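/- **Theorem 6 (Green's formula for $\triangle'$).** Let $n>2$ and let $Cl_n$ be the real Clifford algebra generated by $e_1,\dots,e_n$ with $e_ie_j+e_je_i=-2\delta_{ij}$; vectors of $\mathbb R^n$ are regarded as elements of $Cl_n$. Let $Cl_{n-1}$ be the subalgebra generated by $e_1,\dots,e_{n-1}$. Every $A\in Cl_n$ is uniquely $A=B+Ce_n$ with $B,C\in Cl_{n-1}$; put $Q(A)=C$ and $Q'(A)=-e_nQ(A)e_n$. Let $R^{n,+}=\{x\in\mathbb R^n:x_n>0\}$, $D=\sum_{j=1}^n e_j\frac{\partial}{\partial x_j}$, and $$Mf=Df+\frac{n-2}{x_n}Q'(f),\qquad \triangle'_{R^{n,+}}f=\triangle f-\frac{n-2}{x_n}\frac{\partial f}{\partial x_n}+\frac{n-2}{x_n^2}f .$$ For $y\in R^{n,+}$ let $\hat y=y-2y_ne_n$, and let $$H(x,y)=\frac{1}{(n-2)\,\|x-y\|^{n-2}\|x-\hat y\|^{n-2}},\qquad q(x,y)=DH(x,y),$$ with $D$ acting in $x$. Let $\omega_n$ be the surface area of the unit sphere in $\mathbb R^n$. Let $U\subset R^{n,+}$ be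 a bounded domain with piecewise $C^1$ (for example, piecewise smooth) boundary, that is: $\partial U$ has finite $(n-1)$-dimensional area and, outside a subset of area zero, it is locally a $C^1$ hypersurface with $U$ on one side of it. Let $\sigma$ be the surface measure and $n(x)$ the outer unit normal on $\partial U$. Let $u:U\to Cl_{n-1}e_n$ be a $C^2$ solution of $\triangle'_{R^{n,+}}u=0$ such that $u$ and $Mu$ extend continuously to the closure of $U$. Then for each $y\in U$ the integral below converges absolutely and $$u(y)=-\frac{2^{n-2}y_n^{n-2}}{\omega_n}\,Q\left(\int_{\partial U}\Big(H(x,y)\,n(x)\,Mu(x)-q(x,y)\,n(x)\,u(x)\Big)\,d\sigma(x)\right)e_n .$$ -/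

import Mathlib

open scoped MeasureTheory

noncomputable section

namespace HypGreen

/-! ### Euclidean space and upper half space -/

/-- Euclidean space `R^n`, with coordinates indexed by `Fin n`. -/
abbrev E (n : ℕ) : Type := EuclideanSpace ℝ (Fin n)

/-- The index of the last coordinate `x_n`. -/
def lastIdx (n : ℕ) [NeZero n] : Fin n := ⟨n - 1, Nat.sub_lt (NeZero.pos n) one_pos⟩

/-- The standard basis vector `e_j` of `R^n`. -/
def stdVec {n : ℕ} (j : Fin n) : E n := EuclideanSpace.single j (1 : ℝ)

/-- Upper half space `{x : x_n > 0}`. -/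
def upperHalfSpace (n : ℕ) [NeZero n] : Set (E n) := {x | 0 < x (lastIdx n)}

/-- The reflection `x̂` of `x` in the hyperplane `x_n = 0`. -/
def reflectLast (n : ℕ) [NeZero n] : E n →ₗ[ℝ] E n where
  toFun x := x - (2 * x (lastIdx n)) • stdVec (lastIdx n)
  map_add' x y := by
    simp only [PiLp.add_apply, mul_add, add_smul]; abel
  map_smul' c x := by
    simp only [PiLp.smul_apply, smul_eq_mul, RingHom.id_apply, smul_sub, smul_smul]
    congr 2; ring

theorem norm_reflectLast {n : ℕ} [NeZero n] (x : E n) : ‖reflectLast n x‖ ^ 2 = ‖x‖ ^ 2 := by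
  have h : inner ℝ x (stdVec (lastIdx n)) = x (lastIdx n) := by
    simp [stdVec, EuclideanSpace.inner_single_right]
  have h1 : ‖(stdVec (lastIdx n) : E n)‖ = 1 := by simp [stdVec]
  change ‖x - (2 * x (lastIdx n)) • stdVec (lastIdx n)‖ ^ 2 = _
  rw [norm_sub_sq_real, inner_smul_right, h, norm_smul, h1, mul_one, Real.norm_eq_abs, sq_abs]
  ring

/-! ### The Clifford algebra -/

/-- The negative definite quadratic form `x ↦ -‖x‖²` on `R^n`. -/
def negSq (n : ℕ) : QuadraticForm ℝ (E n) := -LinearMap.BilinMap.toQuadraticMap (innerₗ (E n))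

theorem negSq_apply {n : ℕ} (x : E n) : negSq n x = -‖x‖ ^ 2 := by
  simp [negSq]

/-- The Clifford algebra `Cl_n`, with `e_i e_j + e_j e_i = -2 δ_ij`. -/
abbrev Cl (n : ℕ) : Type := CliffordAlgebra (negSq n)

/-- The inclusion of vectors `R^n ⊆ Cl_n`. -/
def vec {n : ℕ} : E n →ₗ[ℝ] Cl n := CliffordAlgebra.ι (negSq n)

/-- The generator `e_j` of `Cl_n`. -/
def e {n : ℕ} (j : Fin n) : Cl n := vec (stdVec j)

theorem vec_mul_vec {n : ℕ} (x y : E n) :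
    vec x * vec y + vec y * vec x = algebraMap ℝ (Cl n) (-2 * inner ℝ x y) := by
  rw [vec, CliffordAlgebra.ι_mul_ι_add_swap]
  congr 1
  simp only [QuadraticMap.polar, negSq_apply, norm_add_sq_real]
  ring

theorem e_mul_e {n : ℕ} (i j : Fin n) :
    e i * e j + e j * e i = algebraMap ℝ (Cl n) (if i = j then -2 else 0) := by
  rw [e, e, vec_mul_vec]
  congr 1
  by_cases h : i = j
  · simp [stdVec, h]
  · simp [stdVec, h, EuclideanSpace.inner_single_left]

theorem e_sq {n : ℕ} (j : Fin n) : e j * e j = (-1 : Cl n) := by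
  rw [e, vec, CliffordAlgebra.ι_sq_scalar, negSq_apply]
  simp [stdVec]

/-- The basis of `Cl_n` indexed by the subsets `A` of the set of indices; its element at `A` is the
product `e_A`. -/
def clBasis (n : ℕ) : Module.Basis (Finset (Fin n)) ℝ (Cl n) :=
  (Module.Basis.ExteriorAlgebra (EuclideanSpace.basisFun (Fin n) ℝ).toBasis).map
    (CliffordAlgebra.equivExterior (negSq n)).symm

instance instFiniteCl (n : ℕ) : FiniteDimensional ℝ (Cl n) :=
  Module.Finite.of_basis (clBasis n)

/-- The coordinates of an element of `Cl_n` with respect to the basis `e_A`. -/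
def clCoord (n : ℕ) : Cl n →ₗ[ℝ] EuclideanSpace ℝ (Finset (Fin n)) :=
  ((clBasis n).equivFun.trans (WithLp.linearEquiv 2 ℝ (Finset (Fin n) → ℝ)).symm).toLinearMap

theorem clCoord_injective (n : ℕ) : Function.Injective (clCoord n) :=
  ((clBasis n).equivFun.trans
    (WithLp.linearEquiv 2 ℝ (Finset (Fin n) → ℝ)).symm).injective

/-- The norm of `A = ∑ a_A e_A` is `(∑ a_A²)^(1/2)`. -/
instance instNormedCl (n : ℕ) : NormedAddCommGroup (Cl n) :=
  NormedAddCommGroup.induced (Cl n) (EuclideanSpace ℝ (Finset (Fin n))) (clCoord n)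
    (clCoord_injective n)

instance instNormedSpaceCl (n : ℕ) : NormedSpace ℝ (Cl n) :=
  NormedSpace.induced ℝ (Cl n) (EuclideanSpace ℝ (Finset (Fin n))) (clCoord n)

/-- `Cl_{n-1}`, the subalgebra of `Cl_n` generated by `e_1, …, e_{n-1}`. -/
def clSub (n : ℕ) [NeZero n] : Subalgebra ℝ (Cl n) :=
  Algebra.adjoin ℝ {a | ∃ j : Fin n, j ≠ lastIdx n ∧ a = e j}

/-- The automorphism `A = B + C e_n ↦ Â = B - C e_n` of `Cl_n` (for `B, C ∈ Cl_{n-1}`), extending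
the reflection of `R^n`. -/
def clHat (n : ℕ) [NeZero n] : Cl n →ₐ[ℝ] Cl n :=
  CliffordAlgebra.lift (negSq n) ⟨vec ∘ₗ reflectLast n, fun m => by
    change vec (reflectLast n m) * vec (reflectLast n m) = _
    rw [vec, CliffordAlgebra.ι_sq_scalar, negSq_apply, negSq_apply, norm_reflectLast]⟩

/-- The projection `Q : Cl_n → Cl_{n-1}`, `Q (B + C e_n) = C`, through the formula
`Q(A) = -(1/2) (A - Â) e_n`. -/
def clQ {n : ℕ} [NeZero n] (A : Cl n) : Cl n :=
  (-(1 / 2) : ℝ) • ((A - clHat n A) * e (lastIdx n))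

/-- `Q'(A) = -e_n Q(A) e_n`. -/
def clQ' {n : ℕ} [NeZero n] (A : Cl n) : Cl n :=
  -(e (lastIdx n) * clQ A * e (lastIdx n))

theorem clHat_vec {n : ℕ} [NeZero n] (x : E n) : clHat n (vec x) = vec (reflectLast n x) :=
  CliffordAlgebra.lift_ι_apply _ _ x

theorem clHat_e_last {n : ℕ} [NeZero n] : clHat n (e (lastIdx n)) = -e (lastIdx n) := by
  rw [e, clHat_vec, ← map_neg]
  congr 1
  change stdVec _ - _ = _
  simp [stdVec, two_smul]

theorem clHat_of_mem {n : ℕ} [NeZero n] {B : Cl n} (hB : B ∈ clSub n) : clHat n B = B := by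
  have h : clSub n ≤ AlgHom.equalizer (clHat n) (AlgHom.id ℝ (Cl n)) := by
    refine Algebra.adjoin_le ?_
    rintro _ ⟨j, hj, rfl⟩
    change clHat n (e j) = e j
    rw [e, clHat_vec]
    congr 1
    change stdVec _ - _ = _
    simp [stdVec, hj.symm]
  exact h hB

theorem clQ_add_mul {n : ℕ} [NeZero n] {B C : Cl n} (hB : B ∈ clSub n) (hC : C ∈ clSub n) :
    clQ (B + C * e (lastIdx n)) = C := by
  rw [clQ, map_add, map_mul, clHat_of_mem hB, clHat_of_mem hC, clHat_e_last]
  have : (B + C * e (lastIdx n) - (B + C * -e (lastIdx n))) * e (lastIdx n)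
      = (2 : ℝ) • (C * (e (lastIdx n) * e (lastIdx n))) := by
    rw [two_smul]; noncomm_ring
  rw [this, e_sq, smul_smul]
  simp

/-- For `C ∈ Cl_{n-1}` also `-e_n C e_n ∈ Cl_{n-1}`. -/
theorem conj_mem {n : ℕ} [NeZero n] {C : Cl n} (hC : C ∈ clSub n) :
    ∃ C' ∈ clSub n, e (lastIdx n) * C = C' * e (lastIdx n) := by
  induction hC using Algebra.adjoin_induction with
  | mem x hx =>
    obtain ⟨j, hj, rfl⟩ := hx
    refine ⟨-e j, neg_mem (Algebra.subset_adjoin ⟨j, hj, rfl⟩), ?_⟩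
    have h := e_mul_e (lastIdx n) j
    rw [if_neg hj.symm, map_zero] at h
    rw [neg_mul]
    exact eq_neg_of_add_eq_zero_left h
  | algebraMap r => exact ⟨algebraMap ℝ _ r, Subalgebra.algebraMap_mem _ r,
      (Algebra.commutes r _).symm⟩
  | add x y _ _ hx hy =>
    obtain ⟨a, ha, hxa⟩ := hx
    obtain ⟨b, hb, hyb⟩ := hy
    exact ⟨a + b, add_mem ha hb, by rw [mul_add, hxa, hyb, add_mul]⟩
  | mul x y _ _ hx hy =>
    obtain ⟨a, ha, hxa⟩ := hx
    obtain ⟨b, hb, hyb⟩ := hy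
    exact ⟨a * b, mul_mem ha hb, by rw [← mul_assoc, hxa, mul_assoc, hyb, mul_assoc]⟩

theorem vec_eq_sum {n : ℕ} (x : E n) : vec x = ∑ j, x j • (e j : Cl n) := by
  conv_lhs => rw [← (EuclideanSpace.basisFun (Fin n) ℝ).sum_repr x]
  simp [e, stdVec]

/-- `Cl_n = Cl_{n-1} + Cl_{n-1} e_n`. -/
theorem exists_decomp {n : ℕ} [NeZero n] (A : Cl n) :
    ∃ B ∈ clSub n, ∃ C ∈ clSub n, A = B + C * e (lastIdx n) := by
  induction A using CliffordAlgebra.left_induction with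
  | algebraMap r => exact ⟨algebraMap ℝ _ r, Subalgebra.algebraMap_mem _ r, 0, zero_mem _, by simp⟩
  | add x y hx hy =>
    obtain ⟨B, hB, C, hC, rfl⟩ := hx
    obtain ⟨B', hB', C', hC', rfl⟩ := hy
    exact ⟨B + B', add_mem hB hB', C + C', add_mem hC hC', by noncomm_ring⟩
  | ι_mul x m hx =>
    obtain ⟨B, hB, C, hC, rfl⟩ := hx
    obtain ⟨B', hB', hBB⟩ := conj_mem hB
    obtain ⟨C', hC', hCC⟩ := conj_mem hC
    set v : Cl n := ∑ j ∈ Finset.univ.erase (lastIdx n), m j • (e j : Cl n) with hv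
    have hvm : v ∈ clSub n := by
      refine sum_mem fun j hj => Subalgebra.smul_mem _ ?_ _
      exact Algebra.subset_adjoin ⟨j, Finset.ne_of_mem_erase hj, rfl⟩
    have hm : CliffordAlgebra.ι (negSq n) m = v + m (lastIdx n) • e (lastIdx n) := by
      rw [hv, Finset.sum_erase_add _ _ (Finset.mem_univ _)]
      exact vec_eq_sum m
    refine ⟨v * B - m (lastIdx n) • C', sub_mem (mul_mem hvm hB) (Subalgebra.smul_mem _ hC' _),
      v * C + m (lastIdx n) • B', add_mem (mul_mem hvm hC) (Subalgebra.smul_mem _ hB' _), ?_⟩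
    rw [hm, add_mul, smul_mul_assoc, mul_add, mul_add, ← mul_assoc (e _) C, hBB, hCC,
      mul_assoc C', e_sq, add_mul (v * C), smul_mul_assoc, mul_assoc v C]
    simp only [mul_neg, mul_one, smul_add, smul_neg]
    abel

/-! ### Differential operators -/

/-- The partial derivative `∂f/∂x_j`. -/
def pd {n : ℕ} (j : Fin n) (f : E n → Cl n) (x : E n) : Cl n := fderiv ℝ f x (stdVec j)

/-- The Euclidean Dirac operator `D f = ∑ e_j ∂f/∂x_j`. -/
def dirac {n : ℕ} (f : E n → Cl n) (x : E n) : Cl n := ∑ j, e j * pd j f x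

/-- The Dirac-Hodge operator `M f = D f + ((n-2)/x_n) Q'(f)`. -/
def diracHodge {n : ℕ} [NeZero n] (f : E n → Cl n) (x : E n) : Cl n :=
  dirac f x + (((n : ℝ) - 2) / x (lastIdx n)) • clQ' (f x)

/-- The operator `Δ' f = Δ f - ((n-2)/x_n) ∂f/∂x_n + ((n-2)/x_n²) f`, with `Δ` the Euclidean
Laplacian `∑ ∂²/∂x_j²`. -/
def weinstein {n : ℕ} [NeZero n] (f : E n → Cl n) (x : E n) : Cl n :=
  ∑ j, pd j (pd j f) x - (((n : ℝ) - 2) / x (lastIdx n)) • pd (lastIdx n) f x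
    + (((n : ℝ) - 2) / x (lastIdx n) ^ 2) • f x

/-! ### The kernels -/

/-- `H(x,y) = 1 / ((n-2) ‖x-y‖^(n-2) ‖x-ŷ‖^(n-2))`. -/
def kerH {n : ℕ} [NeZero n] (x y : E n) : ℝ :=
  1 / (((n : ℝ) - 2) * ‖x - y‖ ^ (n - 2) * ‖x - reflectLast n y‖ ^ (n - 2))

/-- `q(x,y) = D H(x,y)`, with `D` acting in the variable `x`. -/
def kerq {n : ℕ} [NeZero n] (x y : E n) : Cl n :=
  dirac (fun z => algebraMap ℝ (Cl n) (kerH z y)) x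

/-! ### Surface measure, outer normal, piecewise smooth boundary -/

/-- `ω_n`, the surface area of the unit sphere of `R^n`. -/
def sphereArea (n : ℕ) : ℝ :=
  ((MeasureTheory.volume : MeasureTheory.Measure (E n)).toSphere Set.univ).toReal

/-- Surface measure `σ` of hypersurfaces of `R^n`: the `(n-1)`-dimensional Hausdorff measure,
normalized so as to agree with Lebesgue measure on `R^(n-1)`. -/
def surfaceMeasure (n : ℕ) : MeasureTheory.Measure (E n) :=
  MeasureTheory.Measure.euclideanHausdorffMeasure (n - 1)

/-- `v` is the outer unit normal of `U` at the regular boundary point `x`: near `x` the set `U` is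
`{ρ < 0}` for a `C¹` function `ρ` that vanishes at `x` and whose gradient does not, and
`v = ∇ρ(x) / ‖∇ρ(x)‖`. -/
def IsOuterUnitNormalAt {n : ℕ} (U : Set (E n)) (x v : E n) : Prop :=
  ∃ (V : Set (E n)) (ρ : E n → ℝ), IsOpen V ∧ x ∈ V ∧ ContDiffOn ℝ 1 ρ V ∧ ρ x = 0 ∧
    gradient ρ x ≠ 0 ∧ U ∩ V = {z ∈ V | ρ z < 0} ∧ v = ‖gradient ρ x‖⁻¹ • gradient ρ x

/-- The boundary point `x` of `U` is regular: near `x`, the boundary is a `C¹` hypersurface with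
`U` on one side of it. -/
def IsRegularBoundaryPoint {n : ℕ} (U : Set (E n)) (x : E n) : Prop :=
  ∃ v, IsOuterUnitNormalAt U x v

open Classical in
/-- The outer unit normal `n(x)` at the regular boundary points of `U` (and `0` elsewhere). -/
def outerNormal {n : ℕ} (U : Set (E n)) (x : E n) : E n :=
  if h : IsRegularBoundaryPoint U x then h.choose else 0

/-- The boundary of `U` is piecewise `C¹`: it has finite area, and up to a set of area zero (the
edges and corners) it is a `C¹` hypersurface with `U` on one side of it. -/
structure HasPiecewiseC1Boundary {n : ℕ} (U : Set (E n)) : Prop where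
  finite_area : surfaceMeasure n (frontier U) < ⊤
  null_singular : surfaceMeasure n {x ∈ frontier U | ¬ IsRegularBoundaryPoint U x} = 0

end HypGreen

end

open scoped MeasureTheory

noncomputable section

namespace HypGreen

open Set Filter Topology MeasureTheory InnerProductSpace
open scoped NNReal ENNReal ContDiff Manifold

section

/-! ### Outer normals -/

/-! The field with components $F_j = Q(H e_j Mu - q e_j u)$, built in `greenField`, is divergence
free on $U\setminus\{y\}$, and its flux through $\partial U$ is $Q$ of the integral in the theorem.
So the flux may be computed near the pole $y$, where only the leading part of $F$ counts.

Divergence. Write $\kappa=(n-2)/x_n$. The mixed first-order terms cancel. Symmetry of second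
derivatives and anticommutation turn the second-order sums into Laplacians. As $u$ takes values in
$Cl_{n-1}e_n$, $Q(e_jQ'(u))$ is zero unless $j=n$, when it is $Q(u)$. What remains is $(\triangle
H+\kappa\,\partial_nH)\,Q(u)-H\,Q(\triangle'u)$ (`clQ_divergence_identity`). The second term
vanishes by hypothesis. The first vanishes because $H$ solves the formal adjoint of $\triangle'
u=0$, which is $\triangle h+\kappa\,\partial_nh=0$ (`kerH_pde`).

Pole. Multiplying $F$ by a radial cutoff that is $0$ near $y$ and $1$ near $\partial U$ turns the
flux into an integral over $\varepsilon\le\|x-y\|\le2\varepsilon$. Rescaling gives an integral of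
$\varepsilon^{n-1}F(y+\varepsilon z)$ over a fixed annulus. As $\varepsilon\to0$ the $H$ term drops
out and the $q$ term leaves a multiple of $\sum_i z_ie_ie_ju(y)$. Contracting with $z_j$ gives
$-\|z\|^2u(y)$, and polar coordinates give $-\omega_n(2y_n)^{2-n}Q(u(y))$
(`integral_flux_greenField`). Multiplying by $e_n$ recovers $u(y)$.

Divergence theorem (`integral_divg_eq_integral_flux`). The boundary is $C^1$ only off a null set,
and the fields are $C^1$ only inside $U$. Near a regular boundary point a chart $c$-close to the
identity straightens the boundary. A cutoff in a thin layer and Fubini give an exact formula whose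
boundary measure is Lebesgue measure on a hyperplane, carried back by the chart. The Lipschitz
bounds compare it with Hausdorff measure up to factors $(1\pm c)^{n-1}$, so the error for a test
function $\varphi$ supported in the chart is at most a small constant times $\int_{\partial
U}|\varphi|$. Such errors add up over a partition of unity without growing, and letting the constant
tend to $0$ gives equality for every $\varphi$ vanishing near the singular set. That set is compact
and null, so it is covered by finitely many balls with $\sum r_i^{n-1}$ arbitrarily small. Cutoffs
there have gradients of size $1/r_i$ on sets of volume $r_i^n$, hence small in $L^1$, and the
singular set does not contribute. -/

theorem inner_gradient_eq {n : ℕ} (ρ : E n → ℝ) (x v : E n) :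
    inner ℝ (gradient ρ x) v = fderiv ℝ ρ x v := inner_gradient_left

/-- If a linear functional is nonpositive wherever another one is negative, their representing
vectors point in the same direction. -/
theorem normalized_eq_of_inner_neg_imp {n : ℕ} {a b : E n} (ha : a ≠ 0) (hb : b ≠ 0)
    (h : ∀ w, inner ℝ a w < 0 → inner ℝ b w ≤ 0) : ‖a‖⁻¹ • a = ‖b‖⁻¹ • b := by
  have hna : 0 < ‖a‖ := norm_pos_iff.2 ha
  have hnb : 0 < ‖b‖ := norm_pos_iff.2 hb
  have hle : ∀ w, inner ℝ a w ≤ 0 → inner ℝ b w ≤ 0 := by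
    intro w hw
    by_contra! hbw
    have key : ∀ t : ℝ, 0 < t → inner ℝ b w ≤ t * inner ℝ b a := by
      intro t ht
      have h1 : inner ℝ a (w - t • a) < 0 := by
        rw [inner_sub_right, inner_smul_right, real_inner_self_eq_norm_sq]
        have : 0 < t * ‖a‖ ^ 2 := by positivity
        linarith
      have h2 := h _ h1
      rw [inner_sub_right, inner_smul_right] at h2
      linarith
    have hlim : Tendsto (fun t : ℝ => t * inner ℝ b a) (𝓝[>] 0) (𝓝 (0 * inner ℝ b a)) :=
      ((continuous_id.mul continuous_const).tendsto (0 : ℝ)).mono_left nhdsWithin_le_nhds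
    rw [zero_mul] at hlim
    have := ge_of_tendsto hlim (eventually_mem_nhdsWithin.mono fun t ht => key t ht)
    linarith
  -- This vector is orthogonal to $a$, so the closed form `hle` of the hypothesis applies to both
  -- $w$ and $-w$. Hence $b\perp w$ as well, so $w=0$ and $b$ is a multiple of $a$.
  set w := (inner ℝ a b / ‖a‖ ^ 2) • a - b with hw
  have haw : inner ℝ a w = 0 := by
    rw [hw, inner_sub_right, inner_smul_right, real_inner_self_eq_norm_sq]
    field_simp; ring
  have hbw1 : inner ℝ b w ≤ 0 := hle w haw.le
  have hbw2 : inner ℝ b (-w) ≤ 0 := hle (-w) (by rw [inner_neg_right, haw, neg_zero])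
  rw [inner_neg_right] at hbw2
  have hww : inner ℝ w w = 0 := by
    have h1 : inner ℝ w w = (inner ℝ a b / ‖a‖ ^ 2) * inner ℝ a w - inner ℝ b w := by
      conv_lhs => enter [2]; rw [hw]
      rw [inner_sub_left, inner_smul_left]; simp
    rw [h1, haw]; linarith
  have hw0 : w = 0 := inner_self_eq_zero.1 hww
  have hba : b = (inner ℝ a b / ‖a‖ ^ 2) • a := by
    rw [hw, sub_eq_zero] at hw0; exact hw0.symm
  set k := inner ℝ a b / ‖a‖ ^ 2 with hk
  have hkpos : 0 < k := by
    have hk0 : k ≠ 0 := by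
      intro h0; rw [h0, zero_smul] at hba; exact hb hba
    have := hle (-a) (by rw [inner_neg_right, real_inner_self_eq_norm_sq]; nlinarith)
    rw [hba, inner_neg_right, inner_smul_left, real_inner_self_eq_norm_sq] at this
    simp only [conj_trivial] at this
    have h2 : 0 ≤ k * ‖a‖ ^ 2 := by linarith
    have h3 : 0 ≤ k := nonneg_of_mul_nonneg_left h2 (by positivity)
    exact lt_of_le_of_ne h3 hk0.symm
  rw [hba, norm_smul, smul_smul, Real.norm_of_nonneg hkpos.le]
  congr 1
  field_simp

theorem eventually_neg_of_inner_gradient_neg {n : ℕ} {ρ : E n → ℝ} {x w : E n}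
    (hd : DifferentiableAt ℝ ρ x) (h0 : ρ x = 0) (hw : inner ℝ (gradient ρ x) w < 0) :
    ∀ᶠ t : ℝ in 𝓝[>] 0, ρ (x + t • w) < 0 := by
  rw [inner_gradient_eq] at hw
  have h1 : HasDerivAt (fun t : ℝ => ρ (x + t • w)) (fderiv ℝ ρ x w) 0 := by
    have := hd.hasFDerivAt.hasLineDerivAt w
    exact this
  have h2 := (hasDerivAt_iff_tendsto_slope_zero.1 h1)
  have h3 : ∀ᶠ t : ℝ in 𝓝[>] 0, t⁻¹ • (ρ (x + (0 + t) • w) - ρ (x + (0 : ℝ) • w)) < 0 :=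
    (h2.mono_left (nhdsWithin_mono _ fun t ht => (ne_of_gt ht))).eventually_lt_const hw
  filter_upwards [h3, self_mem_nhdsWithin] with t ht ht0
  simp only [zero_add, zero_smul, add_zero, h0, sub_zero, smul_eq_mul] at ht
  have : (0 : ℝ) < t := ht0
  by_contra! hc
  have : 0 ≤ t⁻¹ * ρ (x + t • w) := by positivity
  linarith

/-- A direction along which one defining function decreases enters $U$. If another one increased
along it, the same short segment would lie outside $U$. This makes the choice in `outerNormal`
harmless: the normal can be computed from any defining function. -/
theorem IsOuterUnitNormalAt.unique {n : ℕ} {U : Set (E n)} {x v w : E n}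
    (hv : IsOuterUnitNormalAt U x v) (hw : IsOuterUnitNormalAt U x w) : v = w := by
  obtain ⟨V, ρ, hVo, hxV, hρ, hρ0, hg, hU, rfl⟩ := hv
  obtain ⟨V', ρ', hVo', hxV', hρ', hρ0', hg', hU', rfl⟩ := hw
  have hd : DifferentiableAt ℝ ρ x :=
    (hρ.contDiffAt (hVo.mem_nhds hxV)).differentiableAt one_ne_zero
  have hd' : DifferentiableAt ℝ ρ' x :=
    (hρ'.contDiffAt (hVo'.mem_nhds hxV')).differentiableAt one_ne_zero
  refine normalized_eq_of_inner_neg_imp hg hg' fun y hy => ?_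
  by_contra! hy'
  have h1 := eventually_neg_of_inner_gradient_neg hd hρ0 hy
  have hneg : gradient (fun z => -ρ' z) x = -gradient ρ' x := by
    simp [gradient]
  have h2 := eventually_neg_of_inner_gradient_neg (ρ := fun z => -ρ' z) (w := y) hd'.neg
    (by simp [hρ0']) (by rw [hneg, inner_neg_left]; linarith)
  have hcont : Tendsto (fun t : ℝ => x + t • y) (𝓝[>] 0) (𝓝 x) := by
    have : Continuous (fun t : ℝ => x + t • y) := by fun_prop
    have h := (this.tendsto 0).mono_left (nhdsWithin_le_nhds (s := Ioi 0))
    simpa using h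
  have h3 := hcont.eventually (hVo.mem_nhds hxV)
  have h4 := hcont.eventually (hVo'.mem_nhds hxV')
  obtain ⟨t, ht1, ht2, ht3, ht4⟩ := (h1.and (h2.and (h3.and h4))).exists
  have hin : x + t • y ∈ U ∩ V := by rw [hU]; exact ⟨ht3, ht1⟩
  have hin' : x + t • y ∈ U ∩ V' := ⟨hin.1, ht4⟩
  rw [hU'] at hin'
  have := hin'.2
  linarith

theorem outerNormal_eq {n : ℕ} {U : Set (E n)} {x v : E n}
    (hv : IsOuterUnitNormalAt U x v) : outerNormal U x = v := by
  have h : IsRegularBoundaryPoint U x := ⟨v, hv⟩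
  rw [outerNormal, dif_pos h]
  exact h.choose_spec.unique hv

theorem norm_outerNormal_le {n : ℕ} (U : Set (E n)) (x : E n) : ‖outerNormal U x‖ ≤ 1 := by
  by_cases h : IsRegularBoundaryPoint U x
  · obtain ⟨v, hv⟩ := h
    rw [outerNormal_eq hv]
    obtain ⟨V, ρ, -, -, -, -, hg, -, rfl⟩ := hv
    rw [norm_smul, norm_inv, norm_norm, inv_mul_cancel₀ (norm_ne_zero_iff.2 hg)]
  · rw [outerNormal, dif_neg h]; simp

/-! ### Boundary charts -/

/-- A chart of `U` near a boundary point `x₀` that straightens the boundary and is `c`-close to the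
identity in the Lipschitz sense; the boundary is mapped to the hyperplane through `x₀` normal to
`ν`. -/
structure BoundaryChart {n : ℕ} (U : Set (E n)) (x₀ : E n) (c : ℝ≥0) where
  /-- the unit normal at `x₀` -/
  ν : E n
  /-- the defining function -/
  ρ : E n → ℝ
  /-- the straightening map -/
  e : OpenPartialHomeomorph (E n) (E n)
  norm_ν : ‖ν‖ = 1
  mem : x₀ ∈ e.source
  contDiffOn : ContDiffOn ℝ 1 ρ e.source
  side : U ∩ e.source = {x ∈ e.source | ρ x < 0}
  fderiv_sub_le : ∀ x ∈ e.source, ∀ v, |fderiv ℝ ρ x v - inner ℝ ν v| ≤ c * ‖v‖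
  coe_e : ∀ x, e x = x + (ρ x - inner ℝ ν (x - x₀)) • ν
  approx : ApproximatesLinearOn e (ContinuousLinearMap.id ℝ (E n)) e.source c

/-- The map replaces the coordinate along $\nu$ by the defining function, rescaled so that its
gradient at $x_0$ is the unit vector $\nu$. Its derivative at $x_0$ is then the identity, and strict
differentiability makes it $c$-close to the identity nearby, hence invertible there. -/
theorem IsRegularBoundaryPoint.nonempty_boundaryChart {n : ℕ} {U : Set (E n)} {x₀ : E n}
    (h : IsRegularBoundaryPoint U x₀) {c : ℝ≥0} (hc0 : 0 < c) (hc1 : c < 1) :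
    Nonempty (BoundaryChart U x₀ c) := by
  obtain ⟨v, V, ρ₀, hVo, hxV, hρ₀, hρ0, hg, hU, rfl⟩ := h
  set ν := ‖gradient ρ₀ x₀‖⁻¹ • gradient ρ₀ x₀ with hν
  have hgpos : 0 < ‖gradient ρ₀ x₀‖ := norm_pos_iff.2 hg
  have hν1 : ‖ν‖ = 1 := by
    rw [hν, norm_smul, norm_inv, norm_norm, inv_mul_cancel₀ hgpos.ne']
  set ρ : E n → ℝ := fun x => ‖gradient ρ₀ x₀‖⁻¹ * ρ₀ x with hρdef
  have hρ : ContDiffOn ℝ 1 ρ V := contDiffOn_const.mul hρ₀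
  have hρat : ContDiffAt ℝ 1 ρ x₀ := hρ.contDiffAt (hVo.mem_nhds hxV)
  have hd₀ : DifferentiableAt ℝ ρ₀ x₀ :=
    (hρ₀.contDiffAt (hVo.mem_nhds hxV)).differentiableAt one_ne_zero
  have hfd : ∀ v, fderiv ℝ ρ x₀ v = inner ℝ ν v := by
    intro v
    rw [hρdef, fderiv_const_mul hd₀, hν, inner_smul_left, inner_gradient_eq]
    simp
  set Ψ : E n → E n := fun x => x + (ρ x - inner ℝ ν (x - x₀)) • ν with hΨ
  have hstrict : HasStrictFDerivAt Ψ (ContinuousLinearMap.id ℝ (E n)) x₀ := by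
    have h1 : HasStrictFDerivAt ρ (fderiv ℝ ρ x₀) x₀ := hρat.hasStrictFDerivAt one_ne_zero
    have h2 : HasStrictFDerivAt (fun x => inner ℝ ν (x - x₀)) (innerSL ℝ ν) x₀ := by
      have := (innerSL ℝ ν).hasStrictFDerivAt (x := x₀)
      have h3 := this.sub_const (inner ℝ ν x₀)
      refine h3.congr_of_eventuallyEq (Eventually.of_forall fun x => ?_)
      simp [inner_sub_right]
    have h3 := (hasStrictFDerivAt_id (𝕜 := ℝ) x₀).add ((h1.sub h2).smul_const ν)
    have heq : fderiv ℝ ρ x₀ - innerSL ℝ ν = 0 := by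
      ext v; simp [hfd]
    rw [heq] at h3
    have : ContinuousLinearMap.id ℝ (E n) + (0 : E n →L[ℝ] ℝ).smulRight ν
        = ContinuousLinearMap.id ℝ (E n) := by ext; simp
    rw [this] at h3
    exact h3
  obtain ⟨s, hs, happ⟩ := hstrict.approximates_deriv_on_nhds (Or.inr hc0)
  have hder : ∀ᶠ x in 𝓝 x₀, ‖fderiv ℝ ρ x - fderiv ℝ ρ x₀‖ ≤ c := by
    have hcont : ContinuousAt (fderiv ℝ ρ) x₀ := (hρat.fderiv_right (m := 0) le_rfl).continuousAt
    have := Metric.continuousAt_iff'.1 hcont c (by exact_mod_cast hc0)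
    filter_upwards [this] with x hx
    rw [← dist_eq_norm]; exact hx.le
  obtain ⟨W, hWsub, hWo, hxW⟩ := mem_nhds_iff.1
    (inter_mem hs (inter_mem (hVo.mem_nhds hxV) hder))
  have happ' : ApproximatesLinearOn Ψ
      ((ContinuousLinearEquiv.refl ℝ (E n) : E n ≃L[ℝ] E n) : E n →L[ℝ] E n) W c :=
    happ.mono_set fun x hx => (hWsub hx).1
  have hcN : Subsingleton (E n) ∨ c < ‖(((ContinuousLinearEquiv.refl ℝ (E n)).symm :
      E n ≃L[ℝ] E n) : E n →L[ℝ] E n)‖₊⁻¹ := by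
    rcases subsingleton_or_nontrivial (E n) with hE | hE
    · exact Or.inl hE
    · right
      have : ‖(((ContinuousLinearEquiv.refl ℝ (E n)).symm :
        E n ≃L[ℝ] E n) : E n →L[ℝ] E n)‖₊ = 1 := by
        ext; exact ContinuousLinearMap.norm_id
      rw [this, inv_one]; exact hc1
  refine ⟨⟨ν, ρ, happ'.toOpenPartialHomeomorph Ψ W hcN hWo, hν1, hxW,
    hρ.mono fun x hx => (hWsub hx).2.1, ?_, ?_, fun x => rfl,
    happ.mono_set fun x hx => (hWsub hx).1⟩⟩
  · ext x
    change x ∈ U ∧ x ∈ W ↔ x ∈ W ∧ ρ x < 0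
    have hsign : ρ x < 0 ↔ ρ₀ x < 0 := by
      have hinv := inv_pos.2 hgpos
      exact ⟨fun h => by by_contra! h'; exact absurd (mul_nonneg hinv.le h') (not_le.2 h),
        fun h => mul_neg_of_pos_of_neg hinv h⟩
    rw [hsign]
    constructor
    · rintro ⟨h1, h2⟩
      have : x ∈ U ∩ V := ⟨h1, (hWsub h2).2.1⟩
      rw [hU] at this
      exact ⟨h2, this.2⟩
    · rintro ⟨h1, h2⟩
      have : x ∈ U ∩ V := by rw [hU]; exact ⟨(hWsub h1).2.1, h2⟩
      exact ⟨this.1, h1⟩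
  · intro x hx v
    have h1 := (hWsub hx).2.2
    rw [← hfd, ← sub_apply, ← Real.norm_eq_abs]
    exact (ContinuousLinearMap.le_opNorm _ _).trans (mul_le_mul_of_nonneg_right h1 (norm_nonneg _))

end

/-! ### Surface measure in a boundary chart -/

section

theorem surfaceMeasure_image_le {n : ℕ} {K : ℝ≥0} {f : E n → E n} {s : Set (E n)}
    (h : LipschitzOnWith K f s) :
    surfaceMeasure n (f '' s) ≤ (K : ℝ≥0∞) ^ (n - 1) * surfaceMeasure n s := by
  rw [surfaceMeasure, Measure.euclideanHausdorffMeasure_def, Measure.smul_apply, Measure.smul_apply,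
    ENNReal.smul_def, ENNReal.smul_def, smul_eq_mul, smul_eq_mul, mul_left_comm]
  gcongr
  have := h.hausdorffMeasure_image_le (d := ((n - 1 : ℕ) : ℝ)) (by positivity)
  rwa [ENNReal.rpow_natCast] at this

namespace BoundaryChart

variable {n : ℕ} {U : Set (E n)} {x₀ : E n} {c : ℝ≥0} (ch : BoundaryChart U x₀ c)

/-- Behind the form of the chart: $U$ becomes a half-space and its boundary a hyperplane. -/
theorem inner_e (x : E n) : inner ℝ ch.ν (ch.e x - x₀) = ch.ρ x := by
  rw [ch.coe_e, add_sub_right_comm, inner_add_right, inner_smul_right, real_inner_self_eq_norm_sq,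
    ch.norm_ν]
  ring

theorem mem_iff {x : E n} (hx : x ∈ ch.e.source) : x ∈ U ↔ ch.ρ x < 0 := by
  have : x ∈ U ∩ ch.e.source ↔ x ∈ {x ∈ ch.e.source | ch.ρ x < 0} := by rw [ch.side]
  simpa [hx] using this

theorem contDiffAt {x : E n} (hx : x ∈ ch.e.source) : ContDiffAt ℝ 1 ch.ρ x :=
  ch.contDiffOn.contDiffAt (ch.e.open_source.mem_nhds hx)

theorem differentiableAt {x : E n} (hx : x ∈ ch.e.source) : DifferentiableAt ℝ ch.ρ x :=
  (ch.contDiffAt hx).differentiableAt one_ne_zero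

theorem continuousAt {x : E n} (hx : x ∈ ch.e.source) : ContinuousAt ch.ρ x :=
  (ch.contDiffAt hx).continuousAt

theorem mem_closure_iff {x : E n} (hx : x ∈ ch.e.source) : x ∈ closure U ↔ ch.ρ x ≤ 0 := by
  constructor
  · intro h
    by_contra! hpos
    have h1 : ∀ᶠ z in 𝓝 x, 0 < ch.ρ z ∧ z ∈ ch.e.source :=
      ((ch.continuousAt hx).eventually (lt_mem_nhds hpos)).and (ch.e.open_source.mem_nhds hx)
    obtain ⟨z, hz, hzU⟩ := mem_closure_iff_nhds.1 h _ h1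
    have := (ch.mem_iff hz.2).1 hzU
    linarith [hz.1]
  · intro h
    -- A point with $\rho\le0$ is reached from inside $U$ by pushing its image along $-\nu$ in the
    -- straightened coordinates.
    have hlim : Tendsto (fun t : ℝ => ch.e.symm (ch.e x - t • ch.ν)) (𝓝[>] 0) (𝓝 x) := by
      have h1 : Tendsto (fun t : ℝ => ch.e x - t • ch.ν) (𝓝[>] 0) (𝓝 (ch.e x)) := by
        have hc : Continuous (fun t : ℝ => ch.e x - t • ch.ν) := by fun_prop
        simpa using (hc.tendsto 0).mono_left (nhdsWithin_le_nhds (s := Ioi 0))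
      exact (ch.e.tendsto_symm hx).comp h1
    have htgt : ∀ᶠ t : ℝ in 𝓝[>] 0, ch.e x - t • ch.ν ∈ ch.e.target := by
      have hc : Continuous (fun t : ℝ => ch.e x - t • ch.ν) := by fun_prop
      have := (hc.tendsto 0).mono_left (nhdsWithin_le_nhds (s := Ioi 0))
      simp only [zero_smul, sub_zero] at this
      exact this.eventually (ch.e.open_target.mem_nhds (ch.e.map_source hx))
    refine mem_closure_of_tendsto hlim ?_
    filter_upwards [htgt, self_mem_nhdsWithin] with t ht ht0
    have ht0' : (0 : ℝ) < t := ht0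
    have hs := ch.e.map_target ht
    rw [ch.mem_iff hs, ← ch.inner_e, ch.e.right_inv ht, sub_right_comm, inner_sub_right, ch.inner_e,
      inner_smul_right, real_inner_self_eq_norm_sq, ch.norm_ν]
    linarith

theorem mem_frontier_iff (hU : IsOpen U) {x : E n} (hx : x ∈ ch.e.source) :
    x ∈ frontier U ↔ ch.ρ x = 0 := by
  rw [hU.frontier_eq, Set.mem_sdiff, ch.mem_closure_iff hx, ch.mem_iff hx]
  constructor
  · rintro ⟨h1, h2⟩; linarith
  · intro h; rw [h]; simp

theorem abs_fderiv_sub_one_le {x : E n} (hx : x ∈ ch.e.source) :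
    |fderiv ℝ ch.ρ x ch.ν - 1| ≤ c := by
  have := ch.fderiv_sub_le x hx ch.ν
  rwa [real_inner_self_eq_norm_sq, ch.norm_ν, one_pow, mul_one] at this

theorem abs_norm_gradient_sub_one_le {x : E n} (hx : x ∈ ch.e.source) :
    |‖gradient ch.ρ x‖ - 1| ≤ c := by
  have h1 : ‖gradient ch.ρ x - ch.ν‖ ≤ c := by
    by_cases h0 : gradient ch.ρ x - ch.ν = 0
    · rw [h0]; simp
    have h2 := ch.fderiv_sub_le x hx (gradient ch.ρ x - ch.ν)
    rw [← inner_gradient_eq, ← inner_sub_left, real_inner_self_eq_norm_sq, abs_of_nonneg (by positivity),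
      sq] at h2
    exact le_of_mul_le_mul_right h2 (norm_pos_iff.2 h0)
  calc |‖gradient ch.ρ x‖ - 1| = |‖gradient ch.ρ x‖ - ‖ch.ν‖| := by rw [ch.norm_ν]
    _ ≤ _ := (abs_norm_sub_norm_le _ _).trans h1

theorem gradient_ne_zero (hc : c < 1) {x : E n} (hx : x ∈ ch.e.source) :
    gradient ch.ρ x ≠ 0 := by
  intro h
  have h1 := ch.abs_norm_gradient_sub_one_le hx
  rw [h, norm_zero, zero_sub, abs_neg, abs_one] at h1
  have : (c : ℝ) < 1 := by exact_mod_cast hc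
  linarith

theorem isOuterUnitNormalAt (hU : IsOpen U) (hc : c < 1) {x : E n} (hx : x ∈ ch.e.source)
    (hxf : x ∈ frontier U) :
    IsOuterUnitNormalAt U x (‖gradient ch.ρ x‖⁻¹ • gradient ch.ρ x) :=
  ⟨ch.e.source, ch.ρ, ch.e.open_source, hx, ch.contDiffOn, (ch.mem_frontier_iff hU hx).1 hxf,
    ch.gradient_ne_zero hc hx, ch.side, rfl⟩

theorem outerNormal_eq (hU : IsOpen U) (hc : c < 1) {x : E n} (hx : x ∈ ch.e.source)
    (hxf : x ∈ frontier U) :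
    outerNormal U x = ‖gradient ch.ρ x‖⁻¹ • gradient ch.ρ x :=
  HypGreen.outerNormal_eq (ch.isOuterUnitNormalAt hU hc hx hxf)

/-- The derivative of the straightening map. -/
def e' (x : E n) : E n →L[ℝ] E n :=
  ContinuousLinearMap.id ℝ (E n) + (fderiv ℝ ch.ρ x - innerSL ℝ ch.ν).smulRight ch.ν

theorem hasFDerivAt_e {x : E n} (hx : x ∈ ch.e.source) : HasFDerivAt ch.e (ch.e' x) x := by
  have h1 : HasFDerivAt ch.ρ (fderiv ℝ ch.ρ x) x := (ch.differentiableAt hx).hasFDerivAt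
  have h2 : HasFDerivAt (fun x => inner ℝ ch.ν (x - x₀)) (innerSL ℝ ch.ν) x := by
    have h3 := ((innerSL ℝ ch.ν).hasFDerivAt (x := x)).sub_const (inner ℝ ch.ν x₀)
    refine h3.congr_of_eventuallyEq (Eventually.of_forall fun x => ?_)
    simp [inner_sub_right]
  have h3 := (hasFDerivAt_id (𝕜 := ℝ) x).add ((h1.sub h2).smul_const ch.ν)
  exact h3.congr_of_eventuallyEq (Eventually.of_forall fun x => ch.coe_e x)

/-- The derivative is the identity plus a rank-one map with image along $\nu$, so its determinant is
one plus the functional at $\nu$; the two ones cancel. -/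
theorem det_e' (x : E n) : (ch.e' x).det = fderiv ℝ ch.ρ x ch.ν := by
  have : ((ch.e' x : E n →L[ℝ] E n) : E n →ₗ[ℝ] E n) =
      LinearMap.transvection ((fderiv ℝ ch.ρ x - innerSL ℝ ch.ν : E n →L[ℝ] ℝ) : E n →ₗ[ℝ] ℝ)
        ch.ν := by
    ext v; simp [e', LinearMap.transvection.apply]
  rw [ContinuousLinearMap.det, this, LinearMap.transvection.det]
  simp [ch.norm_ν]

theorem lipschitzOnWith_e : LipschitzOnWith (1 + c) ch.e ch.e.source := by
  refine LipschitzOnWith.of_dist_le_mul fun x hx y hy => ?_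
  rw [dist_eq_norm, dist_eq_norm]
  have h := ch.approx x hx y hy
  simp only [ContinuousLinearMap.id_apply] at h
  calc ‖ch.e x - ch.e y‖ = ‖(ch.e x - ch.e y - (x - y)) + (x - y)‖ := by congr 1; abel
    _ ≤ c * ‖x - y‖ + ‖x - y‖ := (norm_add_le _ _).trans (by gcongr)
    _ = _ := by push_cast; ring

theorem lipschitzOnWith_symm (hc : c < 1) :
    LipschitzOnWith (1 - c)⁻¹ ch.e.symm ch.e.target := by
  refine LipschitzOnWith.of_dist_le_mul fun x hx y hy => ?_
  rw [dist_eq_norm, dist_eq_norm]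
  have h := ch.approx _ (ch.e.map_target hx) _ (ch.e.map_target hy)
  simp only [ContinuousLinearMap.id_apply, ch.e.right_inv hx, ch.e.right_inv hy] at h
  have hc' : (c : ℝ) < 1 := by exact_mod_cast hc
  rw [NNReal.coe_inv, NNReal.coe_sub hc.le, NNReal.coe_one, inv_mul_eq_div,
    le_div_iff₀ (by linarith)]
  have h2 : ‖ch.e.symm x - ch.e.symm y‖ ≤ ‖x - y‖ + c * ‖ch.e.symm x - ch.e.symm y‖ := by
    calc ‖ch.e.symm x - ch.e.symm y‖
        = ‖(x - y) - (x - y - (ch.e.symm x - ch.e.symm y))‖ := by congr 1; abel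
      _ ≤ _ := (norm_sub_le _ _).trans (by gcongr)
  linarith

theorem surfaceMeasure_image_e_le {A : Set (E n)} (hA : A ⊆ ch.e.source) :
    surfaceMeasure n (ch.e '' A) ≤ (1 + c : ℝ≥0∞) ^ (n - 1) * surfaceMeasure n A := by
  simpa using surfaceMeasure_image_le (ch.lipschitzOnWith_e.mono hA)

theorem le_surfaceMeasure_image_e (hc : c < 1) {A : Set (E n)} (hA : A ⊆ ch.e.source) :
    (1 - c : ℝ≥0∞) ^ (n - 1) * surfaceMeasure n A ≤ surfaceMeasure n (ch.e '' A) := by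
  have h := surfaceMeasure_image_le ((ch.lipschitzOnWith_symm hc).mono
    (s := ch.e '' A) (by rintro _ ⟨x, hx, rfl⟩; exact ch.e.map_source (hA hx)))
  rw [image_image, image_congr (fun x hx => ch.e.left_inv (hA hx)), image_id'] at h
  have h1 : (1 - c : ℝ≥0∞) = ((1 - c : ℝ≥0) : ℝ≥0∞) := by push_cast; rfl
  have h2 : (1 - c : ℝ≥0) ≠ 0 := (tsub_pos_of_lt hc).ne'
  rw [ENNReal.coe_inv h2, ← h1, ← ENNReal.inv_pow] at h
  have h3 : (1 - c : ℝ≥0∞) ^ (n - 1) ≠ 0 := by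
    rw [h1]; exact pow_ne_zero _ (by exact_mod_cast h2)
  have h4 : (1 - c : ℝ≥0∞) ^ (n - 1) ≠ ⊤ := by
    rw [h1]; exact ENNReal.pow_ne_top ENNReal.coe_ne_top
  calc _ ≤ (1 - c : ℝ≥0∞) ^ (n - 1) * (((1 - c : ℝ≥0∞) ^ (n - 1))⁻¹ * _) := by gcongr
    _ = _ := by rw [← mul_assoc, ENNReal.mul_inv_cancel h3 h4, one_mul]

/-- The surface measure of the hyperplane through `x₀`, transported to the boundary. -/
def flatMeasure : Measure (E n) :=
  ((surfaceMeasure n).restrict ({x | inner ℝ ch.ν (x - x₀) = 0} ∩ ch.e.target)).map ch.e.symm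

theorem measurableSet_plane_inter_target :
    MeasurableSet ({x | inner ℝ ch.ν (x - x₀) = 0} ∩ ch.e.target) := by
  refine MeasurableSet.inter ?_ ch.e.open_target.measurableSet
  exact (isClosed_eq (by fun_prop) continuous_const).measurableSet

theorem aemeasurable_symm : AEMeasurable ch.e.symm
    ((surfaceMeasure n).restrict ({x | inner ℝ ch.ν (x - x₀) = 0} ∩ ch.e.target)) :=
  (ch.e.continuousOn_symm.mono inter_subset_right).aemeasurable ch.measurableSet_plane_inter_target

/-- In this form the measure is the Hausdorff measure of a chart image, so the two Lipschitz bounds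
on the chart compare it with surface measure from both sides. -/
theorem flatMeasure_apply (hU : IsOpen U) {A : Set (E n)} (hA : MeasurableSet A) :
    ch.flatMeasure A = surfaceMeasure n (ch.e '' (A ∩ (frontier U ∩ ch.e.source))) := by
  rw [flatMeasure, Measure.map_apply_of_aemeasurable ch.aemeasurable_symm hA,
    Measure.restrict_apply₀' ch.measurableSet_plane_inter_target.nullMeasurableSet]
  congr 1
  ext x
  constructor
  · rintro ⟨h1, h2, h3⟩
    refine ⟨ch.e.symm x, ⟨h1, ?_, ch.e.map_target h3⟩, ch.e.right_inv h3⟩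
    rw [ch.mem_frontier_iff hU (ch.e.map_target h3), ← ch.inner_e, ch.e.right_inv h3]
    exact h2
  · rintro ⟨z, ⟨h1, h2, h3⟩, rfl⟩
    refine ⟨?_, ?_, ch.e.map_source h3⟩
    · rw [mem_preimage, ch.e.left_inv h3]; exact h1
    · rw [mem_ofPred_eq, ch.inner_e]; exact (ch.mem_frontier_iff hU h3).1 h2

theorem flatMeasure_le (hU : IsOpen U) : ch.flatMeasure ≤
    (1 + c : ℝ≥0∞) ^ (n - 1) • (surfaceMeasure n).restrict (frontier U ∩ ch.e.source) := by
  refine Measure.le_iff.2 fun A hA => ?_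
  rw [ch.flatMeasure_apply hU hA, Measure.smul_apply, Measure.restrict_apply hA, smul_eq_mul]
  exact ch.surfaceMeasure_image_e_le fun x hx => hx.2.2

theorem le_flatMeasure (hU : IsOpen U) (hc : c < 1) :
    (1 - c : ℝ≥0∞) ^ (n - 1) • (surfaceMeasure n).restrict (frontier U ∩ ch.e.source) ≤
      ch.flatMeasure := by
  refine Measure.le_iff.2 fun A hA => ?_
  rw [ch.flatMeasure_apply hU hA, Measure.smul_apply, Measure.restrict_apply hA, smul_eq_mul]
  exact ch.le_surfaceMeasure_image_e hc fun x hx => hx.2.2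

end BoundaryChart

/-- Integrals against two measures that are comparable with constants close to one are close. -/
theorem norm_integral_sub_integral_le_of_comparable {α V : Type*} [MeasurableSpace α]
    [NormedAddCommGroup V] [NormedSpace ℝ V] {μ κ : Measure α} [IsFiniteMeasure μ] {a b : ℝ}
    (ha : 0 ≤ a) (ha1 : a ≤ 1) (hb : 0 ≤ b)
    (h1 : ENNReal.ofReal (1 - a) • μ ≤ κ) (h2 : κ ≤ ENNReal.ofReal (1 + b) • μ)
    {f : α → V} (hf : Integrable f μ) :
    ‖∫ x, f x ∂κ - ∫ x, f x ∂μ‖ ≤ (2 * a + b) * ∫ x, ‖f x‖ ∂μ := by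
  set μ' := ENNReal.ofReal (1 - a) • μ with hμ'
  have hfin' : IsFiniteMeasure μ' := Measure.smul_finite _ ENNReal.ofReal_ne_top
  have hκ : κ - μ' + μ' = κ := Measure.sub_add_cancel_of_le h1
  have hbμ : IsFiniteMeasure (ENNReal.ofReal (1 + b) • μ) :=
    Measure.smul_finite _ ENNReal.ofReal_ne_top
  have hκfin : IsFiniteMeasure κ := isFiniteMeasure_of_le _ h2
  have hfκ : Integrable f κ := (hf.smul_measure ENNReal.ofReal_ne_top).mono_measure h2
  have hfμ' : Integrable f μ' := hf.smul_measure ENNReal.ofReal_ne_top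
  -- Subtracting the lower bound $(1-a)\mu$ leaves a positive remainder, at most $(1+b)-(1-a)=a+b$
  -- times $\mu$. Replacing $(1-a)\mu$ by $\mu$ costs a further $a$, whence $2a+b$.
  have hsub : κ - μ' ≤ ENNReal.ofReal (a + b) • μ := by
    refine Measure.le_iff.2 fun s hs => ?_
    rw [Measure.sub_apply hs h1]
    refine tsub_le_iff_right.2 ((h2 s).trans (le_of_eq ?_))
    simp only [hμ', Measure.smul_apply, smul_eq_mul]
    rw [← add_mul, ← ENNReal.ofReal_add (by linarith) (by linarith)]
    congr 2; ring
  have hfs : Integrable f (κ - μ') := hfκ.mono_measure Measure.sub_le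
  have e1 : ∫ x, f x ∂κ = ∫ x, f x ∂(κ - μ') + (1 - a) • ∫ x, f x ∂μ := by
    conv_lhs => rw [← hκ]
    rw [integral_add_measure hfs hfμ', hμ', integral_smul_measure,
      ENNReal.toReal_ofReal (by linarith)]
  have e2 : ‖∫ x, f x ∂(κ - μ')‖ ≤ (a + b) * ∫ x, ‖f x‖ ∂μ := by
    refine (norm_integral_le_integral_norm _).trans ?_
    have := integral_mono_measure hsub (Eventually.of_forall fun x => norm_nonneg (f x))
      (hf.norm.smul_measure ENNReal.ofReal_ne_top)
    rwa [integral_smul_measure, ENNReal.toReal_ofReal (by linarith), smul_eq_mul] at this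
  have e3 : ‖∫ x, f x ∂μ‖ ≤ ∫ x, ‖f x‖ ∂μ := norm_integral_le_integral_norm _
  rw [e1, sub_smul, one_smul]
  calc _ = ‖∫ x, f x ∂(κ - μ') - a • ∫ x, f x ∂μ‖ := by congr 1; abel
    _ ≤ (a + b) * ∫ x, ‖f x‖ ∂μ + a * ∫ x, ‖f x‖ ∂μ := by
      refine (norm_sub_le _ _).trans (add_le_add e2 ?_)
      rw [norm_smul, Real.norm_of_nonneg ha]
      gcongr
    _ = _ := by ring

end

section

/-! ### Integrals of derivatives of compactly supported functions -/

/-- Integration by parts against the constant function $1$. -/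
theorem integral_fderiv_apply_eq_zero {n : ℕ} {V : Type*} [NormedAddCommGroup V] [NormedSpace ℝ V]
    {f : E n → V} (hf : ContDiff ℝ 1 f) (hfc : HasCompactSupport f) (v : E n) :
    ∫ x, fderiv ℝ f x v = 0 := by
  have h1 : Continuous (fun x => fderiv ℝ f x v) := (hf.continuous_fderiv one_ne_zero).clm_apply
    continuous_const
  have h := integral_bilinear_hasFDerivAt_right_eq_neg_left_of_integrable (μ := (volume : Measure (E n)))
    (f := fun _ => (1 : ℝ)) (f' := fun _ => 0) (g := f) (g' := fderiv ℝ f) (v := v)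
    (B := ContinuousLinearMap.lsmul ℝ ℝ) (by simp)
    (by simpa using h1.integrable_of_hasCompactSupport (hfc.fderiv_apply (𝕜 := ℝ) v))
    (by simpa using hf.continuous.integrable_of_hasCompactSupport hfc)
    (fun x _ => hasFDerivAt_const _ _)
    (fun x _ => (hf.differentiable one_ne_zero x).hasFDerivAt)
  simpa using h

/-! ### A step profile -/

/-- A smooth monotone function that is `0` on `(-∞, 1]` and `1` on `[2, ∞)`. -/
def step (t : ℝ) : ℝ := Real.smoothTransition (t - 1)

theorem contDiff_step : ContDiff ℝ ∞ step :=
  Real.smoothTransition.contDiff.comp (contDiff_id.sub contDiff_const)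

theorem step_of_le {t : ℝ} (h : t ≤ 1) : step t = 0 :=
  Real.smoothTransition.zero_of_nonpos (by linarith)

theorem step_of_ge {t : ℝ} (h : 2 ≤ t) : step t = 1 :=
  Real.smoothTransition.one_of_one_le (by linarith)

theorem abs_step_le (t : ℝ) : |step t| ≤ 1 := by
  rw [step, abs_of_nonneg (Real.smoothTransition.nonneg _)]
  exact Real.smoothTransition.le_one _

theorem continuous_deriv_step : Continuous (deriv step) :=
  contDiff_step.continuous_deriv (by simp)

theorem deriv_step_of_le {t : ℝ} (h : t ≤ 1) : deriv step t = 0 := by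
  have h1 : EqOn step (fun _ => 0) (Iio 1) := fun s hs => step_of_le (le_of_lt hs)
  have h2 : EqOn (deriv step) (fun _ => 0) (Iio 1) := fun s hs => by
    have := h1.deriv isOpen_Iio hs; simpa using this
  have h3 := h2.closure continuous_deriv_step continuous_const
  rw [closure_Iio] at h3
  exact h3 h

theorem deriv_step_of_ge {t : ℝ} (h : 2 ≤ t) : deriv step t = 0 := by
  have h1 : EqOn step (fun _ => 1) (Ioi 2) := fun s hs => step_of_ge (le_of_lt hs)
  have h2 : EqOn (deriv step) (fun _ => 0) (Ioi 2) := fun s hs => by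
    have := h1.deriv isOpen_Ioi hs; simpa using this
  have h3 := h2.closure continuous_deriv_step continuous_const
  rw [closure_Ioi] at h3
  exact h3 h

theorem hasCompactSupport_deriv_step : HasCompactSupport (deriv step) :=
  HasCompactSupport.of_support_subset_isCompact isCompact_Icc (K := Icc 1 2) fun t ht => by
    by_contra hc
    rw [mem_Icc, not_and_or, not_le, not_le] at hc
    rcases hc with hc | hc
    · exact ht (deriv_step_of_le hc.le)
    · exact ht (deriv_step_of_ge hc.le)

theorem integrable_deriv_step : Integrable (deriv step) :=
  continuous_deriv_step.integrable_of_hasCompactSupport hasCompactSupport_deriv_step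

theorem integral_deriv_step : ∫ t, deriv step t = 1 := by
  have h := integral_of_hasDerivAt_of_tendsto (f := step) (f' := deriv step) (m := 0) (n := 1)
    (fun t => (contDiff_step.differentiable (by simp) t).hasDerivAt) integrable_deriv_step
    (tendsto_const_nhds.congr' ((eventually_le_atBot 1).mono fun t ht => (step_of_le ht).symm))
    (tendsto_const_nhds.congr' ((eventually_ge_atTop 2).mono fun t ht => (step_of_ge ht).symm))
  simpa using h

/-! ### Slicing by hyperplanes -/

theorem mem_orthogonal_span {n : ℕ} {ν : E n} (w : (ℝ ∙ ν)ᗮ) : inner ℝ ν (w : E n) = 0 :=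
  Submodule.mem_orthogonal_singleton_iff_inner_right.1 w.2

/-- The coordinates `(t, w) ↦ x₀ + t ν + w` with `w ⟂ ν`. -/
theorem measurePreserving_slice {n : ℕ} (x₀ : E n) {ν : E n} (hν : ‖ν‖ = 1) :
    MeasurePreserving (fun p : ℝ × (ℝ ∙ ν)ᗮ => x₀ + (p.1 • ν + (p.2 : E n)))
      (volume.prod volume) volume := by
  have h1 := ((ℝ ∙ ν).measurePreserving_measurableEquivProd x₀).symm
  have h2 : MeasurePreserving (LinearIsometryEquiv.toSpanUnitSingleton (𝕜 := ℝ) ν hν) :=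
    LinearIsometryEquiv.measurePreserving _
  have h3 := h1.comp (h2.prod (MeasurePreserving.id (volume : Measure (ℝ ∙ ν)ᗮ)))
  rw [InnerProductSpace.euclideanHausdorffMeasure_eq_volume] at h3
  have h4 : (fun p : ℝ × (ℝ ∙ ν)ᗮ => x₀ + (p.1 • ν + (p.2 : E n))) =
      ((ℝ ∙ ν).measurableEquivProd x₀).symm ∘
        Prod.map (LinearIsometryEquiv.toSpanUnitSingleton (𝕜 := ℝ) ν hν) id := by
    ext1 p
    simp [add_comm x₀]
  rw [h4]
  exact h3

theorem measurableEmbedding_slice {n : ℕ} (x₀ : E n) {ν : E n} (hν : ‖ν‖ = 1) :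
    MeasurableEmbedding (fun p : ℝ × (ℝ ∙ ν)ᗮ => x₀ + (p.1 • ν + (p.2 : E n))) := by
  have hc : Continuous (fun p : ℝ × (ℝ ∙ ν)ᗮ => x₀ + (p.1 • ν + (p.2 : E n))) := by fun_prop
  refine hc.measurableEmbedding fun p q hpq => ?_
  have h1 : p.1 • ν + (p.2 : E n) = q.1 • ν + (q.2 : E n) := add_left_cancel hpq
  have h2 : p.1 = q.1 := by
    have := congrArg (fun z => inner ℝ ν z) h1
    simpa [inner_add_right, inner_smul_right, mem_orthogonal_span, hν] using this
  refine Prod.ext h2 (Subtype.ext ?_)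
  rw [h2] at h1
  exact add_left_cancel h1

theorem finrank_orthogonal_span {n : ℕ} {ν : E n} (hν : ‖ν‖ = 1) :
    Module.finrank ℝ (ℝ ∙ ν)ᗮ = n - 1 := by
  have hν0 : ν ≠ 0 := by intro h; simp [h] at hν
  have h := (ℝ ∙ ν).finrank_add_finrank_orthogonal
  rw [finrank_span_singleton hν0, finrank_euclideanSpace, Fintype.card_fin] at h
  omega

/-- Translation embeds $\nu^\perp$ isometrically onto the hyperplane. As $\nu^\perp$ has dimension
$n-1$, its Lebesgue measure is the normalized Hausdorff measure used for surfaces. -/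
theorem integral_orthogonal_eq {n : ℕ} {V : Type*} [NormedAddCommGroup V] [NormedSpace ℝ V]
    (x₀ : E n) {ν : E n} (hν : ‖ν‖ = 1) (f : E n → V) :
    ∫ w : (ℝ ∙ ν)ᗮ, f (x₀ + w) =
      ∫ x in {x | inner ℝ ν (x - x₀) = 0}, f x ∂surfaceMeasure n := by
  have hiso : Isometry (fun w : (ℝ ∙ ν)ᗮ => x₀ + (w : E n)) :=
    (isometry_vadd (E n) x₀).comp isometry_subtype_coe
  have h1 := hiso.map_euclideanHausdorffMeasure (d := n - 1)
  have hr : range (fun w : (ℝ ∙ ν)ᗮ => x₀ + (w : E n)) = {x | inner ℝ ν (x - x₀) = 0} := by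
    ext x
    constructor
    · rintro ⟨w, rfl⟩
      simpa using mem_orthogonal_span w
    · intro hx
      exact ⟨⟨x - x₀, Submodule.mem_orthogonal_singleton_iff_inner_right.2 hx⟩, by simp⟩
  rw [hr] at h1
  rw [surfaceMeasure, ← h1, hiso.isClosedEmbedding.measurableEmbedding.integral_map]
  conv_rhs => rw [← finrank_orthogonal_span hν,
    InnerProductSpace.euclideanHausdorffMeasure_eq_volume]

theorem norm_le_norm_slice {n : ℕ} {ν : E n} (t : ℝ) (w : (ℝ ∙ ν)ᗮ) :
    ‖w‖ ≤ ‖t • ν + (w : E n)‖ := by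
  have h : ‖t • ν + (w : E n)‖ * ‖t • ν + (w : E n)‖ = ‖t • ν‖ * ‖t • ν‖ + ‖(w : E n)‖ * ‖(w : E n)‖ :=
    norm_add_sq_eq_norm_sq_add_norm_sq_real (by rw [inner_smul_left, mem_orthogonal_span, mul_zero])
  rw [Submodule.coe_norm]
  refine abs_le_of_sq_le_sq' ?_ (norm_nonneg _) |>.2
  nlinarith [mul_self_nonneg ‖t • ν‖]

/-- A layer of thickness `δ` on one side of a hyperplane, weighted by the derivative of a step
function, converges to the surface measure of the hyperplane. -/
theorem tendsto_layer_integral {n : ℕ} {V : Type*} [NormedAddCommGroup V] [NormedSpace ℝ V]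
    [CompleteSpace V]
    (x₀ : E n) {ν : E n} (hν : ‖ν‖ = 1) {K : E n → V}
    (hK : ContinuousOn K {x | inner ℝ ν (x - x₀) ≤ 0}) {C : Set (E n)} (hC : IsCompact C)
    (hKC : ∀ x ∉ C, K x = 0) :
    Tendsto (fun δ : ℝ => ∫ x, (δ⁻¹ * deriv step (-(inner ℝ ν (x - x₀)) / δ)) • K x) (𝓝[>] 0)
      (𝓝 (∫ x in {x | inner ℝ ν (x - x₀) = 0}, K x ∂surfaceMeasure n)) := by
  set H : Set (E n) := {x | inner ℝ ν (x - x₀) ≤ 0} with hH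
  have hHc : IsClosed H := isClosed_le (by fun_prop) continuous_const
  obtain ⟨M, hM⟩ : ∃ M, ∀ x ∈ H, ‖K x‖ ≤ M := by
    obtain ⟨M, hM⟩ := (hC.inter_right hHc).exists_bound_of_continuousOn (hK.mono inter_subset_right)
    refine ⟨max M 0, fun x hx => ?_⟩
    by_cases hxC : x ∈ C
    · exact (hM x ⟨hxC, hx⟩).trans (le_max_left _ _)
    · rw [hKC x hxC, norm_zero]; exact le_max_right _ _
  have hM0 : 0 ≤ M := (norm_nonneg _).trans (hM x₀ (by simp [hH]))
  obtain ⟨R, hR⟩ := hC.isBounded.subset_closedBall x₀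
  set Φ : ℝ × (ℝ ∙ ν)ᗮ → E n := fun p => x₀ + (p.1 • ν + (p.2 : E n)) with hΦ
  have hinner : ∀ p, inner ℝ ν (Φ p - x₀) = p.1 := by
    intro p
    simp [hΦ, inner_add_right, inner_smul_right, mem_orthogonal_span, hν]
  -- The integral of $K$ over the slice at height $t$. It is continuous only for $t\le0$, the side
  -- on which $K$ is continuous.
  set m : ℝ → V := fun t => ∫ w : (ℝ ∙ ν)ᗮ, K (Φ (t, w)) with hm
  have hbound : ∀ t ∈ Iic (0 : ℝ), ∀ w, ‖K (Φ (t, w))‖ ≤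
      (Metric.closedBall (0 : (ℝ ∙ ν)ᗮ) R).indicator (fun _ => M) w := by
    intro t ht w
    by_cases hw : w ∈ Metric.closedBall (0 : (ℝ ∙ ν)ᗮ) R
    · rw [indicator_of_mem hw]
      exact hM _ (by rw [hH, mem_ofPred_eq, hinner]; exact ht)
    · rw [indicator_of_notMem hw, hKC, norm_zero]
      intro hc
      refine hw ?_
      have h1 := hR hc
      rw [mem_closedBall_iff_norm] at h1 ⊢
      rw [sub_zero]
      refine (norm_le_norm_slice t w).trans ?_
      simpa [hΦ] using h1
  have hbint : Integrable ((Metric.closedBall (0 : (ℝ ∙ ν)ᗮ) R).indicator (fun _ => M)) :=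
    (integrable_indicator_iff Metric.isClosed_closedBall.measurableSet).2
      (integrableOn_const (isCompact_closedBall _ _).measure_lt_top.ne)
  have hmc : ContinuousOn m (Iic 0) := by
    refine continuousOn_of_dominated (bound := (Metric.closedBall (0 : (ℝ ∙ ν)ᗮ) R).indicator
      (fun _ => M)) (fun t ht => ?_) (fun t ht => Eventually.of_forall (hbound t ht)) hbint
      (Eventually.of_forall fun w => ?_)
    · refine Continuous.aestronglyMeasurable ?_
      refine hK.comp_continuous (by fun_prop) fun w => ?_
      rw [mem_ofPred_eq, hinner]; exact ht
    · refine hK.comp (by fun_prop) fun t ht => ?_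
      rw [mem_ofPred_eq, hinner]; exact ht
  have hmb : ∀ t ∈ Iic (0 : ℝ), ‖m t‖ ≤
      ∫ w, (Metric.closedBall (0 : (ℝ ∙ ν)ᗮ) R).indicator (fun _ => M) w := fun t ht =>
    norm_integral_le_of_norm_le hbint (Eventually.of_forall (hbound t ht))
  have hm0 : m 0 = ∫ x in {x | inner ℝ ν (x - x₀) = 0}, K x ∂surfaceMeasure n := by
    rw [← integral_orthogonal_eq x₀ hν]
    simp [hm, hΦ]
  -- Fubini in the slice coordinates, then the substitution $t=-\delta\tau$.
  have hslice : ∀ δ : ℝ, 0 < δ →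
      ∫ x, (δ⁻¹ * deriv step (-(inner ℝ ν (x - x₀)) / δ)) • K x
        = ∫ τ, deriv step τ • m (-δ * τ) := by
    intro δ hδ
    set F : E n → V := fun x => (δ⁻¹ * deriv step (-(inner ℝ ν (x - x₀)) / δ)) • K x with hF
    have hF0 : ∀ x ∉ H, F x = 0 := by
      intro x hx
      rw [hH, mem_ofPred_eq, not_le] at hx
      rw [hF]
      simp only
      rw [deriv_step_of_le, mul_zero, zero_smul]
      exact (div_nonpos_of_nonpos_of_nonneg (by linarith) hδ.le).trans zero_le_one
    have hFc : ContinuousOn F H := by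
      refine ContinuousOn.smul (Continuous.continuousOn ?_) hK
      exact continuous_const.mul (continuous_deriv_step.comp (by fun_prop))
    have hFi : Integrable F := by
      have : F = (C ∩ H).indicator F := by
        ext x
        by_cases hx : x ∈ C ∩ H
        · rw [indicator_of_mem hx]
        · rw [indicator_of_notMem hx]
          rw [mem_inter_iff, not_and_or] at hx
          rcases hx with hx | hx
          · simp [hF, hKC x hx]
          · exact hF0 x hx
      rw [this, integrable_indicator_iff (hC.isClosed.inter hHc).measurableSet]
      exact (hFc.mono inter_subset_right).integrableOn_compact (hC.inter_right hHc)
    have hmp := measurePreserving_slice x₀ hν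
    have hme := measurableEmbedding_slice x₀ hν
    have hFΦ : Integrable (fun p => F (Φ p)) (volume.prod volume) :=
      (hmp.integrable_comp_emb hme).2 hFi
    rw [← hmp.integral_comp hme F, integral_prod _ hFΦ]
    have h1 : ∀ t : ℝ, ∫ w : (ℝ ∙ ν)ᗮ, F (Φ (t, w)) = (δ⁻¹ * deriv step (-t / δ)) • m t := by
      intro t
      simp only [hF, hinner]
      rw [integral_smul]
    simp only [h1]
    have h2 := Measure.integral_comp_mul_left (fun t => (δ⁻¹ * deriv step (-t / δ)) • m t) (-δ)
    have h3 : ∀ τ : ℝ, (δ⁻¹ * deriv step (-(-δ * τ) / δ)) • m (-δ * τ)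
        = δ⁻¹ • (deriv step τ • m (-δ * τ)) := by
      intro τ
      rw [smul_smul]
      congr 3
      field_simp
    simp only [h3] at h2
    rw [integral_smul, inv_neg, abs_neg, abs_of_pos (inv_pos.2 hδ)] at h2
    exact (smul_right_injective V (inv_pos.2 hδ).ne' h2).symm
  have hlim : Tendsto (fun δ : ℝ => ∫ τ, deriv step τ • m (-δ * τ)) (𝓝[>] 0)
      (𝓝 (∫ τ, deriv step τ • m 0)) := by
    -- The derivative of the step lives on $[1,2]$, so only slices strictly on the good side are
    -- used and the one-sided continuity of `m` suffices.
    have hneg : ∀ δ : ℝ, 0 < δ → ∀ τ : ℝ, deriv step τ ≠ 0 → -δ * τ ∈ Iic (0 : ℝ) := by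
      intro δ hδ τ hτ
      have : 1 < τ := by
        by_contra! hc; exact hτ (deriv_step_of_le hc)
      rw [mem_Iic]; nlinarith
    set B := ∫ w, (Metric.closedBall (0 : (ℝ ∙ ν)ᗮ) R).indicator (fun _ => M) w with hB
    refine tendsto_integral_filter_of_dominated_convergence (fun τ => ‖deriv step τ‖ * B) ?_ ?_
      (integrable_deriv_step.norm.mul_const _) ?_
    · filter_upwards [self_mem_nhdsWithin] with δ hδ
      have hδ' : (0 : ℝ) < δ := hδ
      have : (fun τ => deriv step τ • m (-δ * τ)) =
          (Ici (0 : ℝ)).indicator (fun τ => deriv step τ • m (-δ * τ)) := by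
        ext τ
        by_cases hτ : τ ∈ Ici (0 : ℝ)
        · rw [indicator_of_mem hτ]
        · rw [indicator_of_notMem hτ, deriv_step_of_le, zero_smul]
          rw [mem_Ici, not_le] at hτ
          linarith
      rw [this, aestronglyMeasurable_indicator_iff measurableSet_Ici]
      refine ContinuousOn.aestronglyMeasurable ?_ measurableSet_Ici
      refine continuous_deriv_step.continuousOn.smul (hmc.comp (by fun_prop) fun τ hτ => ?_)
      rw [mem_Ici] at hτ
      rw [mem_Iic]; nlinarith
    · filter_upwards [self_mem_nhdsWithin] with δ hδ
      refine Eventually.of_forall fun τ => ?_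
      rw [norm_smul]
      by_cases hτ : deriv step τ = 0
      · simp [hτ]
      · exact mul_le_mul_of_nonneg_left (hmb _ (hneg δ hδ τ hτ)) (norm_nonneg _)
    · refine Eventually.of_forall fun τ => ?_
      by_cases hτ : deriv step τ = 0
      · simp [hτ]
      · refine Tendsto.smul tendsto_const_nhds ?_
        have h1 : Tendsto m (𝓝[Iic 0] 0) (𝓝 (m 0)) := hmc 0 (by simp)
        refine h1.comp (tendsto_nhdsWithin_iff.2 ⟨?_, ?_⟩)
        · have hc : Continuous (fun δ : ℝ => -δ * τ) := by fun_prop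
          simpa using (hc.tendsto 0).mono_left (nhdsWithin_le_nhds (s := Ioi 0))
        · filter_upwards [self_mem_nhdsWithin] with δ hδ using hneg δ hδ τ hτ
  rw [integral_smul_const, integral_deriv_step, one_smul, hm0] at hlim
  refine hlim.congr' ?_
  filter_upwards [self_mem_nhdsWithin] with δ hδ using (hslice δ hδ).symm

end

/-! ### Divergence, flux, and cutoffs near the boundary -/

section

section VectorFields

variable {n : ℕ} {V : Type*} [NormedAddCommGroup V] [NormedSpace ℝ V]

/-- The divergence of the `V`-valued vector field with components `G j`. -/
def divg (G : Fin n → E n → V) (x : E n) : V := ∑ j, fderiv ℝ (G j) x (stdVec j)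

/-- The component of a vector field in the direction `v`. -/
def flux (G : Fin n → E n → V) (v x : E n) : V := ∑ j, v j • G j x

/-- The component of a vector field in the direction of the gradient of `φ`. -/
def gradFlux (φ : E n → ℝ) (G : Fin n → E n → V) (x : E n) : V :=
  ∑ j, fderiv ℝ φ x (stdVec j) • G j x

/-- Vector fields to which the divergence theorem on `U` applies: they are continuous up to the
boundary, continuously differentiable inside, and their divergence is integrable. -/
structure Admissible (U : Set (E n)) (G : Fin n → E n → V) : Prop where
  continuousOn : ∀ j, ContinuousOn (G j) (closure U)
  contDiffOn : ∀ j, ContDiffOn ℝ 1 (G j) U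
  integrableOn : IntegrableOn (divg G) U

theorem gradFlux_eq_flux (φ : E n → ℝ) (G : Fin n → E n → V) (x : E n) :
    gradFlux φ G x = flux G (gradient φ x) x := by
  refine Finset.sum_congr rfl fun j _ => ?_
  congr 1
  rw [← inner_gradient_eq, stdVec, EuclideanSpace.inner_single_right]
  simp

theorem norm_flux_le {G : Fin n → E n → V} {v x : E n} {M : ℝ} (hM : ∀ j, ‖G j x‖ ≤ M) :
    ‖flux G v x‖ ≤ n * (‖v‖ * M) := by
  refine (norm_sum_le _ _).trans ?_
  have : ∀ j ∈ Finset.univ, ‖v j • G j x‖ ≤ ‖v‖ * M := fun j _ => by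
    rw [norm_smul]
    exact mul_le_mul (PiLp.norm_apply_le v j) (hM j) (norm_nonneg _) (norm_nonneg _)
  refine (Finset.sum_le_sum this).trans ?_
  simp

theorem flux_smul_left (G : Fin n → E n → V) (c : ℝ) (v x : E n) :
    flux G (c • v) x = c • flux G v x := by
  simp [flux, Finset.smul_sum, smul_smul]

theorem Admissible.exists_bound {U : Set (E n)} {G : Fin n → E n → V} (hG : Admissible U G)
    (hb : Bornology.IsBounded U) : ∃ M, 0 ≤ M ∧ ∀ j, ∀ x ∈ closure U, ‖G j x‖ ≤ M := by
  have hc : IsCompact (closure U) := hb.isCompact_closure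
  choose M hM using fun j => hc.exists_bound_of_continuousOn (hG.continuousOn j)
  refine ⟨∑ j, |M j|, by positivity, fun j x hx => (hM j x hx).trans ?_⟩
  exact (le_abs_self _).trans
    (Finset.single_le_sum (f := fun j => |M j|) (fun i _ => abs_nonneg _) (Finset.mem_univ j))

theorem continuousOn_gradFlux {φ : E n → ℝ} {G : Fin n → E n → V} {s : Set (E n)}
    (hφ : ContinuousOn (fderiv ℝ φ) s) (hG : ∀ j, ContinuousOn (G j) s) :
    ContinuousOn (gradFlux φ G) s :=
  continuousOn_finsetSum _ fun j _ => (hφ.clm_apply continuousOn_const).smul (hG j)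

theorem Admissible.integrableOn_cutoff {U : Set (E n)} {G : Fin n → E n → V}
    (hG : Admissible U G) (hU : IsOpen U) (hb : Bornology.IsBounded U) {φ : E n → ℝ}
    (hφ : ContDiff ℝ 1 φ) :
    IntegrableOn (fun x => φ x • divg G x + gradFlux φ G x) U := by
  have hc : IsCompact (closure U) := hb.isCompact_closure
  refine Integrable.add ?_ ?_
  · obtain ⟨M, hM⟩ := hc.exists_bound_of_continuousOn hφ.continuous.continuousOn
    exact Integrable.bdd_smul hG.integrableOn M hφ.continuous.aestronglyMeasurable
      (ae_restrict_of_forall_mem hU.measurableSet fun x hx => hM x (subset_closure hx))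
  · have := (continuousOn_gradFlux (hφ.continuous_fderiv one_ne_zero).continuousOn
      hG.continuousOn).integrableOn_compact (μ := volume) hc
    exact this.mono_set subset_closure

theorem gradFlux_eq_zero_of_notMem {φ : E n → ℝ} (G : Fin n → E n → V) {x : E n}
    (hx : x ∉ tsupport φ) : gradFlux φ G x = 0 := by
  have : fderiv ℝ φ x = 0 := by
    have h := notMem_tsupport_iff_eventuallyEq.1 hx
    rw [h.fderiv_eq]; simp
  simp [gradFlux, this]

theorem divg_smul {f : E n → ℝ} {G : Fin n → E n → V} {x : E n} (hf : DifferentiableAt ℝ f x)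
    (hG : ∀ j, DifferentiableAt ℝ (G j) x) :
    divg (fun j x => f x • G j x) x = f x • divg G x + gradFlux f G x := by
  rw [divg, divg, gradFlux, Finset.smul_sum, ← Finset.sum_add_distrib]
  refine Finset.sum_congr rfl fun j _ => ?_
  rw [fderiv_fun_smul hf (hG j)]
  simp

theorem gradFlux_mul {f g : E n → ℝ} {G : Fin n → E n → V} {x : E n}
    (hf : DifferentiableAt ℝ f x) (hg : DifferentiableAt ℝ g x) :
    gradFlux (fun x => f x * g x) G x = f x • gradFlux g G x + g x • gradFlux f G x := by
  simp only [gradFlux, Finset.smul_sum, ← Finset.sum_add_distrib]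
  refine Finset.sum_congr rfl fun j _ => ?_
  rw [fderiv_fun_mul hf hg]
  simp [add_smul, smul_smul]

end VectorFields

namespace BoundaryChart

variable {n : ℕ} {U : Set (E n)} {x₀ : E n} {c : ℝ≥0} (ch : BoundaryChart U x₀ c)
  {V : Type*} [NormedAddCommGroup V] [NormedSpace ℝ V]

/-- The function on the boundary whose integral with respect to the transported hyperplane measure
is the flux of `φ G`. -/
def density (φ : E n → ℝ) (G : Fin n → E n → V) (x : E n) : V :=
  (fderiv ℝ ch.ρ x ch.ν)⁻¹ • φ x • gradFlux ch.ρ G x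

theorem fderiv_apply_pos (hc : c < 1) {x : E n} (hx : x ∈ ch.e.source) :
    0 < fderiv ℝ ch.ρ x ch.ν := by
  have h1 := (abs_le.1 (ch.abs_fderiv_sub_one_le hx)).1
  have h2 : (c : ℝ) < 1 := by exact_mod_cast hc
  linarith

theorem continuousOn_fderiv : ContinuousOn (fderiv ℝ ch.ρ) ch.e.source :=
  ch.contDiffOn.continuousOn_fderiv_of_isOpen ch.e.open_source le_rfl

theorem continuousOn_density (hc : c < 1) {φ : E n → ℝ} (hφ : Continuous φ) {G : Fin n → E n → V}
    (hG : ∀ j, ContinuousOn (G j) (closure U)) :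
    ContinuousOn (ch.density φ G) (closure U ∩ ch.e.source) := by
  have h1 : ContinuousOn (fderiv ℝ ch.ρ) (closure U ∩ ch.e.source) :=
    ch.continuousOn_fderiv.mono inter_subset_right
  refine ContinuousOn.smul (ContinuousOn.inv₀ (h1.clm_apply continuousOn_const)
    fun x hx => (ch.fderiv_apply_pos hc hx.2).ne') (hφ.continuousOn.smul ?_)
  exact continuousOn_gradFlux h1 fun j => (hG j).mono inter_subset_left

/-- The cutoff of `φ G` by a step function of the defining function. -/
theorem contDiff_step_mul_smul {φ : E n → ℝ} (hφ : ContDiff ℝ 1 φ)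
    (hsupp : tsupport φ ⊆ ch.e.source) {g : E n → V} (hU : IsOpen U) (hg : ContDiffOn ℝ 1 g U)
    {δ : ℝ} (hδ : 0 < δ) :
    ContDiff ℝ 1 (fun x => (step (-ch.ρ x / δ) * φ x) • g x) := by
  refine contDiff_iff_contDiffAt.2 fun x => ?_
  by_cases hx : x ∈ tsupport φ
  · by_cases hρ : ch.ρ x < 0
    · refine ContDiffAt.smul (ContDiffAt.mul ?_ hφ.contDiffAt)
        (hg.contDiffAt (hU.mem_nhds ((ch.mem_iff (hsupp hx)).2 hρ)))
      exact (contDiff_step.of_le (by simp)).contDiffAt.comp x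
        ((ch.contDiffAt (hsupp hx)).neg.div_const δ)
    -- The step vanishes wherever $\rho>-\delta$, hence on a neighbourhood of every point with
    -- $\rho\ge0$. The cut field therefore extends by zero across the boundary, whatever `g` does
    -- outside $U$.
    · have h1 : ∀ᶠ z in 𝓝 x, -δ < ch.ρ z :=
        (ch.continuousAt (hsupp hx)).eventually (lt_mem_nhds (by linarith))
      refine (contDiffAt_const (c := (0 : V))).congr_of_eventuallyEq ?_
      filter_upwards [h1] with z hz
      rw [step_of_le, zero_mul, zero_smul]
      rw [div_le_one hδ]; linarith
  · refine (contDiffAt_const (c := (0 : V))).congr_of_eventuallyEq ?_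
    filter_upwards [notMem_tsupport_iff_eventuallyEq.1 hx] with z hz
    rw [hz]; simp

theorem hasCompactSupport_step_mul_smul {φ : E n → ℝ} (hφ : HasCompactSupport φ) (g : E n → V)
    (δ : ℝ) : HasCompactSupport (fun x => (step (-ch.ρ x / δ) * φ x) • g x) :=
  hφ.mono fun x hx => by
    rw [Function.mem_support] at hx ⊢
    intro h; rw [h] at hx; simp at hx

theorem divg_step_mul_smul {φ : E n → ℝ} (hφ : ContDiff ℝ 1 φ)
    (hU : IsOpen U) {G : Fin n → E n → V}
    (hG : ∀ j, ContDiffOn ℝ 1 (G j) U) (δ : ℝ) {x : E n} (hx : x ∈ U ∩ ch.e.source) :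
    divg (fun j x => (step (-ch.ρ x / δ) * φ x) • G j x) x =
      step (-ch.ρ x / δ) • (φ x • divg G x + gradFlux φ G x)
        - (δ⁻¹ * deriv step (-ch.ρ x / δ)) • φ x • gradFlux ch.ρ G x := by
  have hdφ : DifferentiableAt ℝ φ x := hφ.differentiable one_ne_zero x
  have hdρ := ch.differentiableAt hx.2
  have hds : HasFDerivAt (fun x => step (-ch.ρ x / δ))
      (deriv step (-ch.ρ x / δ) • (-(δ⁻¹ • fderiv ℝ ch.ρ x))) x := by
    have h1 : HasDerivAt step (deriv step (-ch.ρ x / δ)) (-ch.ρ x / δ) :=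
      (contDiff_step.differentiable (by simp) _).hasDerivAt
    have h2 : HasFDerivAt (fun x => -ch.ρ x / δ) (-(δ⁻¹ • fderiv ℝ ch.ρ x)) x := by
      refine (hdρ.hasFDerivAt.const_smul δ⁻¹).neg.congr_of_eventuallyEq
        (Eventually.of_forall fun z => ?_)
      simp only [Pi.neg_apply, Pi.smul_apply, smul_eq_mul]
      ring
    have h3 := h1.comp_hasFDerivAt x h2
    exact h3
  have hg1 : gradFlux (fun x => step (-ch.ρ x / δ)) G x
      = -((δ⁻¹ * deriv step (-ch.ρ x / δ)) • gradFlux ch.ρ G x) := by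
    simp only [gradFlux, hds.fderiv, Finset.smul_sum, ← Finset.sum_neg_distrib]
    refine Finset.sum_congr rfl fun j _ => ?_
    simp only [smul_apply, smul_eq_mul, smul_smul, ← neg_smul]
    congr 1; ring
  rw [divg_smul (f := fun x => step (-ch.ρ x / δ) * φ x) (hds.differentiableAt.fun_mul hdφ) (fun j => ((hG j).contDiffAt
    (hU.mem_nhds hx.1)).differentiableAt one_ne_zero), gradFlux_mul hds.differentiableAt hdφ, hg1]
  simp only [smul_add, smul_smul, smul_neg, mul_comm (φ x)]
  abel

theorem divg_step_mul_smul_eq_zero {φ : E n → ℝ} (hsupp : tsupport φ ⊆ ch.e.source)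
    (G : Fin n → E n → V) {δ : ℝ} (hδ : 0 < δ) {x : E n} (hx : x ∉ U ∩ ch.e.source) :
    divg (fun j x => (step (-ch.ρ x / δ) * φ x) • G j x) x = 0 := by
  refine Finset.sum_eq_zero fun j _ => ?_
  have : (fun x => (step (-ch.ρ x / δ) * φ x) • G j x) =ᶠ[𝓝 x] fun _ => 0 := by
    by_cases hxs : x ∈ tsupport φ
    · have hρ : 0 ≤ ch.ρ x := by
        by_contra! hc
        exact hx ⟨(ch.mem_iff (hsupp hxs)).2 hc, hsupp hxs⟩
      have h1 : ∀ᶠ z in 𝓝 x, -δ < ch.ρ z :=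
        (ch.continuousAt (hsupp hxs)).eventually (lt_mem_nhds (by linarith))
      filter_upwards [h1] with z hz
      rw [step_of_le, zero_mul, zero_smul]
      rw [div_le_one hδ]; linarith
    · filter_upwards [notMem_tsupport_iff_eventuallyEq.1 hxs] with z hz
      rw [hz]; simp
  rw [this.fderiv_eq]; simp

/-- The cutoff identity: the volume integral equals an integral over a thin layer. -/
theorem integral_step_eq (hU : IsOpen U) (hb : Bornology.IsBounded U) {G : Fin n → E n → V}
    (hG : Admissible U G) {φ : E n → ℝ} (hφ : ContDiff ℝ 1 φ) (hφc : HasCompactSupport φ)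
    (hsupp : tsupport φ ⊆ ch.e.source) {δ : ℝ} (hδ : 0 < δ) :
    ∫ x in U ∩ ch.e.source, step (-ch.ρ x / δ) • (φ x • divg G x + gradFlux φ G x) =
      ∫ x in U ∩ ch.e.source, (δ⁻¹ * deriv step (-ch.ρ x / δ)) • φ x • gradFlux ch.ρ G x := by
  set S := U ∩ ch.e.source with hS
  have hSm : MeasurableSet S := (hU.inter ch.e.open_source).measurableSet
  set Y : Fin n → E n → V := fun j x => (step (-ch.ρ x / δ) * φ x) • G j x with hY
  have hYd : ∀ j, ContDiff ℝ 1 (Y j) := fun j =>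
    ch.contDiff_step_mul_smul hφ hsupp hU (hG.contDiffOn j) hδ
  have hYc : ∀ j, HasCompactSupport (Y j) := fun j =>
    ch.hasCompactSupport_step_mul_smul hφc (G j) δ
  have hYi : ∀ j, Integrable (fun x => fderiv ℝ (Y j) x (stdVec j)) := fun j =>
    (((hYd j).continuous_fderiv one_ne_zero).clm_apply
      continuous_const).integrable_of_hasCompactSupport ((hYc j).fderiv_apply (𝕜 := ℝ) _)
  have hdi : Integrable (divg Y) := integrable_finsetSum _ fun j _ => hYi j
  have h0 : ∫ x, divg Y x = 0 := by
    rw [show (fun x => divg Y x) = fun x => ∑ j, fderiv ℝ (Y j) x (stdVec j) from rfl,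
      integral_finsetSum _ fun j _ => hYi j]
    exact Finset.sum_eq_zero fun j _ => integral_fderiv_apply_eq_zero (hYd j) (hYc j) _
  have h1 : ∫ x in S, divg Y x = 0 := by
    rw [setIntegral_eq_integral_of_forall_compl_eq_zero, h0]
    exact fun x hx => ch.divg_step_mul_smul_eq_zero hsupp G hδ hx
  have hA : IntegrableOn (fun x => step (-ch.ρ x / δ) • (φ x • divg G x + gradFlux φ G x)) S := by
    refine Integrable.bdd_smul ((hG.integrableOn_cutoff hU hb hφ).mono_set inter_subset_left) 1 ?_
      (Eventually.of_forall fun x => abs_step_le _)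
    refine ContinuousOn.aestronglyMeasurable ?_ hSm
    exact contDiff_step.continuous.comp_continuousOn
      ((ch.contDiffOn.continuousOn.mono inter_subset_right).neg.div_const δ)
  -- Only the whole divergence of the cut field, not the separate partial derivatives of `G`, enters
  -- the estimates: the latter need not be integrable up to the boundary.
  have hB : ∀ x ∈ S, (δ⁻¹ * deriv step (-ch.ρ x / δ)) • φ x • gradFlux ch.ρ G x =
      step (-ch.ρ x / δ) • (φ x • divg G x + gradFlux φ G x) - divg Y x := by
    intro x hx
    rw [hY, ch.divg_step_mul_smul hφ hU hG.contDiffOn δ hx]; abel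
  rw [setIntegral_congr_fun hSm hB, integral_sub hA hdi.integrableOn, h1, sub_zero]

end BoundaryChart

end

/-! ### The local divergence theorem in straightened coordinates -/

section

namespace BoundaryChart

variable {n : ℕ} {U : Set (E n)} {x₀ : E n} {c : ℝ≥0} (ch : BoundaryChart U x₀ c)
  {V : Type*} [NormedAddCommGroup V] [NormedSpace ℝ V]

/-- The density read in the straightened coordinates. -/
def flatDensity (φ : E n → ℝ) (G : Fin n → E n → V) : E n → V :=
  ch.e.target.indicator fun z => ch.density φ G (ch.e.symm z)

theorem density_eq_zero {φ : E n → ℝ} (G : Fin n → E n → V) {x : E n} (hx : x ∉ tsupport φ) :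
    ch.density φ G x = 0 := by
  rw [density, image_eq_zero_of_notMem_tsupport hx]; simp

theorem flatDensity_eq_zero {φ : E n → ℝ} (G : Fin n → E n → V) {z : E n}
    (hz : z ∉ ch.e '' tsupport φ) : ch.flatDensity φ G z = 0 := by
  by_cases hzt : z ∈ ch.e.target
  · rw [flatDensity, indicator_of_mem hzt]
    refine ch.density_eq_zero G fun h => hz ⟨_, h, ch.e.right_inv hzt⟩
  · rw [flatDensity, indicator_of_notMem hzt]

theorem isCompact_image_tsupport {φ : E n → ℝ} (hφc : HasCompactSupport φ)
    (hsupp : tsupport φ ⊆ ch.e.source) : IsCompact (ch.e '' tsupport φ) :=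
  IsCompact.image_of_continuousOn hφc (ch.e.continuousOn.mono hsupp)

/-- On the closed half-space the inverse chart lands in $\overline U$, where `G` is continuous. The
extension by zero is continuous because the support of `φ` has compact image inside the target. -/
theorem continuousOn_flatDensity (hc : c < 1) {φ : E n → ℝ} (hφ : Continuous φ)
    (hφc : HasCompactSupport φ) (hsupp : tsupport φ ⊆ ch.e.source) {G : Fin n → E n → V}
    (hG : ∀ j, ContinuousOn (G j) (closure U)) :
    ContinuousOn (ch.flatDensity φ G) {x | inner ℝ ch.ν (x - x₀) ≤ 0} := by
  intro z hz
  by_cases hzC : z ∈ ch.e '' tsupport φ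
  · have hzt : z ∈ ch.e.target := by
      obtain ⟨x, hx, rfl⟩ := hzC; exact ch.e.map_source (hsupp hx)
    have h1 : ContinuousOn (fun z => ch.density φ G (ch.e.symm z))
        ({x | inner ℝ ch.ν (x - x₀) ≤ 0} ∩ ch.e.target) := by
      refine (ch.continuousOn_density hc hφ hG).comp
        (ch.e.continuousOn_symm.mono inter_subset_right) fun y hy => ?_
      refine ⟨(ch.mem_closure_iff (ch.e.map_target hy.2)).2 ?_, ch.e.map_target hy.2⟩
      rw [← ch.inner_e, ch.e.right_inv hy.2]; exact hy.1
    have h2 := (h1 z ⟨hz, hzt⟩).congr (g := ch.flatDensity φ G)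
      (fun y hy => indicator_of_mem hy.2 _) (indicator_of_mem hzt _)
    exact (continuousWithinAt_inter (ch.e.open_target.mem_nhds hzt)).1 h2
  · have : ch.flatDensity φ G =ᶠ[𝓝 z] fun _ => 0 := by
      filter_upwards [(ch.isCompact_image_tsupport hφc hsupp).isClosed.isOpen_compl.mem_nhds hzC]
        with y hy using ch.flatDensity_eq_zero G hy
    exact (continuousAt_const.congr this.symm).continuousWithinAt

/-- Change of variables by the chart. Its Jacobian $\partial_\nu\rho$ cancels the inverse factor in
`density`, which is there for this purpose. Nothing is added by enlarging the domain: the step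
derivative vanishes on the side $\rho\ge0$. -/
theorem layer_integral_eq (hc : c < 1) {φ : E n → ℝ} (G : Fin n → E n → V) (hU : IsOpen U)
    {δ : ℝ} (hδ : 0 < δ) :
    ∫ x in U ∩ ch.e.source, (δ⁻¹ * deriv step (-ch.ρ x / δ)) • φ x • gradFlux ch.ρ G x =
      ∫ x, (δ⁻¹ * deriv step (-(inner ℝ ch.ν (x - x₀)) / δ)) • ch.flatDensity φ G x := by
  set S := U ∩ ch.e.source with hS
  have hSm : MeasurableSet S := (hU.inter ch.e.open_source).measurableSet
  set g : E n → V := fun z =>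
    (δ⁻¹ * deriv step (-(inner ℝ ch.ν (z - x₀)) / δ)) • ch.flatDensity φ G z with hg
  have h1 := integral_image_eq_integral_abs_det_fderiv_smul volume hSm (f := ch.e) (f' := ch.e')
    (fun x hx => (ch.hasFDerivAt_e hx.2).hasFDerivWithinAt)
    (ch.e.injOn.mono inter_subset_right) g
  have h2 : ∫ z in ch.e '' S, g z = ∫ z, g z := by
    refine setIntegral_eq_integral_of_forall_compl_eq_zero fun z hz => ?_
    by_cases hzt : z ∈ ch.e.target
    · have hs := ch.e.map_target hzt
      have hρ : 0 ≤ ch.ρ (ch.e.symm z) := by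
        by_contra! hc
        exact hz ⟨_, ⟨(ch.mem_iff hs).2 hc, hs⟩, ch.e.right_inv hzt⟩
      rw [← ch.inner_e, ch.e.right_inv hzt] at hρ
      rw [hg]
      simp only
      rw [deriv_step_of_le, mul_zero, zero_smul]
      exact (div_nonpos_of_nonpos_of_nonneg (by linarith) hδ.le).trans zero_le_one
    · simp [hg, flatDensity, indicator_of_notMem hzt]
  rw [← h2, h1]
  refine setIntegral_congr_fun hSm fun x hx => ?_
  have hpos := ch.fderiv_apply_pos hc hx.2
  simp only [hg, ch.inner_e, flatDensity, indicator_of_mem (ch.e.map_source hx.2),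
    ch.e.left_inv hx.2, density, ch.det_e', abs_of_pos hpos, smul_smul]
  congr 1
  field_simp

theorem integrableOn_density (hc : c < 1)
    (hfin : surfaceMeasure n (frontier U) < ⊤) {φ : E n → ℝ} (hφ : Continuous φ)
    (hφc : HasCompactSupport φ) (hsupp : tsupport φ ⊆ ch.e.source) {G : Fin n → E n → V}
    (hG : ∀ j, ContinuousOn (G j) (closure U)) :
    IntegrableOn (ch.density φ G) (frontier U ∩ ch.e.source) (surfaceMeasure n) := by
  have h1 : ContinuousOn (ch.density φ G) (frontier U ∩ tsupport φ) :=
    (ch.continuousOn_density hc hφ hG).mono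
      (inter_subset_inter frontier_subset_closure hsupp)
  have hcpt : IsCompact (frontier U ∩ tsupport φ) := hφc.isCompact.inter_left isClosed_frontier
  have h2 : IntegrableOn (ch.density φ G) (frontier U ∩ tsupport φ) (surfaceMeasure n) :=
    h1.integrableOn_of_subset_isCompact hcpt hcpt.measurableSet subset_rfl
      ((measure_mono inter_subset_left).trans_lt hfin).ne
  refine h2.of_forall_sdiff_eq_zero (isClosed_frontier.measurableSet.inter
    ch.e.open_source.measurableSet) fun x hx => ch.density_eq_zero G fun h => hx.2 ⟨hx.1.1, h⟩

theorem integral_flatDensity [CompleteSpace V] (hc : c < 1) (hU : IsOpen U)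
    (hfin : surfaceMeasure n (frontier U) < ⊤) {φ : E n → ℝ} (hφ : Continuous φ)
    (hφc : HasCompactSupport φ) (hsupp : tsupport φ ⊆ ch.e.source) {G : Fin n → E n → V}
    (hG : ∀ j, ContinuousOn (G j) (closure U)) :
    ∫ x in {x | inner ℝ ch.ν (x - x₀) = 0}, ch.flatDensity φ G x ∂surfaceMeasure n =
      ∫ x, ch.density φ G x ∂ch.flatMeasure := by
  have hac : AEStronglyMeasurable (ch.density φ G) ch.flatMeasure :=
    ((ch.integrableOn_density hc hfin hφ hφc hsupp hG).1.smul_measure _).mono_measure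
      (ch.flatMeasure_le hU)
  rw [flatMeasure, integral_map ch.aemeasurable_symm hac]
  have := setIntegral_indicator (μ := surfaceMeasure n) (s := {x | inner ℝ ch.ν (x - x₀) = 0})
    ch.e.open_target.measurableSet (f := fun z => ch.density φ G (ch.e.symm z))
  exact this

/-- The local divergence theorem, with the boundary integral in the straightened coordinates. -/
theorem integral_eq_integral_flatMeasure [CompleteSpace V] (hc : c < 1) (hU : IsOpen U)
    (hb : Bornology.IsBounded U) (hfin : surfaceMeasure n (frontier U) < ⊤)
    {G : Fin n → E n → V} (hG : Admissible U G) {φ : E n → ℝ} (hφ : ContDiff ℝ 1 φ)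
    (hφc : HasCompactSupport φ) (hsupp : tsupport φ ⊆ ch.e.source) :
    ∫ x in U, (φ x • divg G x + gradFlux φ G x) = ∫ x, ch.density φ G x ∂ch.flatMeasure := by
  have hSm : MeasurableSet (U ∩ ch.e.source) := (hU.inter ch.e.open_source).measurableSet
  have hlim1 := tendsto_layer_integral x₀ ch.norm_ν
    (ch.continuousOn_flatDensity hc hφ.continuous hφc hsupp hG.continuousOn)
    (ch.isCompact_image_tsupport hφc hsupp) (fun x hx => ch.flatDensity_eq_zero G hx)
  rw [ch.integral_flatDensity hc hU hfin hφ.continuous hφc hsupp hG.continuousOn] at hlim1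
  have hint := (hG.integrableOn_cutoff hU hb hφ).mono_set (inter_subset_left (t := ch.e.source))
  -- At each fixed point of $U$ the step is eventually $1$ as the layer shrinks, so dominated
  -- convergence restores the full volume integral.
  have hlim2 : Tendsto (fun δ : ℝ => ∫ x in U ∩ ch.e.source,
      step (-ch.ρ x / δ) • (φ x • divg G x + gradFlux φ G x)) (𝓝[>] 0)
      (𝓝 (∫ x in U ∩ ch.e.source, (φ x • divg G x + gradFlux φ G x))) := by
    refine tendsto_integral_filter_of_dominated_convergence
      (fun x => ‖φ x • divg G x + gradFlux φ G x‖) (Eventually.of_forall fun δ => ?_)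
      (Eventually.of_forall fun δ => Eventually.of_forall fun x => ?_) hint.norm
      (ae_restrict_of_forall_mem hSm fun x hx => ?_)
    · refine AEStronglyMeasurable.smul (ContinuousOn.aestronglyMeasurable ?_ hSm) hint.1
      exact contDiff_step.continuous.comp_continuousOn
        ((ch.contDiffOn.continuousOn.mono inter_subset_right).neg.div_const δ)
    · rw [norm_smul]
      exact mul_le_of_le_one_left (norm_nonneg _) (abs_step_le _)
    · have hρ := (ch.mem_iff hx.2).1 hx.1
      refine tendsto_const_nhds.congr' ?_
      have : Ioo 0 (-ch.ρ x / 2) ∈ 𝓝[>] (0 : ℝ) := Ioo_mem_nhdsGT (by linarith)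
      filter_upwards [this] with δ hδ
      rw [step_of_ge, one_smul]
      rw [le_div_iff₀ hδ.1]; linarith [hδ.2]
  have heq : ∫ x in U, (φ x • divg G x + gradFlux φ G x) =
      ∫ x in U ∩ ch.e.source, (φ x • divg G x + gradFlux φ G x) := by
    refine setIntegral_eq_of_subset_of_forall_sdiff_eq_zero hU.measurableSet inter_subset_left
      fun x hx => ?_
    have hx' : x ∉ tsupport φ := fun h => hx.2 ⟨hx.1, hsupp h⟩
    simp only [gradFlux_eq_zero_of_notMem G hx', image_eq_zero_of_notMem_tsupport hx', zero_smul, add_zero]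
  rw [heq]
  refine tendsto_nhds_unique hlim2 (hlim1.congr' ?_)
  filter_upwards [self_mem_nhdsWithin] with δ hδ
  rw [ch.integral_step_eq hU hb hG hφ hφc hsupp hδ, ch.layer_integral_eq hc G hU hδ]

end BoundaryChart

end

section

/-! ### The boundary integrand -/

/-- The edges and corners of the boundary. -/
def singularSet {n : ℕ} (U : Set (E n)) : Set (E n) :=
  {x ∈ frontier U | ¬ IsRegularBoundaryPoint U x}

/-- Regularity is an open condition on the boundary: the chart at a regular point exhibits a normal
at every boundary point in its source. -/
theorem isClosed_singularSet {n : ℕ} {U : Set (E n)} (hU : IsOpen U) :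
    IsClosed (singularSet U) := by
  refine isClosed_of_closure_subset fun x hx => ?_
  have hxf : x ∈ frontier U := closure_minimal (fun z hz => hz.1) isClosed_frontier hx
  refine ⟨hxf, fun hreg => ?_⟩
  obtain ⟨ch⟩ := hreg.nonempty_boundaryChart (c := 1 / 2) (by norm_num) (by norm_num)
  obtain ⟨z, hz, hzS⟩ := mem_closure_iff_nhds.1 hx _ (ch.e.open_source.mem_nhds ch.mem)
  exact hzS.2 ⟨_, ch.isOuterUnitNormalAt hU (by norm_num) hz hzS.1⟩

/-- By uniqueness of the normal, it is the normalized gradient of one $C^1$ function near each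
regular point. With the null singular set removed, this gives measurability of a function defined by
choice. -/
theorem continuousOn_outerNormal {n : ℕ} {U : Set (E n)} (hU : IsOpen U) :
    ContinuousOn (outerNormal U) (frontier U \ singularSet U) := by
  intro x hx
  have hreg : IsRegularBoundaryPoint U x := by
    by_contra h; exact hx.2 ⟨hx.1, h⟩
  have hc : (1 / 2 : ℝ≥0) < 1 := by norm_num
  obtain ⟨ch⟩ := hreg.nonempty_boundaryChart (c := 1 / 2) (by norm_num) hc
  have hg : ContinuousAt (gradient ch.ρ) x := by
    have h1 : ContinuousAt (fderiv ℝ ch.ρ) x :=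
      ch.continuousOn_fderiv.continuousAt (ch.e.open_source.mem_nhds ch.mem)
    exact ((toDual ℝ (E n)).symm.continuous.continuousAt).comp h1
  have h2 : ContinuousAt (fun z => ‖gradient ch.ρ z‖⁻¹ • gradient ch.ρ z) x :=
    (hg.norm.inv₀ (norm_ne_zero_iff.2 (ch.gradient_ne_zero hc ch.mem))).smul hg
  refine h2.continuousWithinAt.congr_of_eventuallyEq ?_ (ch.outerNormal_eq hU hc ch.mem hx.1)
  filter_upwards [self_mem_nhdsWithin, mem_nhdsWithin_of_mem_nhds
    (ch.e.open_source.mem_nhds ch.mem)] with z hz hzs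
  exact ch.outerNormal_eq hU hc hzs hz.1

theorem aestronglyMeasurable_outerNormal {n : ℕ} {U : Set (E n)} (hU : IsOpen U)
    (hbd : HasPiecewiseC1Boundary U) :
    AEStronglyMeasurable (outerNormal U) ((surfaceMeasure n).restrict (frontier U)) := by
  have hm : MeasurableSet (frontier U \ singularSet U) :=
    isClosed_frontier.measurableSet.diff (isClosed_singularSet hU).measurableSet
  have hae : (frontier U \ singularSet U : Set (E n)) =ᵐ[surfaceMeasure n] frontier U :=
    sdiff_null_ae_eq_self hbd.null_singular
  rw [← Measure.restrict_congr_set hae]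
  exact (continuousOn_outerNormal hU).aestronglyMeasurable hm

section

variable {n : ℕ} {U : Set (E n)} {V : Type*} [NormedAddCommGroup V] [NormedSpace ℝ V]

theorem integrableOn_flux_outerNormal (hU : IsOpen U) (hb : Bornology.IsBounded U)
    (hbd : HasPiecewiseC1Boundary U) {G : Fin n → E n → V}
    (hG : ∀ j, ContinuousOn (G j) (frontier U)) :
    IntegrableOn (fun x => flux G (outerNormal U x) x) (frontier U) (surfaceMeasure n) := by
  have hc : IsCompact (frontier U) :=
    hb.isCompact_closure.of_isClosed_subset isClosed_frontier frontier_subset_closure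
  refine integrable_finsetSum _ fun j _ => ?_
  have hGj : IntegrableOn (G j) (frontier U) (surfaceMeasure n) :=
    (hG j).integrableOn_of_subset_isCompact hc hc.measurableSet subset_rfl hbd.finite_area.ne
  refine Integrable.bdd_smul hGj 1 ?_ (Eventually.of_forall fun x => ?_)
  · exact ((EuclideanSpace.proj j : E n →L[ℝ] ℝ).continuous.comp_aestronglyMeasurable
      (aestronglyMeasurable_outerNormal hU hbd))
  · exact (PiLp.norm_apply_le _ j).trans (norm_outerNormal_le U x)

theorem flux_smul_right (G : Fin n → E n → V) (φ : E n → ℝ) (v x : E n) :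
    flux (fun j x => φ x • G j x) v x = φ x • flux G v x := by
  simp only [flux, Finset.smul_sum]
  exact Finset.sum_congr rfl fun j _ => smul_comm _ _ _

theorem integrableOn_smul_flux_outerNormal (hU : IsOpen U) (hb : Bornology.IsBounded U)
    (hbd : HasPiecewiseC1Boundary U) {G : Fin n → E n → V}
    (hG : ∀ j, ContinuousOn (G j) (frontier U)) {φ : E n → ℝ} (hφ : Continuous φ) :
    IntegrableOn (fun x => φ x • flux G (outerNormal U x) x) (frontier U) (surfaceMeasure n) := by
  have := integrableOn_flux_outerNormal hU hb hbd
    (G := fun j x => φ x • G j x) fun j => hφ.continuousOn.smul (hG j)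
  simpa only [flux_smul_right] using this

/-! ### The defect in the divergence theorem -/

/-- The difference of the two sides of the divergence theorem for `φ G`. -/
def defect (U : Set (E n)) (G : Fin n → E n → V) (φ : E n → ℝ) : V :=
  (∫ x in U, (φ x • divg G x + gradFlux φ G x))
    - ∫ x in frontier U, φ x • flux G (outerNormal U x) x ∂surfaceMeasure n

/-- Agreement on $\overline U$ is enough, because gradients are only evaluated on the open set $U$.
A partition of unity that sums to one only on a compact set can then be used. -/
theorem defect_congr (hU : IsOpen U) (G : Fin n → E n → V) {φ ψ : E n → ℝ}
    (h : EqOn φ ψ (closure U)) : defect U G φ = defect U G ψ := by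
  rw [defect, defect]
  congr 1
  · refine setIntegral_congr_fun hU.measurableSet fun x hx => ?_
    have h1 : φ =ᶠ[𝓝 x] ψ := by
      filter_upwards [hU.mem_nhds hx] with z hz using h (subset_closure hz)
    simp only [gradFlux, h1.fderiv_eq, h (subset_closure hx)]
  · refine setIntegral_congr_fun isClosed_frontier.measurableSet fun x hx => ?_
    simp only [h (frontier_subset_closure hx)]

theorem defect_sum (hU : IsOpen U) (hb : Bornology.IsBounded U) (hbd : HasPiecewiseC1Boundary U)
    {G : Fin n → E n → V} (hG : Admissible U G) {ι : Type*} (s : Finset ι) {φ : ι → E n → ℝ}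
    (hφ : ∀ i, ContDiff ℝ 1 (φ i)) :
    defect U G (fun x => ∑ i ∈ s, φ i x) = ∑ i ∈ s, defect U G (φ i) := by
  simp only [defect, Finset.sum_sub_distrib]
  rw [← integral_finsetSum _ fun i _ => hG.integrableOn_cutoff hU hb (hφ i),
    ← integral_finsetSum _ fun i _ => integrableOn_smul_flux_outerNormal hU hb hbd
      (fun j => (hG.continuousOn j).mono frontier_subset_closure) (hφ i).continuous]
  congr 1
  · congr 1
    ext x
    have h1 : fderiv ℝ (fun x => ∑ i ∈ s, φ i x) x = ∑ i ∈ s, fderiv ℝ (φ i) x :=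
      fderiv_fun_sum fun i _ => (hφ i).differentiable one_ne_zero x
    simp only [gradFlux, h1, Finset.sum_smul, Finset.sum_add_distrib,
      sum_apply]
    congr 1
    exact Finset.sum_comm
  · simp only [Finset.sum_smul]

/-- The field `φ G` extends by zero to a compactly supported $C^1$ field, whose divergence
integrates to zero; the boundary term vanishes. -/
theorem defect_eq_zero_of_tsupport_subset (hU : IsOpen U)
    {G : Fin n → E n → V} (hG : Admissible U G) {φ : E n → ℝ} (hφ : ContDiff ℝ 1 φ)
    (hφc : HasCompactSupport φ) (hsupp : tsupport φ ⊆ U) : defect U G φ = 0 := by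
  set Y : Fin n → E n → V := fun j x => φ x • G j x with hY
  have hz : ∀ x ∉ tsupport φ, ∀ j, Y j =ᶠ[𝓝 x] fun _ => 0 := fun x hx j => by
    filter_upwards [notMem_tsupport_iff_eventuallyEq.1 hx] with z hz
    simp [hY, hz]
  have hYd : ∀ j, ContDiff ℝ 1 (Y j) := fun j => contDiff_iff_contDiffAt.2 fun x => by
    by_cases hx : x ∈ tsupport φ
    · exact hφ.contDiffAt.smul ((hG.contDiffOn j).contDiffAt (hU.mem_nhds (hsupp hx)))
    · exact contDiffAt_const.congr_of_eventuallyEq (hz x hx j)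
  have hYc : ∀ j, HasCompactSupport (Y j) := fun j => hφc.smul_right
  have hYi : ∀ j, Integrable (fun x => fderiv ℝ (Y j) x (stdVec j)) := fun j =>
    (((hYd j).continuous_fderiv one_ne_zero).clm_apply
      continuous_const).integrable_of_hasCompactSupport ((hYc j).fderiv_apply (𝕜 := ℝ) _)
  have h0 : ∫ x, divg Y x = 0 := by
    rw [show (fun x => divg Y x) = fun x => ∑ j, fderiv ℝ (Y j) x (stdVec j) from rfl,
      integral_finsetSum _ fun j _ => hYi j]
    exact Finset.sum_eq_zero fun j _ => integral_fderiv_apply_eq_zero (hYd j) (hYc j) _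
  have h1 : ∫ x in U, divg Y x = 0 := by
    rw [setIntegral_eq_integral_of_forall_compl_eq_zero, h0]
    intro x hx
    refine Finset.sum_eq_zero fun j _ => ?_
    rw [(hz x (fun h => hx (hsupp h)) j).fderiv_eq]; simp
  have h2 : ∫ x in U, (φ x • divg G x + gradFlux φ G x) = 0 := by
    rw [← h1]
    refine setIntegral_congr_fun hU.measurableSet fun x hx => ?_
    exact (divg_smul (hφ.differentiable one_ne_zero x) fun j =>
      ((hG.contDiffOn j).contDiffAt (hU.mem_nhds hx)).differentiableAt one_ne_zero).symm
  have h3 : ∫ x in frontier U, φ x • flux G (outerNormal U x) x ∂surfaceMeasure n = 0 := by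
    refine setIntegral_eq_zero_of_forall_eq_zero fun x hx => ?_
    have : x ∉ tsupport φ := fun h => by
      rw [hU.frontier_eq] at hx; exact hx.2 (hsupp h)
    rw [image_eq_zero_of_notMem_tsupport this, zero_smul]
  rw [defect, h2, h3, sub_zero]

/-- The distortion constant of a chart with parameter `c`. -/
def distortion (n : ℕ) (c : ℝ) : ℝ :=
  (2 * (1 - (1 - c) ^ (n - 1)) + ((1 + c) ^ (n - 1) - 1)) * ((1 - c)⁻¹ * (1 + c))
    + 2 * c * (1 - c)⁻¹ * (1 - c)⁻¹ * (1 + c)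

theorem exists_distortion_lt (n : ℕ) {ε : ℝ} (hε : 0 < ε) :
    ∃ c : ℝ≥0, 0 < c ∧ c < 1 ∧ distortion n c < ε := by
  have hc : ContinuousAt (distortion n) 0 := by
    unfold distortion
    have : ContinuousAt (fun c : ℝ => (1 - c)⁻¹) 0 :=
      (continuousAt_const.sub continuousAt_id).inv₀ (by norm_num)
    fun_prop
  have h0 : distortion n 0 = 0 := by simp [distortion]
  have h1 : ∀ᶠ c : ℝ in 𝓝[>] 0, distortion n c < ε :=
    (hc.mono_left nhdsWithin_le_nhds).eventually_lt_const (by rw [h0]; exact hε)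
  have h2 : Ioo (0 : ℝ) 1 ∈ 𝓝[>] (0 : ℝ) := Ioo_mem_nhdsGT zero_lt_one
  obtain ⟨c, hc1, hc2⟩ := (h1.and h2).exists
  exact ⟨⟨c, hc2.1.le⟩, hc2.1, hc2.2, hc1⟩

/-- Two errors separate the exact local formula from the desired one: the transported hyperplane
measure is not surface measure, and the density carries $1/\partial_\nu\rho$ where the true normal
carries $1/\|\nabla\rho\|$. Both denominators lie within $c$ of $1$. Keeping the bound proportional
to $\int|\varphi|$ is what lets local errors be summed. -/
theorem BoundaryChart.norm_defect_le [CompleteSpace V] {x₀ : E n} {c : ℝ≥0}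
    (ch : BoundaryChart U x₀ c)
    (hc : c < 1) (hU : IsOpen U) (hb : Bornology.IsBounded U) (hbd : HasPiecewiseC1Boundary U)
    {G : Fin n → E n → V} (hG : Admissible U G) {M : ℝ} (hM0 : 0 ≤ M)
    (hM : ∀ j, ∀ x ∈ closure U, ‖G j x‖ ≤ M) {φ : E n → ℝ} (hφ : ContDiff ℝ 1 φ)
    (hφc : HasCompactSupport φ) (hsupp : tsupport φ ⊆ ch.e.source) :
    ‖defect U G φ‖ ≤ distortion n c * (n * M) * ∫ x in frontier U, |φ x| ∂surfaceMeasure n := by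
  have hc' : (c : ℝ) < 1 := by exact_mod_cast hc
  have hc0 : (0 : ℝ) ≤ c := c.2
  set T := frontier U ∩ ch.e.source with hT
  have hTm : MeasurableSet T :=
    isClosed_frontier.measurableSet.inter ch.e.open_source.measurableSet
  set μ := (surfaceMeasure n).restrict T with hμ
  have hμfin : IsFiniteMeasure μ := ⟨by
    rw [hμ, Measure.restrict_apply_univ]
    exact (measure_mono inter_subset_left).trans_lt hbd.finite_area⟩
  have hzero : ∀ x ∈ frontier U \ T, φ x = 0 := fun x hx =>
    image_eq_zero_of_notMem_tsupport fun h => hx.2 ⟨hx.1, hsupp h⟩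
  set N : E n → V := fun x => φ x • flux G (outerNormal U x) x with hN
  have hNi : Integrable N μ := (integrableOn_smul_flux_outerNormal hU hb hbd
    (fun j => (hG.continuousOn j).mono frontier_subset_closure) hφ.continuous).mono_set
      inter_subset_left
  have hfi : Integrable (ch.density φ G) μ :=
    ch.integrableOn_density hc hbd.finite_area hφ.continuous hφc hsupp hG.continuousOn
  have hφi : Integrable (fun x => |φ x|) μ := by
    refine Integrable.mono_measure (ν := (surfaceMeasure n).restrict (frontier U)) ?_
      (Measure.restrict_mono inter_subset_left le_rfl)
    have hcpt : IsCompact (frontier U) :=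
      hb.isCompact_closure.of_isClosed_subset isClosed_frontier frontier_subset_closure
    exact hφ.continuous.abs.continuousOn.integrableOn_of_subset_isCompact hcpt hcpt.measurableSet
      subset_rfl hbd.finite_area.ne
  have e1 : ∫ x in frontier U, N x ∂surfaceMeasure n = ∫ x, N x ∂μ :=
    setIntegral_eq_of_subset_of_forall_sdiff_eq_zero isClosed_frontier.measurableSet
      inter_subset_left fun x hx => by simp [hN, hzero x hx]
  have e2 : ∫ x in frontier U, |φ x| ∂surfaceMeasure n = ∫ x, |φ x| ∂μ :=
    setIntegral_eq_of_subset_of_forall_sdiff_eq_zero isClosed_frontier.measurableSet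
      inter_subset_left fun x hx => by simp [hzero x hx]
  have hgrad : ∀ x ∈ T, ‖gradFlux ch.ρ G x‖ ≤ (1 + c) * (n * M) := by
    intro x hx
    rw [gradFlux_eq_flux]
    refine (norm_flux_le fun j => hM j x (frontier_subset_closure hx.1)).trans ?_
    have h1 := (abs_le.1 (ch.abs_norm_gradient_sub_one_le hx.2)).2
    calc (n : ℝ) * (‖gradient ch.ρ x‖ * M) ≤ n * ((1 + c) * M) := by gcongr; linarith
      _ = _ := by ring
  have hd : ∀ x ∈ T, (fderiv ℝ ch.ρ x ch.ν)⁻¹ ≤ (1 - c : ℝ)⁻¹ := by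
    intro x hx
    have h1 := (abs_le.1 (ch.abs_fderiv_sub_one_le hx.2)).1
    exact inv_anti₀ (by linarith) (by linarith)
  have hdens : ∀ x ∈ T, ‖ch.density φ G x‖ ≤ (1 - c : ℝ)⁻¹ * (1 + c) * (n * M) * |φ x| := by
    intro x hx
    have hp := ch.fderiv_apply_pos hc hx.2
    rw [BoundaryChart.density, norm_smul, norm_smul, Real.norm_of_nonneg (inv_pos.2 hp).le,
      Real.norm_eq_abs]
    calc _ ≤ (1 - c : ℝ)⁻¹ * (|φ x| * ((1 + c) * (n * M))) :=
          mul_le_mul (hd x hx) (mul_le_mul_of_nonneg_left (hgrad x hx) (abs_nonneg _))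
            (by positivity) (inv_nonneg.2 (by linarith))
      _ = _ := by ring
  have hdiff : ∀ x ∈ T, ‖ch.density φ G x - N x‖ ≤
      2 * c * (1 - c : ℝ)⁻¹ * (1 - c : ℝ)⁻¹ * (1 + c) * (n * M) * |φ x| := by
    intro x hx
    have hp := ch.fderiv_apply_pos hc hx.2
    have hq : 0 < ‖gradient ch.ρ x‖ := norm_pos_iff.2 (ch.gradient_ne_zero hc hx.2)
    have h1 := abs_le.1 (ch.abs_fderiv_sub_one_le hx.2)
    have h2 := abs_le.1 (ch.abs_norm_gradient_sub_one_le hx.2)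
    have hq' : ‖gradient ch.ρ x‖⁻¹ ≤ (1 - c : ℝ)⁻¹ := inv_anti₀ (by linarith) (by linarith)
    have hNx : N x = ‖gradient ch.ρ x‖⁻¹ • φ x • gradFlux ch.ρ G x := by
      rw [hN, gradFlux_eq_flux, smul_comm, ← flux_smul_left]
      simp only
      rw [ch.outerNormal_eq hU hc hx.2 hx.1]
    have hinv : |(fderiv ℝ ch.ρ x ch.ν)⁻¹ - ‖gradient ch.ρ x‖⁻¹| ≤
        2 * c * (1 - c : ℝ)⁻¹ * (1 - c : ℝ)⁻¹ := by
      rw [inv_sub_inv hp.ne' hq.ne', abs_div, abs_of_pos (mul_pos hp hq), div_eq_mul_inv, mul_inv,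
        mul_assoc (2 * (c : ℝ))]
      have h3 : |‖gradient ch.ρ x‖ - fderiv ℝ ch.ρ x ch.ν| ≤ 2 * c := by
        rw [abs_le]; constructor <;> linarith
      have := hd x hx
      have h4 : 0 ≤ (1 - c : ℝ)⁻¹ := inv_nonneg.2 (by linarith)
      gcongr
    rw [hNx, BoundaryChart.density, ← sub_smul, norm_smul, norm_smul, Real.norm_eq_abs,
      Real.norm_eq_abs]
    calc _ ≤ (2 * c * (1 - c : ℝ)⁻¹ * (1 - c : ℝ)⁻¹) * (|φ x| * ((1 + c) * (n * M))) := by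
          gcongr
          exact hgrad x hx
      _ = _ := by ring
  have hpow1 : (1 - c : ℝ) ^ (n - 1) ≤ 1 := pow_le_one₀ (by linarith) (by linarith)
  have hpow0 : 0 ≤ (1 - c : ℝ) ^ (n - 1) := pow_nonneg (by linarith) _
  have hpow2 : 1 ≤ (1 + c : ℝ) ^ (n - 1) := one_le_pow₀ (by linarith)
  have hcmp := norm_integral_sub_integral_le_of_comparable (μ := μ) (κ := ch.flatMeasure)
    (a := 1 - (1 - c : ℝ) ^ (n - 1)) (b := (1 + c : ℝ) ^ (n - 1) - 1) (by linarith) (by linarith)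
    (by linarith)
    (by
      have h := ch.le_flatMeasure hU hc
      have h1 : ENNReal.ofReal (1 - (1 - (1 - c : ℝ) ^ (n - 1))) = (1 - c : ℝ≥0∞) ^ (n - 1) := by
        rw [sub_sub_cancel, ENNReal.ofReal_pow (by linarith), ENNReal.ofReal_sub _ hc0]
        simp
      rw [h1]; exact h)
    (by
      have h := ch.flatMeasure_le hU
      have h1 : ENNReal.ofReal (1 + ((1 + c : ℝ) ^ (n - 1) - 1)) = (1 + c : ℝ≥0∞) ^ (n - 1) := by
        rw [add_sub_cancel, ENNReal.ofReal_pow (by linarith), ENNReal.ofReal_add zero_le_one hc0]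
        simp
      rw [h1]; exact h) hfi
  have hb1 : ∫ x, ‖ch.density φ G x‖ ∂μ ≤ (1 - c : ℝ)⁻¹ * (1 + c) * (n * M) * ∫ x, |φ x| ∂μ := by
    rw [← integral_const_mul]
    exact integral_mono_ae hfi.norm (hφi.const_mul _) (ae_restrict_of_forall_mem hTm hdens)
  have hb2 : ‖∫ x, ch.density φ G x ∂μ - ∫ x, N x ∂μ‖ ≤
      2 * c * (1 - c : ℝ)⁻¹ * (1 - c : ℝ)⁻¹ * (1 + c) * (n * M) * ∫ x, |φ x| ∂μ := by
    rw [← integral_sub hfi hNi, ← integral_const_mul]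
    exact norm_integral_le_of_norm_le (hφi.const_mul _) (ae_restrict_of_forall_mem hTm hdiff)
  rw [defect, ch.integral_eq_integral_flatMeasure hc hU hb hbd.finite_area hG hφ hφc hsupp, e1, e2]
  calc _ = ‖(∫ x, ch.density φ G x ∂ch.flatMeasure - ∫ x, ch.density φ G x ∂μ)
        + (∫ x, ch.density φ G x ∂μ - ∫ x, N x ∂μ)‖ := by congr 1; abel
    _ ≤ _ := norm_add_le _ _
    _ ≤ (2 * (1 - (1 - c : ℝ) ^ (n - 1)) + ((1 + c : ℝ) ^ (n - 1) - 1)) *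
          ((1 - c : ℝ)⁻¹ * (1 + c) * (n * M) * ∫ x, |φ x| ∂μ) +
        2 * c * (1 - c : ℝ)⁻¹ * (1 - c : ℝ)⁻¹ * (1 + c) * (n * M) * ∫ x, |φ x| ∂μ := by
      refine add_le_add (hcmp.trans ?_) hb2
      refine mul_le_mul_of_nonneg_left hb1 (by linarith)
    _ = _ := by rw [distortion]; ring

end

end

section

/-! ### Coverings of sets of area zero -/

theorem hausdorffMeasure_eq_zero_of_surfaceMeasure {n : ℕ} {S : Set (E n)}
    (h : surfaceMeasure n S = 0) : Measure.hausdorffMeasure ((n - 1 : ℕ) : ℝ) S = 0 := by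
  rw [surfaceMeasure, Measure.euclideanHausdorffMeasure_def, Measure.smul_apply, ENNReal.smul_def,
    smul_eq_mul, mul_eq_zero, ENNReal.coe_eq_zero] at h
  exact h.resolve_left (Measure.addHaarScalarFactor_volume_hausdorffMeasure_ne_zero _)

/-- A compact set of area zero is covered by finitely many small balls centered on it, the sum of
whose radii to the power `n - 1` is small. -/
theorem exists_finite_cover_of_surfaceMeasure_eq_zero {n : ℕ} (hn : 2 ≤ n) {S : Set (E n)}
    (hSc : IsCompact S) (hS : surfaceMeasure n S = 0) {ε : ℝ} (hε : 0 < ε) :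
    ∃ (s : Finset ℕ) (x : ℕ → E n) (r : ℕ → ℝ), (∀ i ∈ s, x i ∈ S) ∧ (∀ i, 0 < r i) ∧
      (∀ i, r i < ε) ∧ S ⊆ ⋃ i ∈ s, Metric.ball (x i) (r i) ∧ ∑ i ∈ s, r i ^ (n - 1) < ε := by
  rcases S.eq_empty_or_nonempty with rfl | ⟨s₀, hs₀⟩
  · exact ⟨∅, fun _ => 0, fun _ => ε / 2, by simp, fun _ => by linarith, fun _ => by linarith,
      by simp, by simpa using hε⟩
  have hd : (0 : ℝ) < ((n - 1 : ℕ) : ℝ) := by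
    have : 0 < n - 1 := by omega
    exact_mod_cast this
  have h0 := hausdorffMeasure_eq_zero_of_surfaceMeasure hS
  rw [Measure.hausdorffMeasure_apply] at h0
  -- Every fixed-scale premeasure of a Hausdorff-null set is zero, so covers by sets of diameter at
  -- most $\varepsilon/2$ have arbitrarily small sums.
  have h1 : (⨅ (t : ℕ → Set (E n)) (_ : S ⊆ ⋃ n, t n)
      (_ : ∀ n, Metric.ediam (t n) ≤ ENNReal.ofReal (ε / 2)),
      ∑' i, ⨆ _ : (t i).Nonempty, Metric.ediam (t i) ^ ((n - 1 : ℕ) : ℝ)) < ENNReal.ofReal (ε / 2) := by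
    have h2 : ENNReal.ofReal (ε / 2) ≠ 0 := by
      rw [Ne, ENNReal.ofReal_eq_zero, not_le]; linarith
    have := ENNReal.iSup_eq_zero.1 (ENNReal.iSup_eq_zero.1 h0 (ENNReal.ofReal (ε / 2)))
      (pos_iff_ne_zero.2 h2)
    rw [this]; exact pos_iff_ne_zero.2 h2
  simp only [iInf_lt_iff] at h1
  obtain ⟨t, hcov, hdiam, hsum⟩ := h1
  set D : ℕ → ℝ≥0∞ := fun i => ⨆ _ : (t i).Nonempty, Metric.ediam (t i) ^ ((n - 1 : ℕ) : ℝ) with hD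
  have hDtop : ∑' i, D i ≠ ⊤ := (hsum.trans ENNReal.ofReal_lt_top).ne
  have hdiam_ne : ∀ i, Metric.ediam (t i) ≠ ⊤ := fun i =>
    ((hdiam i).trans_lt ENNReal.ofReal_lt_top).ne
  set d : ℕ → ℝ := fun i => (Metric.ediam (t i)).toReal with hdd
  have hdD : ∀ i, d i ^ (n - 1) = (D i).toReal := by
    intro i
    by_cases hne : (t i).Nonempty
    · simp only [hD, hne, iSup_pos, ENNReal.rpow_natCast, ENNReal.toReal_pow, hdd]
    · rw [not_nonempty_iff_eq_empty] at hne
      have : n - 1 ≠ 0 := by omega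
      simp [hD, hdd, hne, this]
  have hdlt : ∀ i, d i < ε := by
    intro i
    have := ENNReal.toReal_mono ENNReal.ofReal_ne_top (hdiam i)
    rw [ENNReal.toReal_ofReal (by linarith)] at this
    change d i ≤ ε / 2 at this
    linarith
  obtain ⟨δ, hδpos, hδsum⟩ := ENNReal.exists_pos_sum_of_countable
    (ε := ENNReal.ofReal (ε / 2)) (by rw [Ne, ENNReal.ofReal_eq_zero, not_le]; linarith) ℕ
  -- Radii slightly larger than the diameters make the balls open with positive radius even when a
  -- covering set is a single point. The cost in $\sum r_i^{n-1}$ is bounded by a summable sequence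
  -- of total less than $\varepsilon/2$.
  have hr : ∀ i, ∃ r, d i < r ∧ r < ε ∧ r ^ (n - 1) < d i ^ (n - 1) + δ i := by
    intro i
    have hc : Tendsto (fun r : ℝ => r ^ (n - 1)) (𝓝[>] d i) (𝓝 (d i ^ (n - 1))) :=
      ((continuous_pow (n - 1)).tendsto _).mono_left nhdsWithin_le_nhds
    have h1 := hc.eventually_lt_const (lt_add_of_pos_right (d i ^ (n - 1))
      (NNReal.coe_pos.2 (hδpos i)))
    have h2 : Ioo (d i) ε ∈ 𝓝[>] d i := Ioo_mem_nhdsGT (hdlt i)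
    obtain ⟨r, hr1, hr2⟩ := (h1.and h2).exists
    exact ⟨r, hr2.1, hr2.2, hr1⟩
  choose r hr1 hr2 hr3 using hr
  have hd0 : ∀ i, 0 ≤ d i := fun i => ENNReal.toReal_nonneg
  classical
  -- A centre in $S\cap t_i$ when there is one. Sets missing $S$ get the dummy centre `s₀`; they are
  -- not needed for the cover.
  set x : ℕ → E n := fun i => if h : (t i ∩ S).Nonempty then h.some else s₀ with hx
  have hxS : ∀ i, x i ∈ S := by
    intro i
    by_cases h : (t i ∩ S).Nonempty
    · simp only [hx, h, dif_pos]; exact h.some_mem.2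
    · simp only [hx, h, dif_neg, not_false_iff]; exact hs₀
  have hball : S ⊆ ⋃ i, Metric.ball (x i) (r i) := by
    intro z hz
    obtain ⟨i, hi⟩ := mem_iUnion.1 (hcov hz)
    refine mem_iUnion.2 ⟨i, ?_⟩
    have hne : (t i ∩ S).Nonempty := ⟨z, hi, hz⟩
    have hxi : x i ∈ t i := by simp only [hx, hne, dif_pos]; exact hne.some_mem.1
    rw [Metric.mem_ball]
    refine lt_of_le_of_lt ?_ (hr1 i)
    rw [dist_edist]
    exact ENNReal.toReal_mono (hdiam_ne i) (Metric.edist_le_ediam_of_mem hi hxi)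
  obtain ⟨s, hs⟩ := hSc.elim_finite_subcover _ (fun i => Metric.isOpen_ball) hball
  refine ⟨s, x, r, fun i _ => hxS i, fun i => (hd0 i).trans_lt (hr1 i), hr2, hs, ?_⟩
  have hδtop : ∑' i, (δ i : ℝ≥0∞) ≠ ⊤ := (hδsum.trans ENNReal.ofReal_lt_top).ne
  have hb1 : ∑ i ∈ s, (D i).toReal < ε / 2 := by
    rw [← ENNReal.toReal_sum fun i _ => ENNReal.ne_top_of_tsum_ne_top hDtop i]
    refine (ENNReal.toReal_mono hDtop (ENNReal.sum_le_tsum s)).trans_lt ?_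
    have := (ENNReal.toReal_lt_toReal hDtop ENNReal.ofReal_ne_top).2 hsum
    rwa [ENNReal.toReal_ofReal (by linarith)] at this
  have hb2 : ∑ i ∈ s, (δ i : ℝ) < ε / 2 := by
    have h1 : ∑ i ∈ s, (δ i : ℝ) = ((∑ i ∈ s, (δ i : ℝ≥0∞))).toReal := by
      rw [ENNReal.toReal_sum fun i _ => ENNReal.coe_ne_top]; rfl
    rw [h1]
    refine (ENNReal.toReal_mono hδtop (ENNReal.sum_le_tsum s)).trans_lt ?_
    have := (ENNReal.toReal_lt_toReal hδtop ENNReal.ofReal_ne_top).2 hδsum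
    rwa [ENNReal.toReal_ofReal (by linarith)] at this
  calc ∑ i ∈ s, r i ^ (n - 1) ≤ ∑ i ∈ s, ((D i).toReal + δ i) :=
        Finset.sum_le_sum fun i _ => by rw [← hdD]; exact (hr3 i).le
    _ < ε := by rw [Finset.sum_add_distrib]; linarith

/-! ### Cutoff functions near small balls -/

/-- A product of factors $1-\chi((z-x_i)/r_i)$ for one fixed bump $\chi$. All factors lie in
$[0,1]$, so the product rule bounds the gradient by the sum of the individual gradients. The
constant `L` depends only on $\chi$, not on the balls. -/
theorem exists_cutoff_of_finset {n : ℕ} : ∃ L : ℝ, 0 ≤ L ∧ ∀ (s : Finset ℕ) (x : ℕ → E n)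
    (r : ℕ → ℝ), (∀ i, 0 < r i) → ∃ φ : E n → ℝ, ContDiff ℝ 1 φ ∧ (∀ z, 0 ≤ φ z) ∧
      (∀ z, φ z ≤ 1) ∧ (∀ z ∈ ⋃ i ∈ s, Metric.ball (x i) (r i), φ z = 0) ∧
      (∀ z, (∀ i ∈ s, 2 * r i ≤ dist z (x i)) → φ z = 1) ∧
      ∀ z, ‖fderiv ℝ φ z‖ ≤
        ∑ i ∈ s, (Metric.closedBall (x i) (2 * r i)).indicator (fun _ => L * (r i)⁻¹) z := by
  set χ : ContDiffBump (0 : E n) := ⟨1, 2, one_pos, one_lt_two⟩ with hχ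
  have hχd : ContDiff ℝ 1 χ := χ.contDiff
  obtain ⟨L, hL⟩ := ((χ.hasCompactSupport.fderiv (𝕜 := ℝ)).exists_bound_of_continuous
    (hχd.continuous_fderiv one_ne_zero))
  have hL0 : 0 ≤ L := (norm_nonneg _).trans (hL 0)
  refine ⟨L, hL0, fun s x r hr => ?_⟩
  classical
  induction s using Finset.induction_on with
  | empty => exact ⟨fun _ => 1, contDiff_const, by simp, by simp, by simp, by simp, by simp⟩
  | insert i s his ih =>
    obtain ⟨φ, hφd, hφ0, hφ1, hφz, hφo, hφb⟩ := ih
    set ψ : E n → ℝ := fun z => 1 - χ ((r i)⁻¹ • (z - x i)) with hψ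
    have hri := hr i
    have hnorm : ∀ z, ‖(r i)⁻¹ • (z - x i)‖ = (r i)⁻¹ * dist z (x i) := fun z => by
      rw [norm_smul, norm_inv, Real.norm_of_nonneg hri.le, dist_eq_norm]
    have hψd : ContDiff ℝ 1 ψ := contDiff_const.sub (hχd.comp
      (show ContDiff ℝ 1 fun z => (r i)⁻¹ • (z - x i) by fun_prop))
    have hψ0 : ∀ z, 0 ≤ ψ z := fun z => sub_nonneg.2 χ.le_one
    have hψ1 : ∀ z, ψ z ≤ 1 := fun z => sub_le_self _ χ.nonneg
    have hψder : ∀ z, ‖fderiv ℝ ψ z‖ ≤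
        (Metric.closedBall (x i) (2 * r i)).indicator (fun _ => L * (r i)⁻¹) z := by
      intro z
      have hA : HasFDerivAt (fun z => (r i)⁻¹ • (z - x i))
          ((r i)⁻¹ • ContinuousLinearMap.id ℝ (E n)) z :=
        (((hasFDerivAt_id (𝕜 := ℝ) z).sub_const (x i)).const_smul (r i)⁻¹).congr_of_eventuallyEq
          (Eventually.of_forall fun _ => rfl)
      have hB : HasFDerivAt ψ (-((fderiv ℝ χ ((r i)⁻¹ • (z - x i))).comp
          ((r i)⁻¹ • ContinuousLinearMap.id ℝ (E n)))) z :=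
        (((hχd.differentiable one_ne_zero _).hasFDerivAt).comp z hA).const_sub 1
      rw [hB.fderiv, norm_neg]
      by_cases hz : z ∈ Metric.closedBall (x i) (2 * r i)
      · rw [indicator_of_mem hz]
        refine (ContinuousLinearMap.opNorm_comp_le _ _).trans ?_
        refine mul_le_mul (hL _) ?_ (norm_nonneg _) hL0
        rw [norm_smul, norm_inv, Real.norm_of_nonneg hri.le]
        exact mul_le_of_le_one_right (inv_nonneg.2 hri.le) ContinuousLinearMap.norm_id_le
      · rw [indicator_of_notMem hz]
        have hn : (r i)⁻¹ • (z - x i) ∉ tsupport χ := by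
          rw [χ.tsupport_eq, mem_closedBall_zero_iff, hnorm]
          rw [Metric.mem_closedBall, not_le] at hz
          change ¬ _ ≤ (2 : ℝ)
          rw [inv_mul_le_iff₀ hri]
          linarith
        rw [(notMem_tsupport_iff_eventuallyEq.1 hn).fderiv_eq]
        simp
    refine ⟨fun z => ψ z * φ z, hψd.mul hφd, fun z => mul_nonneg (hψ0 z) (hφ0 z),
      fun z => mul_le_one₀ (hψ1 z) (hφ0 z) (hφ1 z), fun z hz => ?_, fun z hz => ?_, fun z => ?_⟩
    · simp only [Finset.mem_insert, iUnion_iUnion_eq_or_left, mem_union] at hz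
      rcases hz with hz | hz
      · have : ψ z = 0 := by
          rw [hψ]; simp only
          rw [χ.one_of_mem_closedBall, sub_self]
          rw [mem_closedBall_zero_iff, hnorm]
          change _ ≤ (1 : ℝ)
          rw [inv_mul_le_iff₀ hri, mul_one]
          exact (Metric.mem_ball.1 hz).le
        simp only [this, zero_mul]
      · simp only [hφz z hz, mul_zero]
    · have h1 : ψ z = 1 := by
        rw [hψ]; simp only
        rw [χ.zero_of_le_dist, sub_zero]
        rw [dist_zero_right, hnorm]
        change (2 : ℝ) ≤ _
        rw [le_inv_mul_iff₀ hri]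
        linarith [hz i (Finset.mem_insert_self _ _)]
      simp only [h1, hφo z fun j hj => hz j (Finset.mem_insert_of_mem hj), one_mul]
    · rw [Finset.sum_insert his,
        fderiv_fun_mul (hψd.differentiable one_ne_zero z) (hφd.differentiable one_ne_zero z)]
      refine (norm_add_le _ _).trans ?_
      rw [add_comm, norm_smul, norm_smul, Real.norm_of_nonneg (hψ0 z), Real.norm_of_nonneg (hφ0 z)]
      exact add_le_add ((mul_le_of_le_one_left (norm_nonneg _) (hφ1 z)).trans (hψder z))
        ((mul_le_of_le_one_left (norm_nonneg _) (hψ1 z)).trans (hφb z))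

end

/-! ### From local estimates to the divergence theorem -/

section

variable {n : ℕ} {U : Set (E n)} {V : Type*} [NormedAddCommGroup V] [NormedSpace ℝ V]

/-- At an interior point the defect is zero. At a regular boundary point a chart of small enough
distortion is used. Intersecting with a unit ball makes the supports compact. -/
theorem exists_nhds_norm_defect_le [CompleteSpace V] (hU : IsOpen U) (hb : Bornology.IsBounded U)
    (hbd : HasPiecewiseC1Boundary U) {G : Fin n → E n → V} (hG : Admissible U G) {ε : ℝ}
    (hε : 0 < ε) {x : E n} (hx : x ∈ closure U \ singularSet U) :
    ∃ W, IsOpen W ∧ x ∈ W ∧ ∀ φ : E n → ℝ, ContDiff ℝ 1 φ → tsupport φ ⊆ W →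
      ‖defect U G φ‖ ≤ ε * ∫ x in frontier U, |φ x| ∂surfaceMeasure n := by
  have hcs : ∀ φ : E n → ℝ, tsupport φ ⊆ Metric.ball x 1 → HasCompactSupport φ := fun φ h =>
    Metric.isCompact_of_isClosed_isBounded (isClosed_tsupport φ) (Metric.isBounded_ball.subset h)
  by_cases hxU : x ∈ U
  · refine ⟨U ∩ Metric.ball x 1, hU.inter Metric.isOpen_ball, ⟨hxU, Metric.mem_ball_self one_pos⟩,
      fun φ hφ hs => ?_⟩
    rw [defect_eq_zero_of_tsupport_subset hU hG hφ (hcs φ (hs.trans inter_subset_right))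
      (hs.trans inter_subset_left), norm_zero]
    exact mul_nonneg hε.le (integral_nonneg fun _ => abs_nonneg _)
  · have hreg : IsRegularBoundaryPoint U x := by
      by_contra h
      exact hx.2 ⟨by rw [hU.frontier_eq]; exact ⟨hx.1, hxU⟩, h⟩
    obtain ⟨M, hM0, hM⟩ := hG.exists_bound hb
    -- The `+ 1` covers the case $nM=0$.
    obtain ⟨c, hc0, hc1, hc⟩ := exists_distortion_lt n (ε := ε / (n * M + 1)) (by positivity)
    obtain ⟨ch⟩ := hreg.nonempty_boundaryChart hc0 hc1
    refine ⟨ch.e.source ∩ Metric.ball x 1, ch.e.open_source.inter Metric.isOpen_ball,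
      ⟨ch.mem, Metric.mem_ball_self one_pos⟩, fun φ hφ hs => ?_⟩
    refine (ch.norm_defect_le hc1 hU hb hbd hG hM0 hM hφ (hcs φ (hs.trans inter_subset_right))
      (hs.trans inter_subset_left)).trans ?_
    refine mul_le_mul_of_nonneg_right ?_ (integral_nonneg fun _ => abs_nonneg _)
    have h1 : (0 : ℝ) ≤ n * M := by positivity
    rw [lt_div_iff₀ (by positivity)] at hc
    rcases le_or_gt 0 (distortion n c) with h | h <;> nlinarith

/-- The number of pieces of the partition of unity is uncontrolled but irrelevant: the local bounds
are $\varepsilon\int|\varphi f_i|$, and $\sum f_i\le1$. -/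
theorem norm_defect_le_mul [CompleteSpace V] (hU : IsOpen U) (hb : Bornology.IsBounded U)
    (hbd : HasPiecewiseC1Boundary U) {G : Fin n → E n → V} (hG : Admissible U G) {ε : ℝ}
    (hε : 0 < ε) {φ : E n → ℝ} (hφ : ContDiff ℝ 1 φ)
    (hdisj : Disjoint (tsupport φ) (singularSet U)) :
    ‖defect U G φ‖ ≤ ε * ∫ x in frontier U, |φ x| ∂surfaceMeasure n := by
  set K := closure U ∩ tsupport φ with hK
  have hKc : IsCompact K := hb.isCompact_closure.inter_right (isClosed_tsupport φ)
  have hKs : ∀ x ∈ K, x ∈ closure U \ singularSet U := fun x hx =>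
    ⟨hx.1, fun h => disjoint_left.1 hdisj hx.2 h⟩
  choose! W hWo hxW hW using fun x (hx : x ∈ K) =>
    exists_nhds_norm_defect_le hU hb hbd hG hε (hKs x hx)
  obtain ⟨t, htK, hcov⟩ := hKc.elim_nhds_subcover W fun x hx => (hWo x hx).mem_nhds (hxW x hx)
  have hcov' : K ⊆ ⋃ i : t, W i := fun x hx => by
    obtain ⟨i, hi, hxi⟩ := mem_iUnion₂.1 (hcov hx)
    exact mem_iUnion.2 ⟨⟨i, hi⟩, hxi⟩
  obtain ⟨f, hf⟩ := SmoothPartitionOfUnity.exists_isSubordinate 𝓘(ℝ, E n) hKc.isClosed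
    (fun i : t => W i) (fun i => hWo i (htK i i.2)) hcov'
  have hfd : ∀ i, ContDiff ℝ 1 (f i) := fun i => (f i).contMDiff.contDiff.of_le (by simp)
  have hsum1 : ∀ x ∈ K, ∑ i, f i x = 1 := fun x hx => by
    rw [← finsum_eq_sum_of_fintype]; exact f.sum_eq_one hx
  have hsum2 : ∀ x, ∑ i, f i x ≤ 1 := fun x => by
    rw [← finsum_eq_sum_of_fintype]; exact f.sum_le_one x
  have hprod : ∀ i, ContDiff ℝ 1 (fun x => φ x * f i x) := fun i => hφ.mul (hfd i)
  have h1 : defect U G φ = ∑ i, defect U G (fun x => φ x * f i x) := by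
    rw [← defect_sum hU hb hbd hG Finset.univ hprod]
    refine defect_congr hU G fun x hx => ?_
    rw [← Finset.mul_sum]
    by_cases hxs : x ∈ tsupport φ
    · rw [hsum1 x ⟨hx, hxs⟩, mul_one]
    · rw [image_eq_zero_of_notMem_tsupport hxs, zero_mul]
  have hint : ∀ ψ : E n → ℝ, Continuous ψ → IntegrableOn (fun x => |ψ x|) (frontier U)
      (surfaceMeasure n) := fun ψ hψ => by
    have hcpt : IsCompact (frontier U) :=
      hb.isCompact_closure.of_isClosed_subset isClosed_frontier frontier_subset_closure
    exact hψ.abs.continuousOn.integrableOn_of_subset_isCompact hcpt hcpt.measurableSet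
      subset_rfl hbd.finite_area.ne
  rw [h1]
  calc _ ≤ ∑ i, ‖defect U G (fun x => φ x * f i x)‖ := norm_sum_le _ _
    _ ≤ ∑ i, ε * ∫ x in frontier U, |φ x * f i x| ∂surfaceMeasure n :=
      Finset.sum_le_sum fun i _ => hW i (htK i i.2) _ (hprod i)
        ((tsupport_mul_subset_right).trans (hf i))
    _ = ε * ∫ x in frontier U, ∑ i, |φ x * f i x| ∂surfaceMeasure n := by
      rw [integral_finsetSum _ fun i _ => hint _ (hprod i).continuous, Finset.mul_sum]
    _ ≤ _ := by
      refine mul_le_mul_of_nonneg_left (integral_mono (integrable_finsetSum _ fun i _ =>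
        hint _ (hprod i).continuous) (hint _ hφ.continuous) fun x => ?_) hε.le
      simp only [abs_mul, abs_of_nonneg (f.nonneg _ x)]
      rw [← Finset.mul_sum]
      exact mul_le_of_le_one_right (abs_nonneg _) (hsum2 x)

theorem defect_eq_zero [CompleteSpace V] (hU : IsOpen U) (hb : Bornology.IsBounded U)
    (hbd : HasPiecewiseC1Boundary U) {G : Fin n → E n → V} (hG : Admissible U G)
    {φ : E n → ℝ} (hφ : ContDiff ℝ 1 φ) (hdisj : Disjoint (tsupport φ) (singularSet U)) :
    defect U G φ = 0 := by
  set B := ∫ x in frontier U, |φ x| ∂surfaceMeasure n with hB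
  have hB0 : 0 ≤ B := integral_nonneg fun _ => abs_nonneg _
  refine norm_le_zero_iff.1 (le_of_forall_pos_le_add fun η hη => ?_)
  have h := norm_defect_le_mul hU hb hbd hG (ε := η / (B + 1)) (by positivity) hφ hdisj
  rw [← hB] at h
  rw [zero_add]
  refine h.trans ?_
  rw [div_mul_eq_mul_div, div_le_iff₀ (by positivity)]
  nlinarith

/-- Cutoff functions that vanish near the singular set, converge to one off it, and whose gradients
converge to zero in mean. -/
theorem exists_singular_cutoffs (hn : 2 ≤ n) (hU : IsOpen U) (hb : Bornology.IsBounded U)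
    (hbd : HasPiecewiseC1Boundary U) :
    ∃ φ : ℕ → E n → ℝ, (∀ k, ContDiff ℝ 1 (φ k)) ∧ (∀ k z, |φ k z| ≤ 1) ∧
      (∀ k, Disjoint (tsupport (φ k)) (singularSet U)) ∧
      (∀ z ∉ singularSet U, ∀ᶠ k in atTop, φ k z = 1) ∧
      Tendsto (fun k => ∫ z in U, ‖fderiv ℝ (φ k) z‖) atTop (𝓝 0) := by
  have hSc : IsCompact (singularSet U) := hb.isCompact_closure.of_isClosed_subset
    (isClosed_singularSet hU) fun x hx => frontier_subset_closure hx.1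
  obtain ⟨L, hL0, hL⟩ := exists_cutoff_of_finset (n := n)
  have hε : ∀ k : ℕ, (0 : ℝ) < 1 / (k + 1) := fun k => by positivity
  choose s x r hxS hr0 hrε hcov hsum using fun k : ℕ =>
    exists_finite_cover_of_surfaceMeasure_eq_zero hn hSc hbd.null_singular (hε k)
  choose φ hφd hφ0 hφ1 hφz hφo hφb using fun k => hL (s k) (x k) (r k) (hr0 k)
  refine ⟨φ, hφd, fun k z => by rw [abs_of_nonneg (hφ0 k z)]; exact hφ1 k z, fun k => ?_,
    fun z hz => ?_, ?_⟩
  · rw [disjoint_right]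
    intro z hz
    rw [notMem_tsupport_iff_eventuallyEq]
    have ho : IsOpen (⋃ i ∈ s k, Metric.ball (x k i) (r k i)) :=
      isOpen_biUnion fun i _ => Metric.isOpen_ball
    filter_upwards [ho.mem_nhds (hcov k hz)] with w hw using hφz k w hw
  · have hlim : Tendsto (fun k : ℕ => 1 / ((k : ℝ) + 1)) atTop (𝓝 0) :=
      tendsto_one_div_add_atTop_nhds_zero_nat
    have hnb : (singularSet U)ᶜ ∈ 𝓝 z := (isClosed_singularSet hU).isOpen_compl.mem_nhds hz
    obtain ⟨d, hd, hball⟩ := Metric.mem_nhds_iff.1 hnb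
    have h1 : ∀ᶠ k : ℕ in atTop, 1 / ((k : ℝ) + 1) < d / 2 :=
      hlim.eventually_lt_const (by linarith)
    filter_upwards [h1] with k hk
    refine hφo k z fun i hi => ?_
    have h2 : x k i ∉ Metric.ball z d := fun h => hball h (hxS k i hi)
    rw [Metric.mem_ball, not_lt, dist_comm] at h2
    linarith [hrε k i]
  · set C := L * (2 ^ n * volume.real (Metric.ball (0 : E n) 1)) with hC
    -- The gradient is at most $L/r_i$ on a ball of volume proportional to $(2r_i)^n$, which leaves
    -- $r_i^{n-1}$, the quantity controlled by the cover.
    have hbound : ∀ k, ∫ z in U, ‖fderiv ℝ (φ k) z‖ ≤ C * (1 / ((k : ℝ) + 1)) := by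
      intro k
      have hball : ∀ i, Integrable ((Metric.closedBall (x k i) (2 * r k i)).indicator
          (fun _ => L * (r k i)⁻¹)) := fun i =>
        (integrable_indicator_iff Metric.isClosed_closedBall.measurableSet).2
          (integrableOn_const (isCompact_closedBall _ _).measure_lt_top.ne)
      have hsi := integrable_finsetSum (s k) fun i _ => hball i
      have hfi : Integrable (fun z => ‖fderiv ℝ (φ k) z‖) :=
        hsi.mono' ((hφd k).continuous_fderiv one_ne_zero).norm.aestronglyMeasurable
          (Eventually.of_forall fun z => by rw [norm_norm]; exact hφb k z)
      calc ∫ z in U, ‖fderiv ℝ (φ k) z‖ ≤ ∫ z, ‖fderiv ℝ (φ k) z‖ :=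
            setIntegral_le_integral hfi (Eventually.of_forall fun z => norm_nonneg _)
        _ ≤ ∫ z, ∑ i ∈ s k, (Metric.closedBall (x k i) (2 * r k i)).indicator
              (fun _ => L * (r k i)⁻¹) z := integral_mono hfi hsi (hφb k)
        _ = ∑ i ∈ s k, C * r k i ^ (n - 1) := by
            rw [integral_finsetSum _ fun i _ => hball i]
            refine Finset.sum_congr rfl fun i _ => ?_
            have hri := hr0 k i
            rw [integral_indicator_const _ Metric.isClosed_closedBall.measurableSet,
              Measure.addHaar_real_closedBall _ _ (by positivity), finrank_euclideanSpace,
              Fintype.card_fin, mul_pow, smul_eq_mul, hC]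
            obtain ⟨m, rfl⟩ : ∃ m, n = m + 1 := ⟨n - 1, by omega⟩
            rw [Nat.add_sub_cancel, pow_succ (r k i)]
            field_simp
        _ ≤ C * (1 / ((k : ℝ) + 1)) := by
            rw [← Finset.mul_sum]
            exact mul_le_mul_of_nonneg_left (hsum k).le (by positivity)
    refine squeeze_zero (fun k => integral_nonneg fun _ => norm_nonneg _) hbound ?_
    simpa using (tendsto_one_div_add_atTop_nhds_zero_nat (𝕜 := ℝ)).const_mul C

/-- **The divergence theorem** on a bounded domain with piecewise `C¹` boundary, for a vector field
that is continuous up to the boundary, `C¹` inside, and has an integrable divergence. -/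
theorem integral_divg_eq_integral_flux [CompleteSpace V] (hn : 2 ≤ n) (hU : IsOpen U)
    (hb : Bornology.IsBounded U) (hbd : HasPiecewiseC1Boundary U) {G : Fin n → E n → V}
    (hG : Admissible U G) :
    ∫ x in U, divg G x =
      ∫ x in frontier U, flux G (outerNormal U x) x ∂surfaceMeasure n := by
  obtain ⟨φ, hφd, hφ1, hφS, hφo, hφlim⟩ := exists_singular_cutoffs hn hU hb hbd
  obtain ⟨M, hM0, hM⟩ := hG.exists_bound hb
  have hc : IsCompact (closure U) := hb.isCompact_closure
  have hGf : ∀ j, ContinuousOn (G j) (frontier U) := fun j =>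
    (hG.continuousOn j).mono frontier_subset_closure
  have hgi : ∀ k, IntegrableOn (gradFlux (φ k) G) U := fun k =>
    ((continuousOn_gradFlux ((hφd k).continuous_fderiv one_ne_zero).continuousOn
      hG.continuousOn).integrableOn_compact (μ := volume) hc).mono_set subset_closure
  have hdi : ∀ k, IntegrableOn (fun x => φ k x • divg G x) U := fun k =>
    Integrable.bdd_smul hG.integrableOn 1 (hφd k).continuous.aestronglyMeasurable
      (Eventually.of_forall fun x => hφ1 k x)
  have hlim1 : Tendsto (fun k => ∫ x in U, φ k x • divg G x) atTop (𝓝 (∫ x in U, divg G x)) := by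
    refine tendsto_integral_of_dominated_convergence (fun x => ‖divg G x‖)
      (fun k => (hdi k).1) hG.integrableOn.norm
      (fun k => Eventually.of_forall fun x => ?_)
      (ae_restrict_of_forall_mem hU.measurableSet fun x hx => ?_)
    · rw [norm_smul]; exact mul_le_of_le_one_left (norm_nonneg _) (hφ1 k x)
    · have hxS : x ∉ singularSet U := fun h => by
        have := h.1; rw [hU.frontier_eq] at this; exact this.2 hx
      refine tendsto_const_nhds.congr' ?_
      filter_upwards [hφo x hxS] with k hk
      rw [hk, one_smul]
  -- The field is bounded on $\overline U$ and the cutoff gradients tend to zero in $L^1$, so this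
  -- term disappears.
  have hlim2 : Tendsto (fun k => ∫ x in U, gradFlux (φ k) G x) atTop (𝓝 0) := by
    have hle : ∀ k, ‖∫ x in U, gradFlux (φ k) G x‖ ≤ n * M * ∫ z in U, ‖fderiv ℝ (φ k) z‖ := by
      intro k
      rw [← integral_const_mul]
      refine norm_integral_le_of_norm_le ?_ (ae_restrict_of_forall_mem hU.measurableSet
        fun x hx => ?_)
      · have hcn : Continuous (fun z => ↑n * M * ‖fderiv ℝ (φ k) z‖) :=
          continuous_const.mul ((hφd k).continuous_fderiv one_ne_zero).norm
        exact (hcn.continuousOn.integrableOn_compact (μ := volume) hc).mono_set subset_closure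
      · rw [gradFlux_eq_flux]
        refine (norm_flux_le fun j => hM j x (subset_closure hx)).trans (le_of_eq ?_)
        have : ‖gradient (φ k) x‖ = ‖fderiv ℝ (φ k) x‖ :=
          LinearIsometryEquiv.norm_map (toDual ℝ (E n)).symm _
        rw [this]; ring
    refine squeeze_zero_norm hle ?_
    simpa using hφlim.const_mul (n * M)
  have hlim3 : Tendsto (fun k => ∫ x in frontier U, φ k x • flux G (outerNormal U x) x
      ∂surfaceMeasure n) atTop
      (𝓝 (∫ x in frontier U, flux G (outerNormal U x) x ∂surfaceMeasure n)) := by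
    refine tendsto_integral_of_dominated_convergence (fun x => ‖flux G (outerNormal U x) x‖)
      (fun k => (integrableOn_smul_flux_outerNormal hU hb hbd hGf (hφd k).continuous).1)
      (integrableOn_flux_outerNormal hU hb hbd hGf).norm
      (fun k => Eventually.of_forall fun x => ?_) ?_
    · rw [norm_smul]; exact mul_le_of_le_one_left (norm_nonneg _) (hφ1 k x)
    · have hae : ∀ᵐ x ∂surfaceMeasure n, x ∉ singularSet U :=
        measure_eq_zero_iff_ae_notMem.1 hbd.null_singular
      filter_upwards [ae_restrict_of_ae hae] with x hx
      refine tendsto_const_nhds.congr' ?_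
      filter_upwards [hφo x hx] with k hk
      rw [hk, one_smul]
  have hlim := (hlim1.add hlim2).sub hlim3
  have hz : ∀ k, (∫ x in U, φ k x • divg G x) + (∫ x in U, gradFlux (φ k) G x)
      - ∫ x in frontier U, φ k x • flux G (outerNormal U x) x ∂surfaceMeasure n = 0 := by
    intro k
    rw [← integral_add (hdi k) (hgi k)]
    exact defect_eq_zero hU hb hbd hG (hφd k) (hφS k)
  simp only [hz, add_zero] at hlim
  exact sub_eq_zero.1 (tendsto_nhds_unique hlim tendsto_const_nhds)

end

section

variable {n : ℕ} {U : Set (E n)} {V : Type*} [NormedAddCommGroup V] [NormedSpace ℝ V]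

/-! ### Divergence-free fields with an isolated singularity -/

theorem step_norm_eventuallyEq_zero {z : E n} (hz : ‖z‖ < 1) :
    (fun z : E n => step ‖z‖) =ᶠ[𝓝 z] fun _ => 0 := by
  filter_upwards [continuous_norm.continuousAt.eventually_lt continuousAt_const hz] with w hw
  exact step_of_le (le_of_lt hw)

theorem contDiff_step_norm : ContDiff ℝ 1 (fun z : E n => step ‖z‖) := by
  refine contDiff_iff_contDiffAt.2 fun z => ?_
  by_cases hz : z = 0
  · refine (contDiffAt_const (c := (0 : ℝ))).congr_of_eventuallyEq
      (step_norm_eventuallyEq_zero (by simp [hz]))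
  · exact (contDiff_step.of_le (by simp)).contDiffAt.comp z (contDiffAt_norm ℝ hz)

theorem hasFDerivAt_step_norm {z : E n} (hz : z ≠ 0) :
    HasFDerivAt (fun z : E n => step ‖z‖) ((deriv step ‖z‖ * ‖z‖⁻¹) • innerSL ℝ z) z := by
  have h1 : HasDerivAt step (deriv step ‖z‖) ‖z‖ :=
    (contDiff_step.differentiable (by simp) _).hasDerivAt
  have h2 : HasFDerivAt (fun z : E n => ‖z‖) (‖z‖⁻¹ • innerSL ℝ z) z := by
    have h3 := (hasStrictFDerivAt_norm_sq z).hasFDerivAt.sqrt (by positivity)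
    have h4 : (fun z : E n => ‖z‖) = fun z => √(‖z‖ ^ 2) := by
      ext w; rw [Real.sqrt_sq (norm_nonneg _)]
    rw [h4]
    have h5 : (1 / (2 * √(‖z‖ ^ 2))) • 2 • innerSL ℝ z = ‖z‖⁻¹ • innerSL ℝ z := by
      rw [Real.sqrt_sq (norm_nonneg _), ← Nat.cast_smul_eq_nsmul ℝ 2, smul_smul]
      congr 1
      push_cast
      field_simp
    rw [h5] at h3
    exact h3
  have h3 := h1.comp_hasFDerivAt z h2
  rwa [smul_smul] at h3

theorem fderiv_step_norm_eq_zero_of_le {z : E n} (hz : ‖z‖ ≤ 1) :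
    fderiv ℝ (fun z : E n => step ‖z‖) z = 0 := by
  by_cases h0 : z = 0
  · rw [(step_norm_eventuallyEq_zero (by simp [h0])).fderiv_eq]; simp
  · rw [(hasFDerivAt_step_norm h0).fderiv, deriv_step_of_le hz]; simp

theorem fderiv_step_norm_eq_zero_of_ge {z : E n} (hz : 2 ≤ ‖z‖) :
    fderiv ℝ (fun z : E n => step ‖z‖) z = 0 := by
  have h0 : z ≠ 0 := by rintro rfl; norm_num at hz
  rw [(hasFDerivAt_step_norm h0).fderiv, deriv_step_of_ge hz]; simp

/-- The closed annulus `1 ≤ ‖z‖ ≤ 2`. -/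
def annulus (n : ℕ) : Set (E n) := {z | 1 ≤ ‖z‖ ∧ ‖z‖ ≤ 2}

theorem isCompact_annulus (n : ℕ) : IsCompact (annulus n) := by
  refine (isCompact_closedBall (0 : E n) 2).of_isClosed_subset ?_ fun z hz => ?_
  · exact (isClosed_le continuous_const continuous_norm).inter
      (isClosed_le continuous_norm continuous_const)
  · rw [mem_closedBall_zero_iff]; exact hz.2

theorem fderiv_step_norm_eq_zero_of_notMem {z : E n} (hz : z ∉ annulus n) :
    fderiv ℝ (fun z : E n => step ‖z‖) z = 0 := by
  by_cases h : 1 ≤ ‖z‖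
  · exact fderiv_step_norm_eq_zero_of_ge (le_of_lt (not_le.1 fun h' => hz ⟨h, h'⟩))
  · exact fderiv_step_norm_eq_zero_of_le (le_of_lt (not_le.1 h))

/-- Under $x=y+\varepsilon z$ the volume contributes $\varepsilon^n$ and the cutoff gradient
$\varepsilon^{-1}$; this fixes the exponent $n-1$. -/
theorem integral_scaled_gradFlux (hn : 1 ≤ n) {F : Fin n → E n → V} {y : E n} {ε : ℝ}
    (hε : 0 < ε) :
    ∫ x, gradFlux (fun x => step ‖ε⁻¹ • (x - y)‖) F x =
      ∫ z in annulus n, gradFlux (fun z => step ‖z‖) (fun j z => ε ^ (n - 1) • F j (y + ε • z)) z := by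
  have hder : ∀ x, fderiv ℝ (fun x => step ‖ε⁻¹ • (x - y)‖) x =
      ε⁻¹ • fderiv ℝ (fun z : E n => step ‖z‖) (ε⁻¹ • (x - y)) := by
    intro x
    have h1 : HasFDerivAt (fun x : E n => ε⁻¹ • (x - y)) (ε⁻¹ • ContinuousLinearMap.id ℝ (E n)) x :=
      (((hasFDerivAt_id (𝕜 := ℝ) x).sub_const y).const_smul ε⁻¹).congr_of_eventuallyEq
        (Eventually.of_forall fun _ => rfl)
    have h2 := ((contDiff_step_norm (n := n)).differentiable one_ne_zero
      (ε⁻¹ • (x - y))).hasFDerivAt.comp x h1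
    rw [show (fun x => step ‖ε⁻¹ • (x - y)‖) =
      (fun z : E n => step ‖z‖) ∘ fun x => ε⁻¹ • (x - y) from rfl, h2.fderiv]
    ext v; simp
  have h1 : ∫ x, gradFlux (fun x => step ‖ε⁻¹ • (x - y)‖) F x =
      ε ^ n • ∫ z, gradFlux (fun x => step ‖ε⁻¹ • (x - y)‖) F (y + ε • z) := by
    have h2 := Measure.integral_comp_smul (volume : Measure (E n))
      (fun x => gradFlux (fun x => step ‖ε⁻¹ • (x - y)‖) F (y + x)) ε
    rw [integral_add_left_eq_self] at h2
    rw [h2, finrank_euclideanSpace, Fintype.card_fin, abs_of_pos (by positivity), smul_smul,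
      mul_inv_cancel₀ (by positivity), one_smul]
  rw [h1, setIntegral_eq_integral_of_forall_compl_eq_zero, ← integral_smul]
  · congr 1
    ext z
    simp only [gradFlux, Finset.smul_sum]
    refine Finset.sum_congr rfl fun j _ => ?_
    rw [hder, add_sub_cancel_left, inv_smul_smul₀ hε.ne', smul_apply, smul_smul, smul_smul,
      smul_eq_mul]
    congr 1
    obtain ⟨m, rfl⟩ : ∃ m, n = m + 1 := ⟨n - 1, by omega⟩
    rw [Nat.add_sub_cancel, pow_succ]
    field_simp
  · intro z hz
    simp [gradFlux, fderiv_step_norm_eq_zero_of_notMem hz]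

/-- The cutoff `ψ` removes the pole and is $1$ off the ball of radius $2\varepsilon$, so it does not
change the flux. Since `F` is divergence free, $\operatorname{div}(\psi F)$ is only the gradient
term, supported in an annulus; in particular it is integrable over $U$. -/
theorem integral_flux_eq_of_divg_eq_zero [CompleteSpace V] (hn : 2 ≤ n) (hU : IsOpen U)
    (hb : Bornology.IsBounded U) (hbd : HasPiecewiseC1Boundary U) {y : E n}
    {F : Fin n → E n → V} (hFc : ∀ j, ContinuousOn (F j) (closure U \ {y}))
    (hFd : ∀ j, ContDiffOn ℝ 1 (F j) (U \ {y})) (hdiv : ∀ x ∈ U \ {y}, divg F x = 0)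
    {ε : ℝ} (hε : 0 < ε) (hball : Metric.closedBall y (2 * ε) ⊆ U) :
    ∫ x in frontier U, flux F (outerNormal U x) x ∂surfaceMeasure n =
      ∫ x, gradFlux (fun x => step ‖ε⁻¹ • (x - y)‖) F x := by
  set ψ : E n → ℝ := fun x => step ‖ε⁻¹ • (x - y)‖ with hψ
  have hψd : ContDiff ℝ 1 ψ := contDiff_step_norm.comp
    (show ContDiff ℝ 1 fun x => ε⁻¹ • (x - y) by fun_prop)
  have hnorm : ∀ x, ‖ε⁻¹ • (x - y)‖ = ε⁻¹ * dist x y := fun x => by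
    rw [norm_smul, norm_inv, Real.norm_of_nonneg hε.le, dist_eq_norm]
  have hψ0 : ∀ᶠ x in 𝓝 y, ψ x = 0 := by
    filter_upwards [Metric.ball_mem_nhds y hε] with x hx
    refine step_of_le ?_
    rw [hnorm, inv_mul_le_iff₀ hε, mul_one]
    exact (Metric.mem_ball.1 hx).le
  have hψ1 : ∀ x ∉ U, ψ x = 1 := fun x hx => by
    refine step_of_ge ?_
    rw [hnorm, le_inv_mul_iff₀ hε, mul_comm]
    by_contra! h
    exact hx (hball (Metric.mem_closedBall.2 h.le))
  have hψ1' : ∀ x ∉ U, fderiv ℝ ψ x = 0 := fun x hx => by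
    have : ψ =ᶠ[𝓝 x] fun _ => 1 := by
      filter_upwards [Metric.isClosed_closedBall.isOpen_compl.mem_nhds
        (show x ∈ (Metric.closedBall y (2 * ε))ᶜ from fun h => hx (hball h))] with w hw
      refine step_of_ge ?_
      rw [mem_compl_iff, Metric.mem_closedBall, not_le] at hw
      rw [hnorm, le_inv_mul_iff₀ hε, mul_comm]
      exact hw.le
    rw [this.fderiv_eq]; simp
  have hψy : fderiv ℝ ψ y = 0 := by
    have : ψ =ᶠ[𝓝 y] fun _ => 0 := hψ0
    rw [this.fderiv_eq]; simp
  have hG0 : ∀ j, (fun x => ψ x • F j x) =ᶠ[𝓝 y] fun _ => 0 := fun j => by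
    filter_upwards [hψ0] with x hx
    rw [hx, zero_smul]
  have hyo : IsOpen (U \ {y}) := hU.sdiff isClosed_singleton
  have hGg : ∀ x ∈ U, divg (fun j x => ψ x • F j x) x = gradFlux ψ F x := by
    intro x hx
    by_cases hxy : x = y
    · rw [hxy]
      simp only [divg, gradFlux, (hG0 _).fderiv_eq, hψy]
      simp
    · rw [divg_smul (hψd.differentiable one_ne_zero x) fun j =>
        ((hFd j).contDiffAt (hyo.mem_nhds ⟨hx, hxy⟩)).differentiableAt one_ne_zero,
        hdiv x ⟨hx, hxy⟩, smul_zero, zero_add]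
  have hgc : ContinuousOn (gradFlux ψ F) (closure U) := by
    intro x hx
    by_cases hxy : x = y
    · have : gradFlux ψ F =ᶠ[𝓝 y] fun _ => 0 := by
        filter_upwards [eventually_eventually_nhds.2 hψ0] with w hw
        have : ψ =ᶠ[𝓝 w] fun _ => 0 := hw
        simp [gradFlux, this.fderiv_eq]
      rw [hxy]
      exact (continuousAt_const.congr this.symm).continuousWithinAt
    · refine (continuousOn_gradFlux (hψd.continuous_fderiv one_ne_zero).continuousOn
        hFc x ⟨hx, hxy⟩).mono_of_mem_nhdsWithin ?_
      exact inter_mem_nhdsWithin _ (isOpen_ne.mem_nhds hxy)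
  have hA : Admissible U (fun j x => ψ x • F j x) := by
    refine ⟨fun j x hx => ?_, fun j x hx => ?_, ?_⟩
    · by_cases hxy : x = y
      · rw [hxy]
        exact (continuousAt_const.congr (hG0 j).symm).continuousWithinAt
      · refine ((hψd.continuous.continuousOn.smul (hFc j)) x ⟨hx, hxy⟩).mono_of_mem_nhdsWithin ?_
        exact inter_mem_nhdsWithin _ (isOpen_ne.mem_nhds hxy)
    · by_cases hxy : x = y
      · rw [hxy]
        exact (contDiffAt_const.congr_of_eventuallyEq (hG0 j)).contDiffWithinAt
      · exact (hψd.contDiffAt.smul ((hFd j).contDiffAt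
          (hyo.mem_nhds ⟨hx, hxy⟩))).contDiffWithinAt
    · refine IntegrableOn.congr_fun ((hgc.integrableOn_compact (μ := volume)
        hb.isCompact_closure).mono_set subset_closure) (fun x hx => (hGg x hx).symm)
        hU.measurableSet
  have hdt := integral_divg_eq_integral_flux hn hU hb hbd hA
  rw [setIntegral_congr_fun hU.measurableSet hGg,
    setIntegral_eq_integral_of_forall_compl_eq_zero
      fun x hx => by simp [gradFlux, hψ1' x hx]] at hdt
  rw [hdt]
  refine setIntegral_congr_fun isClosed_frontier.measurableSet fun x hx => ?_
  rw [hU.frontier_eq] at hx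
  simp [flux, hψ1 x hx.2]

/-- The flux of a divergence-free field with an isolated singularity of order `n - 1` at `y`,
in terms of the principal part of the field at `y`. -/
theorem integral_flux_eq_integral_principal_part [CompleteSpace V] (hn : 2 ≤ n) (hU : IsOpen U)
    (hb : Bornology.IsBounded U) (hbd : HasPiecewiseC1Boundary U) {y : E n} (hy : y ∈ U)
    {F : Fin n → E n → V} (hFc : ∀ j, ContinuousOn (F j) (closure U \ {y}))
    (hFd : ∀ j, ContDiffOn ℝ 1 (F j) (U \ {y})) (hdiv : ∀ x ∈ U \ {y}, divg F x = 0)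
    {ε₀ : ℝ} (hε₀ : 0 < ε₀) {Φ : Fin n → ℝ → E n → V}
    (hΦ : ∀ j, ContinuousOn (Function.uncurry (Φ j)) (Icc 0 ε₀ ×ˢ annulus n))
    (hΦF : ∀ j, ∀ ε ∈ Ioc 0 ε₀, ∀ z ∈ annulus n, Φ j ε z = ε ^ (n - 1) • F j (y + ε • z)) :
    ∫ x in frontier U, flux F (outerNormal U x) x ∂surfaceMeasure n =
      ∫ z in annulus n, gradFlux (fun z => step ‖z‖) (fun j => Φ j 0) z := by
  obtain ⟨d, hd, hdU⟩ := Metric.mem_nhds_iff.1 (hU.mem_nhds hy)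
  have hKm : MeasurableSet (annulus n) := (isCompact_annulus n).isClosed.measurableSet
  -- The left side does not depend on $\varepsilon$, so the identity survives the limit. The bound
  -- $d/3$ keeps the ball of radius $2\varepsilon$ inside $U$.
  have hev : ∀ᶠ ε in 𝓝[>] (0 : ℝ),
      ∫ x in frontier U, flux F (outerNormal U x) x ∂surfaceMeasure n =
      ∫ z in annulus n, gradFlux (fun z => step ‖z‖) (fun j => Φ j ε) z := by
    filter_upwards [Ioc_mem_nhdsGT (show 0 < min ε₀ (d / 3) by positivity)] with ε hε
    have h1 : ε ≤ ε₀ := hε.2.trans (min_le_left _ _)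
    have h2 : ε ≤ d / 3 := hε.2.trans (min_le_right _ _)
    rw [integral_flux_eq_of_divg_eq_zero hn hU hb hbd hFc hFd hdiv hε.1
      ((Metric.closedBall_subset_ball (by linarith [hε.1])).trans hdU),
      integral_scaled_gradFlux (by omega) hε.1]
    refine setIntegral_congr_fun hKm fun z hz => ?_
    simp only [gradFlux]
    exact Finset.sum_congr rfl fun j _ => by rw [hΦF j ε ⟨hε.1, h1⟩ z hz]
  have hcont : ContinuousOn (fun p : ℝ × E n => gradFlux (fun z => step ‖z‖) (fun j => Φ j p.1) p.2)
      (Icc 0 ε₀ ×ˢ annulus n) := by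
    refine continuousOn_finsetSum _ fun j _ => ContinuousOn.smul ?_ (hΦ j)
    exact (((contDiff_step_norm.continuous_fderiv one_ne_zero).comp continuous_snd).clm_apply
      continuous_const).continuousOn
  obtain ⟨M, hM⟩ := (isCompact_Icc.prod (isCompact_annulus n)).exists_bound_of_continuousOn hcont
  have hIoc : ∀ᶠ ε in 𝓝[>] (0 : ℝ), ε ∈ Icc 0 ε₀ := by
    filter_upwards [Ioc_mem_nhdsGT hε₀] with ε hε using ⟨hε.1.le, hε.2⟩
  have hlim : Tendsto (fun ε => ∫ z in annulus n, gradFlux (fun z => step ‖z‖) (fun j => Φ j ε) z)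
      (𝓝[>] 0) (𝓝 (∫ z in annulus n, gradFlux (fun z => step ‖z‖) (fun j => Φ j 0) z)) := by
    refine tendsto_integral_filter_of_dominated_convergence (fun _ => M) ?_ ?_ ?_ ?_
    · filter_upwards [hIoc] with ε hε
      refine ContinuousOn.aestronglyMeasurable ?_ hKm
      exact hcont.comp (f := fun z => (ε, z)) (by fun_prop) fun z hz => ⟨hε, hz⟩
    · filter_upwards [hIoc] with ε hε
      exact ae_restrict_of_forall_mem hKm fun z hz => hM (ε, z) ⟨hε, hz⟩
    · exact integrableOn_const (isCompact_annulus n).measure_lt_top.ne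
    · refine ae_restrict_of_forall_mem hKm fun z hz => ?_
      have h1 : ContinuousOn (fun ε : ℝ => gradFlux (fun z => step ‖z‖) (fun j => Φ j ε) z)
          (Icc 0 ε₀) := hcont.comp (f := fun ε => (ε, z)) (by fun_prop) fun ε hε => ⟨hε, hz⟩
      exact (h1 0 ⟨le_rfl, hε₀.le⟩).mono_left
        (nhdsWithin_le_of_mem hIoc)
  exact tendsto_nhds_unique (tendsto_const_nhds.congr' hev) hlim

/-- In polar coordinates the weight $r^{n-1}$ reduces the radial integrand to the derivative of the
step, whose integral is $1$. -/
theorem integral_radial_deriv_step [NeZero n] :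
    ∫ z : E n, ‖z‖ * deriv step ‖z‖ * (‖z‖ ^ n)⁻¹ = sphereArea n := by
  have h := integral_fun_norm_addHaar (volume : Measure (E n))
    (fun r : ℝ => r * deriv step r * (r ^ n)⁻¹)
  have hint : ∫ r in Ioi (0 : ℝ), r ^ (n - 1) • (r * deriv step r * (r ^ n)⁻¹) = 1 := by
    rw [← integral_deriv_step, ← setIntegral_eq_integral_of_forall_compl_eq_zero
      (s := Ioi (0 : ℝ)) (f := deriv step) fun r hr => deriv_step_of_le
        ((not_lt.1 hr).trans zero_le_one)]
    refine setIntegral_congr_fun measurableSet_Ioi fun r hr => ?_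
    have hr0 : r ≠ 0 := (mem_Ioi.1 hr).ne'
    obtain ⟨m, hm⟩ : ∃ m, n = m + 1 := ⟨n - 1, by have := NeZero.pos n; omega⟩
    simp only [hm, Nat.add_sub_cancel, pow_succ, smul_eq_mul]
    field_simp
  rw [finrank_euclideanSpace, Fintype.card_fin, hint] at h
  rw [h, sphereArea, ← measureReal_def, Measure.toSphere_real_apply_univ, finrank_euclideanSpace,
    Fintype.card_fin]
  simp

end

section

variable {n : ℕ} [NeZero n]

/-! ### The kernel -/

/-- The function `‖x-y‖² ‖x-ŷ‖²`, of which the kernel is a power. -/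
def kerBase (x y : E n) : ℝ := ‖x - y‖ ^ 2 * ‖x - reflectLast n y‖ ^ 2

/-- The partial derivatives of `‖x-y‖² ‖x-ŷ‖²`. -/
def kerBaseDeriv (j : Fin n) (x y : E n) : ℝ :=
  2 * ((x j - y j) * ‖x - reflectLast n y‖ ^ 2 + ‖x - y‖ ^ 2 * (x j - reflectLast n y j))

theorem kerBase_pos {x y : E n} (h1 : x ≠ y) (h2 : x ≠ reflectLast n y) : 0 < kerBase x y :=
  mul_pos (pow_pos (norm_pos_iff.2 (sub_ne_zero.2 h1)) 2)
    (pow_pos (norm_pos_iff.2 (sub_ne_zero.2 h2)) 2)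

/-- A real power of the polynomial $\|x-y\|^2\|x-\hat y\|^2$ can be differentiated uniformly in the
parity of $n$ and without differentiating norms. -/
theorem kerH_eq_rpow (hn : 2 < n) (x y : E n) :
    kerH x y = ((n : ℝ) - 2)⁻¹ * kerBase x y ^ (-((n : ℝ) - 2) / 2) := by
  set t := ‖x - y‖ * ‖x - reflectLast n y‖ with ht
  have ht0 : 0 ≤ t := by positivity
  have h1 : kerBase x y = t ^ (2 : ℝ) := by
    rw [kerBase, ← mul_pow, ← ht, ← Real.rpow_natCast]; norm_num
  have h2 : (2 : ℝ) * (-((n : ℝ) - 2) / 2) = -((n - 2 : ℕ) : ℝ) := by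
    rw [Nat.cast_sub hn.le]; push_cast; ring
  rw [h1, ← Real.rpow_mul ht0, h2, Real.rpow_neg ht0, Real.rpow_natCast, kerH, mul_assoc, ← mul_pow,
    one_div, mul_inv]

theorem hasFDerivAt_norm_sub_sq {n : ℕ} (x y : E n) :
    HasFDerivAt (fun x : E n => ‖x - y‖ ^ 2) ((2 : ℝ) • innerSL ℝ (x - y)) x := by
  have h := (hasStrictFDerivAt_norm_sq (x - y)).hasFDerivAt.comp x
    ((hasFDerivAt_id (𝕜 := ℝ) x).sub_const y)
  rw [← Nat.cast_smul_eq_nsmul ℝ 2] at h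
  exact_mod_cast h

theorem innerSL_stdVec {n : ℕ} (v : E n) (j : Fin n) : innerSL ℝ v (stdVec j) = v j := by
  simp [stdVec, EuclideanSpace.inner_single_right]

theorem kerBase_hasFDerivAt (x y : E n) : HasFDerivAt (fun x => kerBase x y)
    (‖x - y‖ ^ 2 • (2 : ℝ) • innerSL ℝ (x - reflectLast n y) +
      ‖x - reflectLast n y‖ ^ 2 • (2 : ℝ) • innerSL ℝ (x - y)) x :=
  (hasFDerivAt_norm_sub_sq x y).mul (hasFDerivAt_norm_sub_sq x (reflectLast n y))

theorem fderiv_kerBase_stdVec (x y : E n) (j : Fin n) :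
    fderiv ℝ (fun x => kerBase x y) x (stdVec j) = kerBaseDeriv j x y := by
  rw [(kerBase_hasFDerivAt x y).fderiv]
  simp only [add_apply, smul_apply, innerSL_stdVec, smul_eq_mul, kerBaseDeriv, PiLp.sub_apply]
  ring

theorem contDiff_kerBase (y : E n) {m : WithTop ℕ∞} : ContDiff ℝ m (fun x => kerBase x y) :=
  ((contDiff_id.sub contDiff_const).norm_sq ℝ).mul ((contDiff_id.sub contDiff_const).norm_sq ℝ)

theorem contDiffAt_kerH (hn : 2 < n) {x y : E n} (h1 : x ≠ y) (h2 : x ≠ reflectLast n y)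
    {m : WithTop ℕ∞} : ContDiffAt ℝ m (fun x => kerH x y) x := by
  simp only [kerH_eq_rpow hn]
  exact contDiffAt_const.mul ((contDiff_kerBase y).contDiffAt.rpow_const_of_ne
    (kerBase_pos h1 h2).ne')

theorem fderiv_kerH_stdVec (hn : 2 < n) {x y : E n} (h1 : x ≠ y) (h2 : x ≠ reflectLast n y)
    (j : Fin n) : fderiv ℝ (fun x => kerH x y) x (stdVec j) =
      -(1 / 2) * kerBase x y ^ (-(n : ℝ) / 2) * kerBaseDeriv j x y := by
  have hk : (n : ℝ) - 2 ≠ 0 := by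
    have : (2 : ℝ) < n := by exact_mod_cast hn
    linarith
  have hd := (((kerBase_hasFDerivAt x y).differentiableAt.hasFDerivAt).rpow_const
    (p := -((n : ℝ) - 2) / 2) (Or.inl (kerBase_pos h1 h2).ne')).const_mul ((n : ℝ) - 2)⁻¹
  simp only [kerH_eq_rpow hn]
  rw [hd.fderiv]
  simp only [smul_apply, fderiv_kerBase_stdVec, smul_eq_mul]
  rw [show -((n : ℝ) - 2) / 2 - 1 = -n / 2 by ring]
  field_simp

theorem hasFDerivAt_coord_sub {n : ℕ} (x y : E n) (j : Fin n) :
    HasFDerivAt (fun x : E n => x j - y j) (EuclideanSpace.proj j : E n →L[ℝ] ℝ) x :=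
  (EuclideanSpace.proj j : E n →L[ℝ] ℝ).hasFDerivAt.sub_const _

theorem fderiv_kerBaseDeriv (x y : E n) (j : Fin n) :
    DifferentiableAt ℝ (fun x => kerBaseDeriv j x y) x ∧
    fderiv ℝ (fun x => kerBaseDeriv j x y) x (stdVec j) =
      2 * (‖x - y‖ ^ 2 + ‖x - reflectLast n y‖ ^ 2)
        + 8 * ((x j - y j) * (x j - reflectLast n y j)) := by
  have hd := (((hasFDerivAt_coord_sub x y j).mul
    (hasFDerivAt_norm_sub_sq x (reflectLast n y))).add ((hasFDerivAt_norm_sub_sq x y).mul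
      (hasFDerivAt_coord_sub x (reflectLast n y) j))).const_mul 2
  refine ⟨hd.differentiableAt, ?_⟩
  have h1 : (EuclideanSpace.proj j : E n →L[ℝ] ℝ) (stdVec j) = 1 := by simp [stdVec]
  have h2 : fderiv ℝ (fun x => kerBaseDeriv j x y) x = _ := hd.fderiv
  rw [h2]
  simp only [add_apply, smul_apply, innerSL_stdVec, smul_eq_mul, PiLp.sub_apply, h1]
  ring

theorem fderiv_fderiv_kerH_stdVec (hn : 2 < n) {x y : E n} (h1 : x ≠ y)
    (h2 : x ≠ reflectLast n y) (j : Fin n) :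
    fderiv ℝ (fun x => fderiv ℝ (fun x => kerH x y) x (stdVec j)) x (stdVec j) =
      -(1 / 2) * kerBase x y ^ (-(n : ℝ) / 2 - 1) * (-(n : ℝ) / 2 * kerBaseDeriv j x y ^ 2 +
        kerBase x y * (2 * (‖x - y‖ ^ 2 + ‖x - reflectLast n y‖ ^ 2)
          + 8 * ((x j - y j) * (x j - reflectLast n y j)))) := by
  have hpos := kerBase_pos h1 h2
  have hev : (fun x => fderiv ℝ (fun x => kerH x y) x (stdVec j)) =ᶠ[𝓝 x]
      fun x => -(1 / 2) * kerBase x y ^ (-(n : ℝ) / 2) * kerBaseDeriv j x y := by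
    filter_upwards [isOpen_ne.mem_nhds h1, isOpen_ne.mem_nhds h2] with w hw1 hw2
    exact fderiv_kerH_stdVec hn hw1 hw2 j
  have hd := ((((kerBase_hasFDerivAt x y).differentiableAt.hasFDerivAt).rpow_const
    (p := -(n : ℝ) / 2) (Or.inl hpos.ne')).const_mul (-(1 / 2))).mul
      (fderiv_kerBaseDeriv x y j).1.hasFDerivAt
  have h3 : fderiv ℝ (fun x => -(1 / 2) * kerBase x y ^ (-(n : ℝ) / 2) * kerBaseDeriv j x y) x = _ :=
    hd.fderiv
  rw [hev.fderiv_eq, h3]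
  have h4 : kerBase x y ^ (-(n : ℝ) / 2) = kerBase x y ^ (-(n : ℝ) / 2 - 1) * kerBase x y := by
    rw [Real.rpow_sub_one hpos.ne']; field_simp
  simp only [add_apply, smul_apply, fderiv_kerBase_stdVec, (fderiv_kerBaseDeriv x y j).2,
    smul_eq_mul, h4]
  ring

theorem sub_reflectLast (x y : E n) : x - reflectLast n y =
    (x - y) + (2 * y (lastIdx n)) • stdVec (lastIdx n) := by
  change x - (y - (2 * y (lastIdx n)) • stdVec (lastIdx n)) = _
  abel

theorem reflectLast_last (y : E n) : reflectLast n y (lastIdx n) = -y (lastIdx n) := by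
  change (y - (2 * y (lastIdx n)) • stdVec (lastIdx n)) (lastIdx n) = _
  simp [stdVec]; ring

/-- The relation that closes the computation of the kernel equation: the distance to the mirror
point is a function of $\|x-y\|$, $x_n$ and $y_n$. -/
theorem norm_sub_reflectLast_sq (x y : E n) :
    ‖x - reflectLast n y‖ ^ 2 = ‖x - y‖ ^ 2 + 4 * x (lastIdx n) * y (lastIdx n) := by
  rw [sub_reflectLast, norm_add_sq_real, inner_smul_right, ← innerSL_apply_apply ℝ, innerSL_stdVec,
    norm_smul]
  have : ‖(stdVec (lastIdx n) : E n)‖ = 1 := by simp [stdVec]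
  rw [this, mul_one, Real.norm_eq_abs, sq_abs, PiLp.sub_apply]
  ring

theorem sum_mul_sub_reflectLast (x y : E n) :
    ∑ j, (x j - y j) * (x j - reflectLast n y j) =
      ‖x - y‖ ^ 2 + 2 * y (lastIdx n) * (x (lastIdx n) - y (lastIdx n)) := by
  have h : ∑ j, (x j - y j) * (x j - reflectLast n y j) = inner ℝ (x - y) (x - reflectLast n y) := by
    simp [PiLp.inner_apply, mul_comm]
  rw [h, sub_reflectLast, inner_add_right, real_inner_self_eq_norm_sq, inner_smul_right,
    ← innerSL_apply_apply ℝ, innerSL_stdVec, PiLp.sub_apply]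

/-- This is the formal adjoint of $\triangle'u=0$: differentiating the coefficient $(n-2)/x_n$ in
the adjoint first-order term cancels the zeroth-order term. -/
theorem kerH_pde (hn : 2 < n) {x y : E n} (h1 : x ≠ y) (h2 : x ≠ reflectLast n y)
    (hx : x (lastIdx n) ≠ 0) :
    ∑ j, fderiv ℝ (fun x => fderiv ℝ (fun x => kerH x y) x (stdVec j)) x (stdVec j) +
      ((n : ℝ) - 2) / x (lastIdx n) * fderiv ℝ (fun x => kerH x y) x (stdVec (lastIdx n)) = 0 := by
  have hpos := kerBase_pos h1 h2
  simp only [fderiv_fderiv_kerH_stdVec hn h1 h2, fderiv_kerH_stdVec hn h1 h2]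
  have h4 : kerBase x y ^ (-(n : ℝ) / 2) = kerBase x y ^ (-(n : ℝ) / 2 - 1) * kerBase x y := by
    rw [Real.rpow_sub_one hpos.ne']; field_simp
  have hb := norm_sub_reflectLast_sq x y
  have hp := sum_mul_sub_reflectLast x y
  have hsa : ∑ j, (x j - y j) ^ 2 = ‖x - y‖ ^ 2 := by
    rw [EuclideanSpace.real_norm_sq_eq]; rfl
  have hsb : ∑ j, (x j - reflectLast n y j) ^ 2 = ‖x - reflectLast n y‖ ^ 2 := by
    rw [EuclideanSpace.real_norm_sq_eq]; rfl
  have hsq : ∑ j, kerBaseDeriv j x y ^ 2 = 4 * (‖x - reflectLast n y‖ ^ 4 * ‖x - y‖ ^ 2 +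
      2 * ‖x - y‖ ^ 2 * ‖x - reflectLast n y‖ ^ 2 * ∑ j, (x j - y j) * (x j - reflectLast n y j) +
      ‖x - y‖ ^ 4 * ‖x - reflectLast n y‖ ^ 2) := by
    have hj : ∀ j, kerBaseDeriv j x y ^ 2 = 4 * (‖x - reflectLast n y‖ ^ 4 * (x j - y j) ^ 2 +
        2 * ‖x - y‖ ^ 2 * ‖x - reflectLast n y‖ ^ 2 * ((x j - y j) * (x j - reflectLast n y j)) +
        ‖x - y‖ ^ 4 * (x j - reflectLast n y j) ^ 2) := fun j => by
      rw [kerBaseDeriv]; ring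
    simp only [hj]
    rw [← Finset.mul_sum, Finset.sum_add_distrib, Finset.sum_add_distrib, ← Finset.mul_sum,
      ← Finset.mul_sum, ← Finset.mul_sum, hsa, hsb]
  have hlin : ∑ j, (2 * (‖x - y‖ ^ 2 + ‖x - reflectLast n y‖ ^ 2)
      + 8 * ((x j - y j) * (x j - reflectLast n y j))) =
      n * (2 * (‖x - y‖ ^ 2 + ‖x - reflectLast n y‖ ^ 2)) +
        8 * ∑ j, (x j - y j) * (x j - reflectLast n y j) := by
    rw [Finset.sum_add_distrib, Finset.sum_const, Finset.card_univ, Fintype.card_fin, nsmul_eq_mul,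
      Finset.mul_sum]
  rw [← Finset.mul_sum, Finset.sum_add_distrib, ← Finset.mul_sum, ← Finset.mul_sum,
    hsq, hlin, hp, h4, kerBaseDeriv, reflectLast_last, kerBase]
  -- The power is a common factor. With $\|x-\hat y\|^2=a+4x_ny_n$ the rest is a rational identity
  -- in $a$, $x_n$, $y_n$ and $n$.
  generalize (‖x - y‖ ^ 2 * ‖x - reflectLast n y‖ ^ 2) ^ (-(n : ℝ) / 2 - 1) = S
  rw [show ‖x - reflectLast n y‖ ^ 4 = (‖x - reflectLast n y‖ ^ 2) ^ 2 by ring,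
    show ‖x - y‖ ^ 4 = (‖x - y‖ ^ 2) ^ 2 by ring, hb]
  generalize ‖x - y‖ ^ 2 = a
  field_simp
  ring

end

section

variable {n : ℕ} [NeZero n]

/-! ### Algebra in `Cl_n` -/

/-- Left multiplication in `Cl_n` as a continuous linear map. -/
def lmulCLM {n : ℕ} (a : Cl n) : Cl n →L[ℝ] Cl n :=
  LinearMap.toContinuousLinearMap (LinearMap.mulLeft ℝ a)

@[simp] theorem lmulCLM_apply {n : ℕ} (a b : Cl n) : lmulCLM a b = a * b := rfl

/-- The projection `Q` as a continuous linear map. -/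
def clQCLM (n : ℕ) [NeZero n] : Cl n →L[ℝ] Cl n := LinearMap.toContinuousLinearMap
  { toFun := clQ
    map_add' := fun a b => by
      simp only [clQ, map_add, ← smul_add, ← add_mul]; congr 2; abel
    map_smul' := fun c a => by
      simp only [clQ, map_smul, RingHom.id_apply, ← smul_sub, smul_mul_assoc]
      exact smul_comm _ _ _ }

@[simp] theorem clQCLM_apply (a : Cl n) : clQCLM n a = clQ a := rfl

theorem clQ_add (a b : Cl n) : clQ (a + b) = clQ a + clQ b := map_add (clQCLM n) a b

theorem clQ_sub (a b : Cl n) : clQ (a - b) = clQ a - clQ b := map_sub (clQCLM n) a b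

theorem clQ_neg (a : Cl n) : clQ (-a) = -clQ a := map_neg (clQCLM n) a

theorem clQ_smul (c : ℝ) (a : Cl n) : clQ (c • a) = c • clQ a := map_smul (clQCLM n) c a

theorem clQ_sum {ι : Type*} (s : Finset ι) (f : ι → Cl n) :
    clQ (∑ i ∈ s, f i) = ∑ i ∈ s, clQ (f i) := map_sum (clQCLM n) f s

/-- The map `Q'` as a continuous linear map. -/
def clQ'CLM (n : ℕ) [NeZero n] : Cl n →L[ℝ] Cl n := LinearMap.toContinuousLinearMap
  { toFun := clQ'
    map_add' := fun a b => by
      simp only [clQ', clQ_add, mul_add, add_mul]; abel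
    map_smul' := fun c a => by
      simp only [clQ', clQ_smul, mul_smul_comm, smul_mul_assoc, RingHom.id_apply, smul_neg] }

@[simp] theorem clQ'CLM_apply (a : Cl n) : clQ'CLM n a = clQ' a := rfl

theorem clQ_of_mem {a : Cl n} (ha : a ∈ clSub n) : clQ a = 0 := by
  have := clQ_add_mul ha (zero_mem (clSub n))
  rwa [zero_mul, add_zero] at this

theorem clQ_mul_e_last {w : Cl n} (hw : w ∈ clSub n) : clQ (w * e (lastIdx n)) = w := by
  have := clQ_add_mul (zero_mem (clSub n)) hw
  rwa [zero_add] at this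

theorem clQ_mem (a : Cl n) : clQ a ∈ clSub n := by
  obtain ⟨B, hB, C, hC, rfl⟩ := exists_decomp a
  rwa [clQ_add_mul hB hC]

theorem clQ'_mem (a : Cl n) : clQ' a ∈ clSub n := by
  obtain ⟨C, hC, h⟩ := conj_mem (clQ_mem a)
  rw [clQ', h, mul_assoc, e_sq]
  simpa using hC

/-- For $a\in Cl_{n-1}e_n$ one has $e_nQ'(a)=a$. For $j\ne n$ the product stays in $Cl_{n-1}$, which
$Q$ kills. This is why the formula needs $Q$ and values in $Cl_{n-1}e_n$. -/
theorem clQ_e_mul_clQ' {a : Cl n} (ha : clQ a * e (lastIdx n) = a) (j : Fin n) :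
    clQ (e j * clQ' a) = if j = lastIdx n then clQ a else 0 := by
  split_ifs with h
  · have h1 : e (lastIdx n) * clQ' a = a := by
      rw [clQ', mul_neg, ← mul_assoc, ← mul_assoc, e_sq, neg_one_mul, neg_mul, neg_neg, ha]
    rw [h, h1]
  · exact clQ_of_mem (mul_mem (Algebra.subset_adjoin ⟨j, h, rfl⟩) (clQ'_mem a))

/-- Averaging the sum with its transpose leaves only the anticommutators, that is, the diagonal. It
serves both for Hessians and for $z_iz_j$ at the pole. -/
theorem sum_e_mul_e_mul {n : ℕ} {a : Fin n → Fin n → Cl n} (ha : ∀ i j, a i j = a j i) :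
    ∑ i, ∑ j, e i * e j * a i j = -∑ i, a i i := by
  have h1 : ∑ i, ∑ j, e i * e j * a i j = ∑ i, ∑ j, e j * e i * a i j := by
    rw [Finset.sum_comm]
    exact Finset.sum_congr rfl fun i _ => Finset.sum_congr rfl fun j _ => by rw [ha]
  have h2 : ∑ i, ∑ j, e i * e j * a i j + ∑ i, ∑ j, e j * e i * a i j
      = (-2 : ℝ) • ∑ i, a i i := by
    rw [← Finset.sum_add_distrib, Finset.smul_sum]
    refine Finset.sum_congr rfl fun i _ => ?_
    rw [← Finset.sum_add_distrib]
    simp only [← add_mul, e_mul_e]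
    rw [Finset.sum_eq_single i (fun j _ hj => by simp [hj.symm]) (by simp)]
    rw [if_pos rfl, ← Algebra.smul_def]
  rw [← h1, ← two_smul ℝ, neg_smul] at h2
  have h3 : (2 : ℝ) • (∑ i, ∑ j, e i * e j * a i j + ∑ i, a i i) = 0 := by
    rw [smul_add, h2]; simp
  exact eq_neg_of_add_eq_zero_left ((smul_eq_zero.1 h3).resolve_left two_ne_zero)

/-- The algebraic identity behind Green's formula: the value of the divergence of
`Q (h e_j M v - (D h) e_j v)` in terms of the derivatives of `h` and `v` at a point. -/
theorem clQ_divergence_identity (h : ℝ) (h1 : Fin n → ℝ) (h2 : Fin n → Fin n → ℝ)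
    (hh : ∀ i j, h2 i j = h2 j i) (v : Cl n) (v1 : Fin n → Cl n) (v2 : Fin n → Fin n → Cl n)
    (hvv : ∀ i j, v2 i j = v2 j i) (hv : clQ v * e (lastIdx n) = v)
    (hv1 : ∀ j, clQ (v1 j) * e (lastIdx n) = v1 j) (κ κ' : ℝ) :
    ∑ j, clQ (h1 j • (e j * (∑ i, e i * v1 i + κ • clQ' v)) +
        h • (e j * (∑ i, e i * v2 j i + κ • clQ' (v1 j) - (if j = lastIdx n then κ' else 0) • clQ' v))
        - ∑ i, (h2 j i • (e i * e j * v) + h1 i • (e i * e j * v1 j))) =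
      (∑ j, h2 j j + κ * h1 (lastIdx n)) • clQ v
        - h • clQ (∑ j, v2 j j - κ • v1 (lastIdx n) + κ' • v) := by
  -- The mixed first-order terms, from $\partial_jH\,e_jDu$ and from $q\,e_j\,\partial_ju$, agree
  -- after exchanging the sums and cancel.
  have s1 : ∑ j, ∑ i, h1 j • (e j * e i * v1 i) = ∑ j, ∑ i, h1 i • (e i * e j * v1 j) :=
    Finset.sum_comm
  have s3 := sum_e_mul_e_mul hvv
  have s6 := sum_e_mul_e_mul (a := fun i j => h2 i j • v) fun i j => by rw [hh]
  have s6' : ∑ j, ∑ i, h2 j i • (e i * e j * v) = -∑ i, h2 i i • v := by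
    rw [← s6, Finset.sum_comm]
    refine Finset.sum_congr rfl fun i _ => Finset.sum_congr rfl fun j _ => ?_
    rw [mul_smul_comm, hh]
  have s2 : ∀ c : Fin n → ℝ, ∑ j, c j • clQ (e j * clQ' v) = c (lastIdx n) • clQ v := fun c => by
    simp [clQ_e_mul_clQ' hv]
  have s4 : ∑ j, clQ (e j * clQ' (v1 j)) = clQ (v1 (lastIdx n)) := by
    simp [clQ_e_mul_clQ' (hv1 _)]
  have key : ∀ j, clQ (h1 j • (e j * (∑ i, e i * v1 i + κ • clQ' v)) +
        h • (e j * (∑ i, e i * v2 j i + κ • clQ' (v1 j) - (if j = lastIdx n then κ' else 0) • clQ' v))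
        - ∑ i, (h2 j i • (e i * e j * v) + h1 i • (e i * e j * v1 j))) =
      clQ (∑ i, h1 j • (e j * e i * v1 i)) + (κ * h1 j) • clQ (e j * clQ' v)
      + h • clQ (∑ i, e j * e i * v2 j i) + (h * κ) • clQ (e j * clQ' (v1 j))
      - (h * (if j = lastIdx n then κ' else 0)) • clQ (e j * clQ' v)
      - clQ (∑ i, h2 j i • (e i * e j * v)) - clQ (∑ i, h1 i • (e i * e j * v1 j)) := by
    intro j
    simp only [mul_add, mul_sub, Finset.mul_sum, smul_add, smul_sub, clQ_add, clQ_sub,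
      Finset.sum_add_distrib, mul_smul_comm, clQ_smul, smul_smul, ← mul_assoc, ← Finset.smul_sum,
      mul_comm κ]
    abel
  rw [Finset.sum_congr rfl fun j _ => key j]
  simp only [Finset.sum_add_distrib, Finset.sum_sub_distrib]
  rw [← Finset.smul_sum, ← Finset.smul_sum]
  simp only [← clQ_sum (Finset.univ (α := Fin n)) fun j => ∑ i, _]
  rw [s1, s3, s6', s4, s2 fun j => κ * h1 j, s2 fun j => h * (if j = lastIdx n then κ' else 0)]
  simp only [clQ_add, clQ_sub, clQ_neg, clQ_smul, if_true, ← Finset.sum_smul, smul_add, smul_sub,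
    add_smul, smul_smul, smul_neg]
  abel

end

section

variable {n : ℕ} [NeZero n]

/-! ### Calculus for functions with values in `Cl_n` -/

theorem fderiv_stdVec_symm {n : ℕ} {V : Type*} [NormedAddCommGroup V] [NormedSpace ℝ V]
    {f : E n → V} {x : E n} (hf : ContDiffAt ℝ 2 f x) (i j : Fin n) :
    fderiv ℝ (fun x => fderiv ℝ f x (stdVec i)) x (stdVec j) =
      fderiv ℝ (fun x => fderiv ℝ f x (stdVec j)) x (stdVec i) := by
  have hd : DifferentiableAt ℝ (fderiv ℝ f) x :=
    (hf.fderiv_right (m := 1) (by norm_num)).differentiableAt one_ne_zero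
  have h : ∀ i j : Fin n, fderiv ℝ (fun x => fderiv ℝ f x (stdVec i)) x (stdVec j) =
      fderiv ℝ (fderiv ℝ f) x (stdVec j) (stdVec i) := fun i j => by
    rw [fderiv_clm_apply hd (differentiableAt_const _)]
    simp
  rw [h, h]
  exact (hf.isSymmSndFDerivAt (by simp)).eq _ _

theorem contDiffAt_pd {n : ℕ} {u : E n → Cl n} {x : E n} (hu : ContDiffAt ℝ 2 u x) (i : Fin n) :
    ContDiffAt ℝ 1 (pd i u) x :=
  (hu.fderiv_right (m := 1) (by norm_num)).clm_apply contDiffAt_const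

theorem contDiffAt_div_last {x : E n} (hx : x (lastIdx n) ≠ 0) {m : WithTop ℕ∞} (c : ℝ) :
    ContDiffAt ℝ m (fun x : E n => c / x (lastIdx n)) x :=
  contDiffAt_const.div (EuclideanSpace.proj (lastIdx n) : E n →L[ℝ] ℝ).contDiff.contDiffAt hx

theorem diracHodge_eq (u : E n → Cl n) : diracHodge u = fun x =>
    ∑ i, lmulCLM (e i) (pd i u x) + (((n : ℝ) - 2) / x (lastIdx n)) • clQ'CLM n (u x) := rfl

theorem contDiffAt_diracHodge {u : E n → Cl n} {x : E n} (hu : ContDiffAt ℝ 2 u x)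
    (hx : x (lastIdx n) ≠ 0) : ContDiffAt ℝ 1 (diracHodge u) x := by
  rw [diracHodge_eq]
  refine (ContDiffAt.sum fun i _ => (lmulCLM (e i)).contDiff.contDiffAt.comp x
    (contDiffAt_pd hu i)).add ((contDiffAt_div_last hx _).smul ?_)
  exact (clQ'CLM n).contDiff.contDiffAt.comp x (hu.of_le (by norm_num))

theorem pd_diracHodge {u : E n → Cl n} {x : E n} (hu : ContDiffAt ℝ 2 u x)
    (hx : x (lastIdx n) ≠ 0) (j : Fin n) :
    pd j (diracHodge u) x = ∑ i, e i * pd j (pd i u) x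
      + (((n : ℝ) - 2) / x (lastIdx n)) • clQ' (pd j u x)
      - (if j = lastIdx n then ((n : ℝ) - 2) / x (lastIdx n) ^ 2 else 0) • clQ' (u x) := by
  have h1 : ∀ i, HasFDerivAt (fun x => lmulCLM (e i) (pd i u x))
      ((lmulCLM (e i)).comp (fderiv ℝ (pd i u) x)) x := fun i =>
    (lmulCLM (e i)).hasFDerivAt.comp x
      ((contDiffAt_pd hu i).differentiableAt one_ne_zero).hasFDerivAt
  have h2 : HasFDerivAt (fun x : E n => ((n : ℝ) - 2) / x (lastIdx n))
      ((-(((n : ℝ) - 2) / x (lastIdx n) ^ 2)) • (EuclideanSpace.proj (lastIdx n) : E n →L[ℝ] ℝ)) x := by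
    have h3 := ((hasDerivAt_inv hx).const_mul ((n : ℝ) - 2)).comp_hasFDerivAt x
      (EuclideanSpace.proj (lastIdx n) : E n →L[ℝ] ℝ).hasFDerivAt
    have h4 : ((n : ℝ) - 2) * -(x (lastIdx n) ^ 2)⁻¹ = -(((n : ℝ) - 2) / x (lastIdx n) ^ 2) := by
      rw [div_eq_mul_inv]; ring
    rw [h4] at h3
    exact h3
  have h5 : HasFDerivAt (fun x => clQ'CLM n (u x)) ((clQ'CLM n).comp (fderiv ℝ u x)) x :=
    (clQ'CLM n).hasFDerivAt.comp x (hu.differentiableAt two_ne_zero).hasFDerivAt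
  have h6 : HasFDerivAt (diracHodge u) _ x := (HasFDerivAt.fun_sum fun i _ => h1 i).add (h2.smul h5)
  have h7 : (EuclideanSpace.proj (lastIdx n) : E n →L[ℝ] ℝ) (stdVec j) =
      if j = lastIdx n then 1 else 0 := by
    simp [stdVec, eq_comm]
  rw [pd, h6.fderiv]
  simp only [add_apply, sum_apply, ContinuousLinearMap.comp_apply, smul_apply,
    ContinuousLinearMap.smulRight_apply, lmulCLM_apply, clQ'CLM_apply, h7, smul_eq_mul, pd]
  split_ifs <;> simp [sub_eq_add_neg, add_assoc]

/-- Membership in $Cl_{n-1}e_n$ is a fixed-point condition for a linear map, so it passes to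
derivatives. -/
theorem pd_of_forall_clQ_mul {U : Set (E n)} (hU : IsOpen U) {u : E n → Cl n}
    (hu : ∀ x ∈ U, clQ (u x) * e (lastIdx n) = u x) {x : E n} (hx : x ∈ U)
    (hd : DifferentiableAt ℝ u x) (j : Fin n) : clQ (pd j u x) * e (lastIdx n) = pd j u x := by
  set R : Cl n →L[ℝ] Cl n := LinearMap.toContinuousLinearMap (LinearMap.mulRight ℝ (e (lastIdx n)))
  have h1 : HasFDerivAt (fun x => R (clQCLM n (u x))) ((R.comp (clQCLM n)).comp (fderiv ℝ u x)) x :=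
    (R.comp (clQCLM n)).hasFDerivAt.comp x hd.hasFDerivAt
  have h2 : u =ᶠ[𝓝 x] fun x => R (clQCLM n (u x)) := by
    filter_upwards [hU.mem_nhds hx] with z hz using (hu z hz).symm
  have h3 := congrArg (fun A => A (stdVec j)) (h1.congr_of_eventuallyEq h2).fderiv
  exact h3.symm

/-! ### The field of Green's formula -/

/-- The partial derivatives of the kernel. -/
def kerHDeriv (i : Fin n) (x y : E n) : ℝ := fderiv ℝ (fun x => kerH x y) x (stdVec i)

/-- The components of the field `H v Mu - q v u`, linear in the vector `v`. -/
def greenField (u Mu : E n → Cl n) (y : E n) (j : Fin n) (x : E n) : Cl n :=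
  kerH x y • (e j * Mu x) - kerq x y * e j * u x

theorem kerq_eq_sum (hn : 2 < n) {x y : E n} (h1 : x ≠ y) (h2 : x ≠ reflectLast n y) :
    kerq x y = ∑ i, kerHDeriv i x y • e i := by
  have hd := (contDiffAt_kerH hn h1 h2 (m := 1)).differentiableAt one_ne_zero
  have h3 := (LinearMap.toContinuousLinearMap
    (Algebra.linearMap ℝ (Cl n))).hasFDerivAt.comp x hd.hasFDerivAt
  rw [kerq, dirac]
  refine Finset.sum_congr rfl fun i _ => ?_
  have h4 : pd i (fun z => algebraMap ℝ (Cl n) (kerH z y)) x =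
      algebraMap ℝ (Cl n) (kerHDeriv i x y) := congrArg (fun A => A (stdVec i)) h3.fderiv
  rw [h4, ← Algebra.commutes, ← Algebra.smul_def]

theorem greenField_eq (hn : 2 < n) {x y : E n} (h1 : x ≠ y) (h2 : x ≠ reflectLast n y)
    (u Mu : E n → Cl n) (j : Fin n) : greenField u Mu y j x =
      kerH x y • lmulCLM (e j) (Mu x) - ∑ i, kerHDeriv i x y • lmulCLM (e i * e j) (u x) := by
  rw [greenField, kerq_eq_sum hn h1 h2, Finset.sum_mul, Finset.sum_mul]
  simp only [smul_mul_assoc, lmulCLM_apply]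

theorem contDiffAt_kerHDeriv (hn : 2 < n) {x y : E n} (h1 : x ≠ y) (h2 : x ≠ reflectLast n y)
    (i : Fin n) : ContDiffAt ℝ 1 (fun x => kerHDeriv i x y) x :=
  ((contDiffAt_kerH hn h1 h2 (m := 2)).fderiv_right (m := 1) (by norm_num)).clm_apply
    contDiffAt_const

theorem ne_reflectLast {x y : E n} (hx : 0 ≤ x (lastIdx n)) (hy : 0 < y (lastIdx n)) :
    x ≠ reflectLast n y := by
  rintro rfl
  rw [reflectLast_last] at hx
  linarith

theorem nonneg_of_mem_closure {U : Set (E n)} (hU : U ⊆ upperHalfSpace n) {x : E n}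
    (hx : x ∈ closure U) : 0 ≤ x (lastIdx n) := by
  have hc : IsClosed {x : E n | 0 ≤ x (lastIdx n)} :=
    isClosed_le continuous_const (EuclideanSpace.proj (lastIdx n) : E n →L[ℝ] ℝ).continuous
  have hs : U ⊆ {x : E n | 0 ≤ x (lastIdx n)} := fun z hz =>
    (show 0 < z (lastIdx n) from hU hz).le
  exact closure_minimal hs hc hx

theorem continuousOn_greenField (hn : 2 < n) {S : Set (E n)} {y : E n} (hy : y ∉ S)
    (hy' : reflectLast n y ∉ S) {u Mu : E n → Cl n} (hu : ContinuousOn u S)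
    (hMu : ContinuousOn Mu S) (j : Fin n) : ContinuousOn (greenField u Mu y j) S := by
  have hne : ∀ x ∈ S, x ≠ y ∧ x ≠ reflectLast n y := fun x hx =>
    ⟨ne_of_mem_of_not_mem hx hy, ne_of_mem_of_not_mem hx hy'⟩
  refine ContinuousOn.congr (f := fun x => kerH x y • lmulCLM (e j) (Mu x) -
    ∑ i, kerHDeriv i x y • lmulCLM (e i * e j) (u x)) ?_
    fun x hx => greenField_eq hn (hne x hx).1 (hne x hx).2 u Mu j
  have h1 : ContinuousOn (fun x => kerH x y) S := fun x hx =>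
    (contDiffAt_kerH hn (hne x hx).1 (hne x hx).2 (m := 1)).continuousAt.continuousWithinAt
  have h2 : ∀ i, ContinuousOn (fun x => kerHDeriv i x y) S := fun i x hx =>
    (contDiffAt_kerHDeriv hn (hne x hx).1 (hne x hx).2 i).continuousAt.continuousWithinAt
  exact (h1.smul ((lmulCLM (e j)).continuous.comp_continuousOn hMu)).sub
    (continuousOn_finsetSum _ fun i _ =>
      (h2 i).smul ((lmulCLM (e i * e j)).continuous.comp_continuousOn hu))

theorem contDiffAt_greenField (hn : 2 < n) {x y : E n} (h1 : x ≠ y) (h2 : x ≠ reflectLast n y)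
    {u Mu : E n → Cl n} (hu : ContDiffAt ℝ 1 u x) (hMu : ContDiffAt ℝ 1 Mu x) (j : Fin n) :
    ContDiffAt ℝ 1 (greenField u Mu y j) x := by
  refine ContDiffAt.congr_of_eventuallyEq (f := fun x => kerH x y • lmulCLM (e j) (Mu x) -
    ∑ i, kerHDeriv i x y • lmulCLM (e i * e j) (u x)) ?_ ?_
  · exact ((contDiffAt_kerH hn h1 h2).smul ((lmulCLM (e j)).contDiff.contDiffAt.comp x hMu)).sub
      (ContDiffAt.sum fun i _ => (contDiffAt_kerHDeriv hn h1 h2 i).smul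
        ((lmulCLM (e i * e j)).contDiff.contDiffAt.comp x hu))
  · filter_upwards [isOpen_ne.mem_nhds h1, isOpen_ne.mem_nhds h2] with w hw1 hw2
    exact greenField_eq hn hw1 hw2 u Mu j

theorem fderiv_greenField (hn : 2 < n) {x y : E n} (h1 : x ≠ y) (h2 : x ≠ reflectLast n y)
    {u Mu : E n → Cl n} (hu : DifferentiableAt ℝ u x) (hMu : DifferentiableAt ℝ Mu x)
    (j : Fin n) : fderiv ℝ (greenField u Mu y j) x (stdVec j) =
      kerHDeriv j x y • (e j * Mu x) + kerH x y • (e j * pd j Mu x) -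
      ∑ i, (fderiv ℝ (fun x => kerHDeriv i x y) x (stdVec j) • (e i * e j * u x) +
        kerHDeriv i x y • (e i * e j * pd j u x)) := by
  have hev : greenField u Mu y j =ᶠ[𝓝 x] fun x => kerH x y • lmulCLM (e j) (Mu x) -
      ∑ i, kerHDeriv i x y • lmulCLM (e i * e j) (u x) := by
    filter_upwards [isOpen_ne.mem_nhds h1, isOpen_ne.mem_nhds h2] with w hw1 hw2
    exact greenField_eq hn hw1 hw2 u Mu j
  have hA := ((contDiffAt_kerH hn h1 h2 (m := 1)).differentiableAt one_ne_zero).hasFDerivAt.smul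
    ((lmulCLM (e j)).hasFDerivAt.comp x hMu.hasFDerivAt)
  have hB := fun i => ((contDiffAt_kerHDeriv hn h1 h2 i).differentiableAt
    one_ne_zero).hasFDerivAt.smul ((lmulCLM (e i * e j)).hasFDerivAt.comp x hu.hasFDerivAt)
  have hC : HasFDerivAt (fun x => kerH x y • lmulCLM (e j) (Mu x) -
      ∑ i, kerHDeriv i x y • lmulCLM (e i * e j) (u x)) _ x :=
    hA.sub (HasFDerivAt.fun_sum fun i _ => hB i)
  rw [hev.fderiv_eq, hC.fderiv]
  simp only [add_apply, sub_apply, sum_apply, ContinuousLinearMap.comp_apply, smul_apply,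
    ContinuousLinearMap.smulRight_apply, lmulCLM_apply, Function.comp_apply, pd]
  congr 1
  · rw [add_comm]; rfl
  · exact Finset.sum_congr rfl fun i _ => add_comm _ _

/-- The algebraic identity is applied with $\kappa=(n-2)/x_n$ and $\kappa'=-\partial_n\kappa$. Its
two coefficients are then the adjoint equation for $H$ and the equation for $u$. -/
theorem divg_clQ_greenField (hn : 2 < n) {U : Set (E n)} (hU : IsOpen U)
    (hUpos : U ⊆ upperHalfSpace n) {u Mu : E n → Cl n} (hu : ContDiffOn ℝ 2 u U)
    (hval : ∀ x ∈ U, clQ (u x) * e (lastIdx n) = u x) (hsol : ∀ x ∈ U, weinstein u x = 0)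
    (hMu : ∀ x ∈ U, Mu x = diracHodge u x) {y : E n} (hy : y ∈ U) {x : E n} (hx : x ∈ U \ {y}) :
    divg (fun j x => clQ (greenField u Mu y j x)) x = 0 := by
  have h1 : x ≠ y := hx.2
  have h0 : 0 < x (lastIdx n) := hUpos hx.1
  have h2 : x ≠ reflectLast n y := ne_reflectLast h0.le (hUpos hy)
  have hux : ContDiffAt ℝ 2 u x := hu.contDiffAt (hU.mem_nhds hx.1)
  have hMe : Mu =ᶠ[𝓝 x] diracHodge u := by
    filter_upwards [hU.mem_nhds hx.1] with z hz using hMu z hz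
  have hud := hux.differentiableAt two_ne_zero
  have hMx : ContDiffAt ℝ 1 Mu x :=
    (contDiffAt_diracHodge hux h0.ne').congr_of_eventuallyEq hMe
  have hMd := hMx.differentiableAt one_ne_zero
  have hpM : ∀ j, pd j Mu x = pd j (diracHodge u) x := fun j => by
    rw [pd, pd, hMe.fderiv_eq]
  have hQ : ∀ j, fderiv ℝ (fun x => clQ (greenField u Mu y j x)) x (stdVec j) =
      clQ (fderiv ℝ (greenField u Mu y j) x (stdVec j)) := fun j => by
    have := (clQCLM n).hasFDerivAt.comp x ((contDiffAt_greenField hn h1 h2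
      (hux.of_le (by norm_num)) hMx j).differentiableAt one_ne_zero).hasFDerivAt
    exact congrArg (fun A => A (stdVec j)) this.fderiv
  have key := clQ_divergence_identity (kerH x y) (fun i => kerHDeriv i x y)
    (fun j i => fderiv ℝ (fun x => kerHDeriv i x y) x (stdVec j))
    (fun i j => fderiv_stdVec_symm (contDiffAt_kerH hn h1 h2) j i) (u x) (fun i => pd i u x)
    (fun j i => pd j (pd i u) x) (fun i j => fderiv_stdVec_symm hux j i) (hval x hx.1)
    (fun j => pd_of_forall_clQ_mul hU hval hx.1 hud j)
    (((n : ℝ) - 2) / x (lastIdx n)) (((n : ℝ) - 2) / x (lastIdx n) ^ 2)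
  have hw : ∑ j, pd j (pd j u) x - (((n : ℝ) - 2) / x (lastIdx n)) • pd (lastIdx n) u x
      + (((n : ℝ) - 2) / x (lastIdx n) ^ 2) • u x = 0 := hsol x hx.1
  have hH : ∑ j, fderiv ℝ (fun x => kerHDeriv j x y) x (stdVec j) +
      ((n : ℝ) - 2) / x (lastIdx n) * kerHDeriv (lastIdx n) x y = 0 := kerH_pde hn h1 h2 h0.ne'
  have hz : clQ (0 : Cl n) = 0 := map_zero (clQCLM n)
  rw [hw, hH, hz, zero_smul, smul_zero, sub_zero] at key
  rw [← key, divg]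
  refine Finset.sum_congr rfl fun j _ => ?_
  rw [hQ, fderiv_greenField hn h1 h2 hud hMd, hpM, pd_diracHodge hux h0.ne', hMu x hx.1]
  rfl

/-! ### The principal part at the pole -/

/-- `ε^(n-1)` times the components of Green's field at `y + ε z`, written so as to make sense for
`ε = 0` also. -/
def scaledField (u Mu : E n → Cl n) (y : E n) (j : Fin n) (ε : ℝ) (z : E n) : Cl n :=
  (ε / (((n : ℝ) - 2) * ‖z‖ ^ (n - 2) * ‖y + ε • z - reflectLast n y‖ ^ (n - 2))) •
      lmulCLM (e j) (Mu (y + ε • z)) +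
    ∑ i, ((z i * ‖y + ε • z - reflectLast n y‖ ^ 2 +
        ε * ‖z‖ ^ 2 * (y + ε • z - reflectLast n y) i) /
        (‖z‖ ^ n * ‖y + ε • z - reflectLast n y‖ ^ n)) • lmulCLM (e i * e j) (u (y + ε • z))

theorem kerBase_rpow (x y : E n) : kerBase x y ^ (-(n : ℝ) / 2) =
    (‖x - y‖ ^ n * ‖x - reflectLast n y‖ ^ n)⁻¹ := by
  set t := ‖x - y‖ * ‖x - reflectLast n y‖ with ht
  have ht0 : 0 ≤ t := by positivity
  have h1 : kerBase x y = t ^ (2 : ℝ) := by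
    rw [kerBase, ← mul_pow, ← ht, ← Real.rpow_natCast]; norm_num
  rw [h1, ← Real.rpow_mul ht0, show (2 : ℝ) * (-(n : ℝ) / 2) = -n by ring, Real.rpow_neg ht0,
    Real.rpow_natCast, ← mul_pow]

/-- $H$ has order $\varepsilon^{2-n}$ and $q$ order $\varepsilon^{1-n}$ at the pole, so after
multiplication by $\varepsilon^{n-1}$ the first keeps a factor $\varepsilon$ and the second a finite
limit. -/
theorem scaledField_eq (hn : 2 < n) (u Mu : E n → Cl n) {y z : E n} {ε : ℝ} (hε : 0 < ε)
    (hz : z ≠ 0) (hne : y + ε • z ≠ reflectLast n y) (j : Fin n) :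
    scaledField u Mu y j ε z = ε ^ (n - 1) • greenField u Mu y j (y + ε • z) := by
  have h1 : y + ε • z ≠ y := by simpa [hε.ne'] using hz
  obtain ⟨k, rfl⟩ : ∃ k, n = k + 2 := ⟨n - 2, by omega⟩
  have hk : (k : ℝ) ≠ 0 := by
    have : 0 < k := by omega
    positivity
  have hz' : ‖z‖ ≠ 0 := norm_ne_zero_iff.2 hz
  have hw : ‖y + ε • z - reflectLast (k + 2) y‖ ≠ 0 := norm_ne_zero_iff.2 (sub_ne_zero.2 hne)
  have hs : ‖y + ε • z - y‖ = ε * ‖z‖ := by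
    rw [add_sub_cancel_left, norm_smul, Real.norm_of_nonneg hε.le]
  have hε0 := hε.ne'
  rw [greenField_eq hn h1 hne, scaledField, smul_sub, Finset.smul_sum]
  refine (congrArg₂ (· + ·) ?_ ?_).trans (sub_eq_add_neg _ _).symm
  · rw [smul_smul]
    congr 1
    rw [kerH, hs, Nat.add_sub_cancel, show k + 2 - 1 = k + 1 by omega, mul_pow]
    push_cast
    field_simp
    ring
  · rw [← Finset.sum_neg_distrib]
    refine Finset.sum_congr rfl fun i _ => ?_
    rw [smul_smul, ← neg_smul]
    congr 1
    rw [kerHDeriv, fderiv_kerH_stdVec hn h1 hne, kerBase_rpow, kerBaseDeriv, hs,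
      show k + 2 - 1 = k + 1 by omega, mul_pow]
    have h3 : (y + ε • z) i - y i = ε * z i := by simp
    have h4 : (y + ε • z) i - reflectLast (k + 2) y i = (y + ε • z - reflectLast (k + 2) y) i := rfl
    rw [h3, h4]
    field_simp
    ring

theorem continuousOn_scaledField (hn : 2 < n) {U : Set (E n)} {u Mu : E n → Cl n}
    (hu : ContinuousOn u U) (hMu : ContinuousOn Mu U) {y : E n} (hy' : reflectLast n y ∉ U)
    {S : Set (ℝ × E n)} (hS : ∀ p ∈ S, p.2 ≠ 0 ∧ y + p.1 • p.2 ∈ U) (j : Fin n) :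
    ContinuousOn (Function.uncurry (scaledField u Mu y j)) S := by
  have hc : Continuous fun p : ℝ × E n => y + p.1 • p.2 := by fun_prop
  have hm : MapsTo (fun p : ℝ × E n => y + p.1 • p.2) S U := fun p hp => (hS p hp).2
  have hk : (n : ℝ) - 2 ≠ 0 := by
    have : (2 : ℝ) < n := by exact_mod_cast hn
    linarith
  have hz : ∀ p ∈ S, ‖p.2‖ ≠ 0 := fun p hp => norm_ne_zero_iff.2 (hS p hp).1
  have hw : ∀ p ∈ S, ‖y + p.1 • p.2 - reflectLast n y‖ ≠ 0 := fun p hp =>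
    norm_ne_zero_iff.2 (sub_ne_zero.2 (ne_of_mem_of_not_mem (hS p hp).2 hy'))
  have hcoord : ∀ i : Fin n, Continuous fun z : E n => z i := fun i =>
    (EuclideanSpace.proj i : E n →L[ℝ] ℝ).continuous
  have hA : ContinuousOn (fun p : ℝ × E n => p.1 / (((n : ℝ) - 2) * ‖p.2‖ ^ (n - 2) *
      ‖y + p.1 • p.2 - reflectLast n y‖ ^ (n - 2))) S :=
    continuous_fst.continuousOn.div (by fun_prop) fun p hp =>
      mul_ne_zero (mul_ne_zero hk (pow_ne_zero _ (hz p hp))) (pow_ne_zero _ (hw p hp))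
  have hB : ∀ i, ContinuousOn (fun p : ℝ × E n => (p.2 i * ‖y + p.1 • p.2 - reflectLast n y‖ ^ 2 +
      p.1 * ‖p.2‖ ^ 2 * (y + p.1 • p.2 - reflectLast n y) i) /
        (‖p.2‖ ^ n * ‖y + p.1 • p.2 - reflectLast n y‖ ^ n)) S := fun i => by
    have h1 : Continuous fun p : ℝ × E n => p.2 i := (hcoord i).comp continuous_snd
    have h2 : Continuous fun p : ℝ × E n => (y + p.1 • p.2 - reflectLast n y) i :=
      (hcoord i).comp (hc.sub continuous_const)
    have h3 : Continuous fun p : ℝ × E n => ‖y + p.1 • p.2 - reflectLast n y‖ :=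
      (hc.sub continuous_const).norm
    exact ((h1.mul (h3.pow 2)).add
      ((continuous_fst.mul (continuous_snd.norm.pow 2)).mul h2)).continuousOn.div
      (by fun_prop) fun p hp => mul_ne_zero (pow_ne_zero _ (hz p hp)) (pow_ne_zero _ (hw p hp))
  exact (hA.smul ((lmulCLM (e j)).continuous.comp_continuousOn (hMu.comp hc.continuousOn hm))).add
    (continuousOn_finsetSum _ fun i _ => (hB i).smul
      ((lmulCLM (e i * e j)).continuous.comp_continuousOn (hu.comp hc.continuousOn hm)))

/-- At $\varepsilon=0$ only the $q$ term is left, with $\|y-\hat y\|=2y_n$. The radial gradient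
supplies $z_j$, and $\sum z_iz_je_ie_j=-\|z\|^2$ produces the minus sign. -/
theorem gradFlux_scaledField (hn : 2 < n) (u Mu : E n → Cl n) {y : E n}
    (hy : 0 < y (lastIdx n)) {z : E n} (hz : z ≠ 0) :
    gradFlux (fun z => step ‖z‖) (fun j z => clQ (scaledField u Mu y j 0 z)) z =
      (-(‖z‖ * deriv step ‖z‖ * (‖z‖ ^ n)⁻¹)) •
        ((2 * y (lastIdx n)) ^ (n - 2))⁻¹ • clQ (u y) := by
  have hz' : ‖z‖ ≠ 0 := norm_ne_zero_iff.2 hz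
  have hw : ‖y - reflectLast n y‖ = 2 * y (lastIdx n) := by
    rw [sub_reflectLast, sub_self, zero_add, norm_smul, Real.norm_of_nonneg (by positivity)]
    simp [stdVec]
  have h1 : ∀ j, scaledField u Mu y j 0 z =
      (‖z‖ ^ n * (2 * y (lastIdx n)) ^ (n - 2))⁻¹ • ∑ i, z i • (e i * e j * u y) := by
    intro j
    obtain ⟨k, rfl⟩ : ∃ k, n = k + 2 := ⟨n - 2, by omega⟩
    simp only [scaledField, zero_smul, add_zero, zero_div, zero_mul, zero_add, hw, lmulCLM_apply,
      Finset.smul_sum, smul_smul]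
    refine Finset.sum_congr rfl fun i _ => ?_
    congr 1
    rw [Nat.add_sub_cancel, pow_add (2 * y (lastIdx (k + 2))) k 2]
    field_simp
  have h2 := sum_e_mul_e_mul (a := fun i j => (z i * z j) • u y) fun i j => by rw [mul_comm]
  have h3 : ∑ i, (z i * z i) = ‖z‖ ^ 2 := by
    rw [EuclideanSpace.real_norm_sq_eq]
    exact Finset.sum_congr rfl fun i _ => (sq _).symm
  rw [← Finset.sum_smul, h3, Finset.sum_comm] at h2
  simp only [gradFlux, (hasFDerivAt_step_norm hz).fderiv, smul_apply, innerSL_stdVec, h1]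
  have h4 : ∀ j, ((deriv step ‖z‖ * ‖z‖⁻¹) • z j) • clQ ((‖z‖ ^ n * (2 * y (lastIdx n)) ^ (n - 2))⁻¹ •
      ∑ i, z i • (e i * e j * u y)) = (deriv step ‖z‖ * ‖z‖⁻¹ *
        (‖z‖ ^ n * (2 * y (lastIdx n)) ^ (n - 2))⁻¹) •
        clQ (∑ i, e i * e j * ((z i * z j) • u y)) := by
    intro j
    simp only [clQ_smul, clQ_sum, Finset.smul_sum, smul_smul, mul_smul_comm, smul_eq_mul]
    refine Finset.sum_congr rfl fun i _ => ?_
    congr 1; ring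
  rw [Finset.sum_congr rfl fun j _ => h4 j, ← Finset.smul_sum, ← clQ_sum, h2, clQ_neg, clQ_smul,
    ← neg_smul, smul_smul, smul_smul]
  congr 1
  field_simp

end

/-! ### Evaluation of the flux and conclusion -/

section

variable {n : ℕ} [NeZero n]

theorem flux_greenField (u Mu : E n → Cl n) (y v x : E n) :
    flux (greenField u Mu y) v x = kerH x y • (vec v * Mu x) - kerq x y * vec v * u x := by
  simp only [flux, greenField, vec_eq_sum v, smul_sub, Finset.sum_sub_distrib, Finset.sum_mul,
    Finset.mul_sum, Finset.smul_sum, smul_mul_assoc, mul_smul_comm]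
  congr 1
  exact Finset.sum_congr rfl fun j _ => smul_comm _ _ _

theorem sphereArea_pos : 0 < sphereArea n := by
  rw [sphereArea, ← measureReal_def, Measure.toSphere_real_apply_univ, finrank_euclideanSpace,
    Fintype.card_fin]
  exact mul_pos (Nat.cast_pos.2 (NeZero.pos n))
    (ENNReal.toReal_pos (Metric.measure_ball_pos _ _ one_pos).ne' measure_ball_lt_top.ne)

theorem integral_gradFlux_scaledField (hn : 2 < n) (u Mu : E n → Cl n) {y : E n}
    (hy : 0 < y (lastIdx n)) :
    ∫ z in annulus n, gradFlux (fun z => step ‖z‖) (fun j z => clQ (scaledField u Mu y j 0 z)) z =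
      (-sphereArea n) • ((2 * y (lastIdx n)) ^ (n - 2))⁻¹ • clQ (u y) := by
  have hm : MeasurableSet (annulus n) := (isCompact_annulus n).isClosed.measurableSet
  have hne : ∀ z ∈ annulus n, z ≠ 0 := by
    rintro z hz rfl
    have := hz.1
    simp only [norm_zero] at this
    linarith
  rw [setIntegral_congr_fun hm fun z hz => gradFlux_scaledField hn u Mu hy (hne z hz),
    integral_smul_const, integral_neg, setIntegral_eq_integral_of_forall_compl_eq_zero,
    integral_radial_deriv_step]
  intro z hz
  by_cases h : 1 ≤ ‖z‖
  · rw [deriv_step_of_ge (le_of_lt (not_le.1 fun h' => hz ⟨h, h'⟩))]; simp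
  · rw [deriv_step_of_le (le_of_lt (not_le.1 h))]; simp

/-- The flux of Green's field through the boundary. -/
theorem integral_flux_greenField (hn : 2 < n) {U : Set (E n)} (hU : IsOpen U)
    (hb : Bornology.IsBounded U) (hbd : HasPiecewiseC1Boundary U)
    (hUpos : U ⊆ upperHalfSpace n) {u Mu : E n → Cl n} (hu : ContDiffOn ℝ 2 u U)
    (hucont : ContinuousOn u (closure U)) (hval : ∀ x ∈ U, clQ (u x) * e (lastIdx n) = u x)
    (hsol : ∀ x ∈ U, weinstein u x = 0) (hMucont : ContinuousOn Mu (closure U))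
    (hMu : ∀ x ∈ U, Mu x = diracHodge u x) {y : E n} (hy : y ∈ U) :
    ∫ x in frontier U, clQ (flux (greenField u Mu y) (outerNormal U x) x) ∂surfaceMeasure n =
      (-sphereArea n) • ((2 * y (lastIdx n)) ^ (n - 2))⁻¹ • clQ (u y) := by
  have hy0 : 0 < y (lastIdx n) := hUpos hy
  have hyr : reflectLast n y ∉ closure U := fun h =>
    ne_reflectLast (nonneg_of_mem_closure hUpos h) hy0 rfl
  set F : Fin n → E n → Cl n := fun j x => clQ (greenField u Mu y j x) with hF
  have hFc : ∀ j, ContinuousOn (F j) (closure U \ {y}) := fun j =>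
    (clQCLM n).continuous.comp_continuousOn (continuousOn_greenField hn (fun h => h.2 rfl)
      (fun h => hyr h.1) (hucont.mono sdiff_subset) (hMucont.mono sdiff_subset) j)
  have hFd : ∀ j, ContDiffOn ℝ 1 (F j) (U \ {y}) := fun j x hx => by
    have h0 : 0 < x (lastIdx n) := hUpos hx.1
    have hux : ContDiffAt ℝ 2 u x := hu.contDiffAt (hU.mem_nhds hx.1)
    have hMe : Mu =ᶠ[𝓝 x] diracHodge u := by
      filter_upwards [hU.mem_nhds hx.1] with z hz using hMu z hz
    exact ((clQCLM n).contDiff.contDiffAt.comp x (contDiffAt_greenField hn hx.2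
      (ne_reflectLast h0.le hy0) (hux.of_le (by norm_num))
      ((contDiffAt_diracHodge hux h0.ne').congr_of_eventuallyEq hMe) j)).contDiffWithinAt
  obtain ⟨d, hd, hdU⟩ := Metric.mem_nhds_iff.1 (hU.mem_nhds hy)
  -- Since $\|z\|\le2$ on the annulus, $\varepsilon\le d/3$ keeps $y+\varepsilon z$ within $2d/3<d$
  -- of $y$.
  have hS : ∀ p ∈ Icc 0 (d / 3) ×ˢ annulus n, p.2 ≠ 0 ∧ y + p.1 • p.2 ∈ U := by
    rintro ⟨ε, z⟩ ⟨hε, hz⟩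
    refine ⟨fun h => ?_, hdU ?_⟩
    · have h1 : 1 ≤ ‖z‖ := hz.1
      have h2 : z = 0 := h
      rw [h2, norm_zero] at h1
      linarith
    · rw [Metric.mem_ball, dist_eq_norm, add_sub_cancel_left, norm_smul,
        Real.norm_of_nonneg hε.1]
      have := mul_le_mul hε.2 hz.2 (norm_nonneg _) (by positivity)
      simp only at this ⊢
      linarith
  have hkey := integral_flux_eq_integral_principal_part hn.le hU hb hbd hy hFc hFd
    (fun x hx => divg_clQ_greenField hn hU hUpos hu hval hsol hMu hy hx)
    (ε₀ := d / 3) (by positivity) (Φ := fun j ε z => clQ (scaledField u Mu y j ε z))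
    (fun j => (clQCLM n).continuous.comp_continuousOn (continuousOn_scaledField hn
      (hucont.mono subset_closure) (hMucont.mono subset_closure)
      (fun h => hyr (subset_closure h)) hS j))
    (fun j ε hε z hz => by
      have h1 := hS (ε, z) ⟨⟨hε.1.le, hε.2⟩, hz⟩
      rw [scaledField_eq hn u Mu hε.1 h1.1 (fun h => hyr (subset_closure (h ▸ h1.2))), clQ_smul])
  rw [integral_gradFlux_scaledField hn u Mu hy0] at hkey
  rw [← hkey]
  refine integral_congr_ae (Eventually.of_forall fun x => ?_)
  simp only [flux, clQ_sum, clQ_smul, hF]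

theorem integrableOn_flux_greenField (hn : 2 < n) {U : Set (E n)} (hU : IsOpen U)
    (hb : Bornology.IsBounded U) (hbd : HasPiecewiseC1Boundary U)
    (hUpos : U ⊆ upperHalfSpace n) {u Mu : E n → Cl n}
    (hucont : ContinuousOn u (closure U)) (hMucont : ContinuousOn Mu (closure U))
    {y : E n} (hy : y ∈ U) :
    IntegrableOn (fun x => flux (greenField u Mu y) (outerNormal U x) x) (frontier U)
      (surfaceMeasure n) := by
  refine integrableOn_flux_outerNormal hU hb hbd fun j => continuousOn_greenField hn ?_ ?_
    (hucont.mono frontier_subset_closure) (hMucont.mono frontier_subset_closure) j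
  · rw [hU.frontier_eq]; exact fun h => h.2 hy
  · exact fun h => ne_reflectLast
      (nonneg_of_mem_closure hUpos (frontier_subset_closure h)) (hUpos hy) rfl

end

end HypGreen

theorem theorem6 (n : ℕ) [NeZero n] (hn : 2 < n)
    (U : Set (HypGreen.E n)) (hUopen : IsOpen U) (hUconn : IsConnected U)
    (hUbdd : Bornology.IsBounded U) (hUpos : U ⊆ HypGreen.upperHalfSpace n)
    (hUbdry : HypGreen.HasPiecewiseC1Boundary U)
    (u : HypGreen.E n → HypGreen.Cl n)
    (hu : ContDiffOn ℝ 2 u U) (hucont : ContinuousOn u (closure U))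
    (hval : ∀ x ∈ U, ∃ w ∈ HypGreen.clSub n, u x = w * HypGreen.e (HypGreen.lastIdx n))
    (hsol : ∀ x ∈ U, HypGreen.weinstein u x = 0)
    -- `Mu` is the continuous extension of the Dirac-Hodge derivative of `u` to the closure of `U`
    (Mu : HypGreen.E n → HypGreen.Cl n) (hMucont : ContinuousOn Mu (closure U))
    (hMu : ∀ x ∈ U, Mu x = HypGreen.diracHodge u x)
    (y : HypGreen.E n) (hy : y ∈ U) :
    MeasureTheory.IntegrableOn
        (fun x => HypGreen.kerH x y • (HypGreen.vec (HypGreen.outerNormal U x) * Mu x)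
          - HypGreen.kerq x y * HypGreen.vec (HypGreen.outerNormal U x) * u x)
        (frontier U) (HypGreen.surfaceMeasure n) ∧
      u y = -((2 ^ (n - 2) * y (HypGreen.lastIdx n) ^ (n - 2) / HypGreen.sphereArea n) •
        HypGreen.clQ (∫ x in frontier U,
          (HypGreen.kerH x y • (HypGreen.vec (HypGreen.outerNormal U x) * Mu x)
            - HypGreen.kerq x y * HypGreen.vec (HypGreen.outerNormal U x) * u x)
          ∂(HypGreen.surfaceMeasure n))) * HypGreen.e (HypGreen.lastIdx n) := by
  have hvalQ : ∀ x ∈ U, HypGreen.clQ (u x) * HypGreen.e (HypGreen.lastIdx n) = u x := fun x hx => by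
    obtain ⟨w, hw, hux⟩ := hval x hx
    rw [hux, HypGreen.clQ_mul_e_last hw]
  have hint := HypGreen.integrableOn_flux_greenField hn hUopen hUbdd hUbdry hUpos hucont hMucont hy
  have hflux := HypGreen.integral_flux_greenField hn hUopen hUbdd hUbdry hUpos hu hucont hvalQ hsol
    hMucont hMu hy
  -- The flux was computed with $Q$ under the integral. Absolute convergence lets the continuous
  -- linear map $Q$ be taken outside.
  have hcomm := (HypGreen.clQCLM n).integral_comp_comm hint
  simp only [HypGreen.clQCLM_apply] at hcomm
  rw [hcomm] at hflux
  simp only [HypGreen.flux_greenField] at hint hflux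
  refine ⟨hint, ?_⟩
  have hy0 : 0 < y (HypGreen.lastIdx n) := hUpos hy
  have hω := HypGreen.sphereArea_pos (n := n)
  have hc : (2 ^ (n - 2) * y (HypGreen.lastIdx n) ^ (n - 2) / HypGreen.sphereArea n) *
      (-HypGreen.sphereArea n * ((2 * y (HypGreen.lastIdx n)) ^ (n - 2))⁻¹) = -1 := by
    rw [mul_pow]
    field_simp
  rw [hflux, smul_smul, smul_smul, mul_assoc, hc, neg_one_smul, neg_neg, hvalQ y hy]
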